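/- Setting. Let $d\ge 1$ and $\overline{\mathbb R}=\mathbb R\cup\{\infty\}$ (a circle; $\pm\infty$ are identified with $\infty$). For $V\colon\mathbb Z^d\to\overline{\mathbb R}$ put $I(V)=\{\mathbf n: V(\mathbf n)=\infty\}$ and let $H_V$ be the self-adjoint operator on $\ell^2(\mathbb Z^d\setminus I(V))$ given by $$(H_V\psi)(\mathbf n)=\mathbf 1_{\mathbb Z^d\setminus I(V)}(\mathbf n)(\Delta\psi)(\mathbf n)+V(\mathbf n)\psi(\mathbf n),\qquad \operatorname{dom} H_V=\Big\{\psi:\sum_{\mathbf n}|V(\mathbf n)\psi(\mathbf n)|^2<\infty\Big\},$$ where $0\cdot\infty=0$ and $\Delta$ is the sum over the $2d$ nearest neighbours. Let $\bar\sigma(H_V)\subset\overline{\mathbb R}$ be the closure of $\sigma(H_V)$ in $\overline{\mathbb R}$ if $I(V)=\varnothing$, and $\sigma(H_V)\cup\{\infty\}$ otherwise. Let $f\colon\mathbb R\to[-\infty,+\infty)$ be $1$-periodic with a simple discontinuity: $f|_{[0,1)}$ extends to a continuous map $[0,1]\to[-\infty,+\infty]$, $f(0)\ne f(1-0)$, and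 at least one of $f(0),f(1-0)$ is finite. Let $\mathcal A\subset\overline{\mathbb R}$ be one of the two closed arcs with endpoints $f(0),f(1-0)$, with a continuous injective parametrization $\varphi_{\mathcal A}\colon[-1,0]\to\mathcal A$, $\varphi_{\mathcal A}(-1)=f(1-0)$, $\varphi_{\mathcal A}(0)=f(0)$. For $t\in\mathcal A$ let $f_t$ be $f$ with its value on $\mathbb Z$ replaced by $t$, and for $\alpha\in\mathbb R^d$ let $H_t(\alpha,x)$ be the operator with potential $\mathbf n\mapsto f_t(x+\mathbf n\cdot\alpha)$. Let $\mathcal S=\mathbb R/3\mathbb Z$, $h_\alpha(y)=y+3^{-d}\sum_{\mathbf n:\{\mathbf n\cdot\alpha\}\le y}2^{-|\mathbf n|_1}$ for $y\in[0,1]$, and let $\mathcal C_\alpha$ be the closure of $h_\alpha([0,1])$ in $\mathcal S$. For $\mathbf n\in\mathbb Z^d$ and $y=\{\mathbf n\cdot\alpha\}$ let $\varphi_{\mathbf n}\colon[-1,0]\to\mathcal S$ be the increasing affine parametrization of the closed gap of $\mathcal C_\alpha$ from $h_\alpha(y-0)$ to $h_\alpha(y)$ (for $y=0$: from $h_\alpha(1)=2\equiv-1$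 to $h_\alpha(0)$). For $\theta\in\mathcal S$ the operator $H(\alpha,\theta)$ is defined by $$H(\alpha,h_\alpha(x))=H_{f(0)}(\alpha,x)\quad(x\in[0,1)),\qquad H(\alpha,\varphi_{\mathbf n}(u))=H_{\varphi_{\mathcal A}(u)}(\alpha,\{\mathbf n\cdot\alpha\})\quad(\mathbf n\in\mathbb Z^d,\ u\in[-1,0]).$$ For $t\in\mathcal A$ let $\mathcal S_{\alpha,t}=\{\varphi_{\mathbf n}(\varphi_{\mathcal A}^{-1}(t)):\mathbf n\in\mathbb Z^d\}$. Theorem. Let $\alpha\in\mathbb R^d$ have rationally independent components, in the sense that $\mathbf n\cdot\alpha\notin\mathbb Z$ for every $\mathbf n\in\mathbb Z^d\setminus\{0\}$. Then $\bar\sigma(H(\alpha,\theta))$ is the same set, denoted by $\Sigma(\alpha)$, for all $\theta\in\mathcal C_\alpha$. Also, for every $\beta\in\mathbb R^d$ and $t\in\mathcal A$, $\bar\sigma(H(\beta,\theta))$ is the same set, denoted by $\Sigma(\beta,t)$, for all $\theta\in\mathcal S_{\beta,t}$. Let $\alpha_j\to\alpha$ be any sequence of vectors with all components rational. Then, for $E\in\overline{\mathbb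 R}$ (all convergence of energies and of parameters $t_j$ being in $\overline{\mathbb R}$): (1) $E\in\Sigma(\alpha)$ if and only if there exist $\theta_j\in\mathcal C_{\alpha_j}$ and $E_j\in\bar\sigma(H(\alpha_j,\theta_j))$ with $E_j\to E$. (2) For every $t\in\mathcal A$: $E\in\Sigma(\alpha,t)$ if and only if there exist $t_j\in\mathcal A$ and $E_j\in\Sigma(\alpha_j,t_j)$ with $t_j\to t$ and $E_j\to E$. (3) The maps $\beta\mapsto\bigcup_{\theta\in\mathcal C_\beta}\bar\sigma(H(\beta,\theta))$ and $\beta\mapsto\bigcup_{\theta\in\mathcal S}\bar\sigma(H(\beta,\theta))$, $\beta\in\mathbb R^d$, are continuous at $\beta=\alpha$ with respect to the Hausdorff distance of subsets of the circle $\overline{\mathbb R}$ (with the metric inherited from the unit circle through $t\mapsto\frac{t-i}{t+i}$). -/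

import Mathlib

open Filter Topology Set

/-! ### The extended line and operators with infinite potentials

`OnePoint ℝ` is the circle `ℝ ∪ {∞}`; `+∞` and `-∞` are not distinguished in it. -/

/-- The identification of the two ends of `[-∞, +∞]`. -/
noncomputable def toCircleLine (x : EReal) : OnePoint ℝ :=
  if x = ⊤ ∨ x = ⊥ then OnePoint.infty else ((x.toReal : ℝ) : OnePoint ℝ)

/-- The real value of a point of `ℝ ∪ {∞}`, with the value `0` at `∞`
(it is only ever multiplied by `0` there). -/
noncomputable def finiteValue (v : OnePoint ℝ) : ℝ := v.elim 0 id

/-- The complex Hilbert space `ℓ²(ℤ^d)`. -/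
abbrev EllTwo (d : ℕ) : Type := lp (fun _ : Fin d → ℤ => ℂ) 2

/-- `ℓ²(ℤ^d ∖ I(V))`, where `I(V) = {n : V n = ∞}`, as a subspace of `ℓ²(ℤ^d)`. -/
def finiteSubspace {d : ℕ} (V : (Fin d → ℤ) → OnePoint ℝ) : Submodule ℂ (EllTwo d) where
  carrier := {ψ | ∀ n, V n = OnePoint.infty → ψ n = 0}
  add_mem' := by
    intro a b ha hb n hn
    simp [ha n hn, hb n hn]
  zero_mem' := by
    intro n _
    simp
  smul_mem' := by
    intro c a ha n hn
    simp [ha n hn]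

/-- The discrete Laplacian: the sum over the `2d` nearest neighbours. -/
def latticeLaplacian {d : ℕ} (ψ : (Fin d → ℤ) → ℂ) (n : Fin d → ℤ) : ℂ :=
  ∑ i : Fin d, (ψ (n + Pi.single i 1) + ψ (n - Pi.single i 1))

theorem memlp_comp_injective {ι : Type*} {ψ : ι → ℂ} (hψ : Memℓp ψ 2) {e : ι → ι}
    (he : Function.Injective e) : Memℓp (fun n => ψ (e n)) 2 := by
  have h2 : 0 < (2 : ENNReal).toReal := by norm_num
  exact memℓp_gen ((hψ.summable h2).comp_injective he)

theorem memlp_latticeLaplacian {d : ℕ} {ψ : (Fin d → ℤ) → ℂ} (hψ : Memℓp ψ 2) :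
    Memℓp (latticeLaplacian ψ) 2 := by
  have h : latticeLaplacian ψ = fun n => ∑ i ∈ (Finset.univ : Finset (Fin d)),
      (fun n => ψ (n + Pi.single i 1) + ψ (n - Pi.single i 1)) n := rfl
  rw [h]
  refine Memℓp.finsetSum _ fun i _ => ?_
  exact (memlp_comp_injective hψ (add_left_injective _)).add
    (memlp_comp_injective hψ (sub_left_injective (b := (Pi.single i 1 : Fin d → ℤ))))

open Classical in
theorem memlp_cut {ι : Type*} {ψ : ι → ℂ} (hψ : Memℓp ψ 2) (s : ι → Prop) :
    Memℓp (fun n => if s n then 0 else ψ n) 2 := by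
  have h2 : 0 < (2 : ENNReal).toReal := by norm_num
  refine memℓp_gen ((hψ.summable h2).of_nonneg_of_le (fun n => by positivity) fun n => ?_)
  split_ifs
  · simp
  · exact le_rfl

open Classical in
/-- The Schrödinger expression `(Hψ)(n) = 1_{ℤ^d ∖ I(V)}(n) (Δψ)(n) + V(n) ψ(n)` with
potential `V : ℤ^d → ℝ ∪ {∞}`, for functions `ψ` vanishing on `I(V)` (and `0 · ∞ = 0`). -/
noncomputable def schrodingerExpr {d : ℕ} (V : (Fin d → ℤ) → OnePoint ℝ)
    (ψ : (Fin d → ℤ) → ℂ) (n : Fin d → ℤ) : ℂ :=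
  if V n = OnePoint.infty then 0 else latticeLaplacian ψ n + (finiteValue (V n) : ℂ) * ψ n

theorem schrodingerExpr_add {d : ℕ} (V : (Fin d → ℤ) → OnePoint ℝ) (a b : (Fin d → ℤ) → ℂ) :
    schrodingerExpr V (a + b) = schrodingerExpr V a + schrodingerExpr V b := by
  funext n
  by_cases h : V n = OnePoint.infty
  · simp [schrodingerExpr, h]
  · simp [schrodingerExpr, h, latticeLaplacian, Finset.sum_add_distrib]
    ring

theorem schrodingerExpr_smul {d : ℕ} (V : (Fin d → ℤ) → OnePoint ℝ) (c : ℂ)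
    (a : (Fin d → ℤ) → ℂ) : schrodingerExpr V (c • a) = c • schrodingerExpr V a := by
  funext n
  by_cases h : V n = OnePoint.infty
  · simp [schrodingerExpr, h]
  · simp [schrodingerExpr, h, latticeLaplacian, Finset.mul_sum, mul_add]
    ring

/-- The discrete Schrödinger operator with potential `V : ℤ^d → ℝ ∪ {∞}`, as an unbounded
operator in the Hilbert space `ℓ²(ℤ^d ∖ I(V))`, with domain `{ψ : ∑ |V(n) ψ(n)|² < ∞}`. -/
noncomputable def schrodinger {d : ℕ} (V : (Fin d → ℤ) → OnePoint ℝ) :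
    finiteSubspace V →ₗ.[ℂ] finiteSubspace V where
  domain :=
    { carrier := {ψ | Memℓp (fun n => (finiteValue (V n) : ℂ) * (ψ : EllTwo d) n) 2}
      add_mem' := by
        intro a b ha hb
        have h := Memℓp.add ha hb
        refine (iff_of_eq (congrArg (fun g => Memℓp g 2) ?_)).mp h
        funext n
        simp [mul_add]
      zero_mem' := by
        refine (iff_of_eq (congrArg (fun g => Memℓp g 2) ?_)).mp
          (zero_memℓp (E := fun _ : Fin d → ℤ => ℂ) (p := 2))
        funext n
        simp
      smul_mem' := by
        intro c a ha
        have h := Memℓp.const_smul (𝕜 := ℂ) ha c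
        refine (iff_of_eq (congrArg (fun g => Memℓp g 2) ?_)).mp h
        funext n
        simp [mul_left_comm] }
  toFun :=
    { toFun := fun ψ =>
        ⟨⟨schrodingerExpr V ((ψ : finiteSubspace V) : EllTwo d),
          memlp_cut ((memlp_latticeLaplacian (lp.memℓp _)).add ψ.2) _⟩,
        fun n hn => by simp [schrodingerExpr, hn]⟩
      map_add' := fun a b => Subtype.ext (Subtype.ext (schrodingerExpr_add V _ _))
      map_smul' := fun c a => Subtype.ext (Subtype.ext (schrodingerExpr_smul V c _)) }

/-- The resolvent set of an unbounded operator: those `z` for which `T - z` has an everywhere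
defined bounded two-sided inverse. -/
def unboundedResolventSet {X : Type*} [NormedAddCommGroup X] [NormedSpace ℂ X]
    (T : X →ₗ.[ℂ] X) : Set ℂ :=
  {z | ∃ R : X →L[ℂ] X,
    (∀ y : X, ∃ h : R y ∈ T.domain, T ⟨R y, h⟩ - z • R y = y) ∧
    ∀ x : T.domain, R (T x - z • (x : X)) = x}

/-- The spectrum `σ(H)` of the Schrödinger operator with potential `V`. The operator is
self-adjoint in `ℓ²(ℤ^d ∖ I(V))`, so only real points have to be recorded. -/
def realSpectrum {d : ℕ} (V : (Fin d → ℤ) → OnePoint ℝ) : Set ℝ :=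
  {E | (E : ℂ) ∉ unboundedResolventSet (schrodinger V)}

open Classical in
/-- The generalized spectrum `σ̄(H) ⊆ ℝ ∪ {∞}`: the closure of `σ(H)` if the potential is
finite everywhere, and `σ(H) ∪ {∞}` otherwise. -/
noncomputable def extSpectrum {d : ℕ} (V : (Fin d → ℤ) → OnePoint ℝ) : Set (OnePoint ℝ) :=
  if ∀ n, V n ≠ OnePoint.infty then closure ((fun E : ℝ => (E : OnePoint ℝ)) '' realSpectrum V)
  else (fun E : ℝ => (E : OnePoint ℝ)) '' realSpectrum V ∪ {OnePoint.infty}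

/-! ### The potentials -/

/-- A `1`-periodic function `f : ℝ → [-∞, +∞)` with a simple discontinuity: `f` on `[0, 1)` extends
to a continuous map `[0, 1] → [-∞, +∞]`, the values `f(0)` and `f(1-0)` (here
`Function.leftLim f 1`) are different, and at least one of them is finite. -/
structure HasSimpleDiscontinuity (f : ℝ → EReal) : Prop where
  periodic : Function.Periodic f 1
  ne_top : ∀ x, f x ≠ ⊤
  continuousOn : ContinuousOn f (Ico 0 1)
  tendsto_left : Tendsto f (𝓝[<] 1) (𝓝 (Function.leftLim f 1))
  jump : f 0 ≠ Function.leftLim f 1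
  finite : f 0 ≠ ⊥ ∨ (Function.leftLim f 1 ≠ ⊥ ∧ Function.leftLim f 1 ≠ ⊤)

/-- `φ` restricted to `[-1, 0]` is a continuous injective parametrization of a closed arc in
the circle `ℝ ∪ {∞}`, with `φ(-1) = f(1-0)` and `φ(0) = f(0)`. The arc itself is
`φ '' Icc (-1) 0`; either of the two arcs with these endpoints is allowed. -/
structure IsArcParametrization (f : ℝ → EReal) (φ : ℝ → OnePoint ℝ) : Prop where
  continuousOn : ContinuousOn φ (Icc (-1) 0)
  injOn : InjOn φ (Icc (-1) 0)
  left : φ (-1) = toCircleLine (Function.leftLim f 1)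
  right : φ 0 = toCircleLine (f 0)

/-- The scalar product `n · α`. -/
def freqDot {d : ℕ} (n : Fin d → ℤ) (α : Fin d → ℝ) : ℝ := ∑ i, (n i : ℝ) * α i

/-- Rational independence of a frequency vector (together with `1`): `n · α` is an integer only
for `n = 0`. For `d = 1` this is irrationality. -/
def RationallyIndependent {d : ℕ} (α : Fin d → ℝ) : Prop :=
  ∀ n : Fin d → ℤ, n ≠ 0 → ∀ k : ℤ, freqDot n α ≠ k

open Classical in
/-- The potential `n ↦ f_t(x + n · α)` of `H_t(x)`, where `f_t` is `f` with its value at the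
integers replaced by `t`. -/
noncomputable def shiftedPotential {d : ℕ} (f : ℝ → EReal) (t : OnePoint ℝ) (α : Fin d → ℝ)
    (x : ℝ) (n : Fin d → ℤ) : OnePoint ℝ :=
  if Int.fract (x + freqDot n α) = 0 then t else toCircleLine (f (x + freqDot n α))

/-! ### The parameter circle, the set `C_α` and its gaps -/

/-- The parameter circle `𝒮`, of length `3`. -/
abbrev ParamCircle : Type := AddCircle (3 : ℝ)

instance factThreePos : Fact ((0 : ℝ) < 3) := ⟨by norm_num⟩

/-- The weight `3^{-d} 2^{-|n|₁}`; the total weight of `ℤ^d` is `1`. -/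
noncomputable def siteWeight {d : ℕ} (n : Fin d → ℤ) : ℝ :=
  ((3 : ℝ) ^ d)⁻¹ * ((2 : ℝ) ^ (∑ i, (n i).natAbs))⁻¹

open Classical in
/-- `h(y) = y + 3^{-d} ∑_{n : {n·α} ≤ y} 2^{-|n|₁}`. -/
noncomputable def hullStep {d : ℕ} (α : Fin d → ℝ) (y : ℝ) : ℝ :=
  y + ∑' n : Fin d → ℤ, if Int.fract (freqDot n α) ≤ y then siteWeight n else 0

open Classical in
/-- The left endpoint `h(y - 0)` of the gap at `y`, for `y ∈ (0, 1)`. The gap at `y = 0` starts at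
`h(1) = 2`, which is lifted to `2 - 3 = -1` so that it lies to the left of `h(0)`. -/
noncomputable def hullStepLeft {d : ℕ} (α : Fin d → ℝ) (y : ℝ) : ℝ :=
  if y = 0 then -1 else
    y + ∑' n : Fin d → ℤ, if Int.fract (freqDot n α) < y then siteWeight n else 0

/-- `C_α`, the closure in the circle `𝒮` of the range of `h : [0, 1] → [0, 2]`. -/
def paramCantor {d : ℕ} (α : Fin d → ℝ) : Set ParamCircle :=
  closure ((fun y : ℝ => ((hullStep α y : ℝ) : ParamCircle)) '' Icc 0 1)

/-- The increasing affine parametrization `φ_n` of the closed gap of `C_α` labelled by `n` (the gap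
at `{n·α}`) by `u ∈ [-1, 0]`. -/
noncomputable def gapPoint {d : ℕ} (α : Fin d → ℝ) (n : Fin d → ℤ) (u : ℝ) : ParamCircle :=
  let y := Int.fract (freqDot n α)
  ((hullStep α y + u * (hullStep α y - hullStepLeft α y) : ℝ) : ParamCircle)

/-- `𝒮_{α,t} = {φ_n(φ⁻¹(t)) : n ∈ ℤ^d}`, for the arc parametrized by `φ`. -/
def paramLevel {d : ℕ} (φ : ℝ → OnePoint ℝ) (α : Fin d → ℝ) (t : OnePoint ℝ) : Set ParamCircle :=
  {θ | ∃ u ∈ Icc (-1 : ℝ) 0, φ u = t ∧ ∃ n : Fin d → ℤ, θ = gapPoint α n u}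

/-- The representative in `[-1, 2)` of a point of the circle `𝒮`. -/
noncomputable def circleRep (θ : ParamCircle) : ℝ := (AddCircle.equivIco (3 : ℝ) (-1) θ : ℝ)

/-- The point `x ∈ [0, 1)` at which `θ` sits, that is, the only `x` for which `θ` lies between
`h(x - 0)` and `h(x)` (and, for `x = 0`, between `-1` and `h(0)`). -/
noncomputable def basePoint {d : ℕ} (α : Fin d → ℝ) (θ : ParamCircle) : ℝ :=
  sInf {y | y ∈ Icc (0 : ℝ) 1 ∧ circleRep θ ≤ hullStep α y}

/-- The coordinate `u ∈ [-1, 0]` of `θ` in the closed gap at its base point: `0` at the right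
endpoint, `-1` at the left endpoint, affine in between. If there is no gap at the base point
`x`, then `θ = h(x)` and the quotient is `0 / 0 = 0` (and plays no role, since then no
`x + n·α` is an integer). -/
noncomputable def gapCoordinate {d : ℕ} (α : Fin d → ℝ) (θ : ParamCircle) : ℝ :=
  (circleRep θ - hullStep α (basePoint α θ)) /
    (hullStep α (basePoint α θ) - hullStepLeft α (basePoint α θ))

/-- The potential of the operator `H(α, θ)`, `θ ∈ 𝒮`. At `θ = h(x)` this is the potential
`f(x + n·α)` of `H(x) = H(x+0)`. At the left endpoint of a gap at `x` it is the potential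
`f(x + n·α - 0)` of `H(x-0)`. On the gap it is the potential `f_t(x + n·α)` with `t` running
through the arc parametrized by `φ`. -/
noncomputable def hullPotential {d : ℕ} (f : ℝ → EReal) (φ : ℝ → OnePoint ℝ) (α : Fin d → ℝ)
    (θ : ParamCircle) : (Fin d → ℤ) → OnePoint ℝ :=
  shiftedPotential f (φ (gapCoordinate α θ)) α (basePoint α θ)

/-- The union spectrum `⋃_{θ ∈ Θ} σ̄(H(α, θ))`. When the spectrum is constant on
`Θ`, this is its common value. -/
noncomputable def unionSpectrum {d : ℕ} (f : ℝ → EReal) (φ : ℝ → OnePoint ℝ) (α : Fin d → ℝ)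
    (Θ : Set ParamCircle) : Set (OnePoint ℝ) :=
  ⋃ θ ∈ Θ, extSpectrum (hullPotential f φ α θ)

/-! ### Hausdorff distance in `ℝ ∪ {∞}` -/

/-- The Cayley embedding `t ↦ (t - i) / (t + i)`, `∞ ↦ 1`, of `ℝ ∪ {∞}` onto the unit circle. -/
noncomputable def cayleyPoint (t : OnePoint ℝ) : ℂ :=
  t.elim 1 (fun s : ℝ => ((s : ℂ) - Complex.I) / ((s : ℂ) + Complex.I))

/-- The Hausdorff distance of subsets of `ℝ ∪ {∞}`, for the metric that `ℝ ∪ {∞}` inherits from the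
unit circle. -/
noncomputable def circleHausdorffEDist (A B : Set (OnePoint ℝ)) : ENNReal :=
  Metric.hausdorffEDist (cayleyPoint '' A) (cayleyPoint '' B)

/-! ### Normal operators on a Hilbert space -/

section NormalOperators

variable {H : Type*} [NormedAddCommGroup H] [InnerProductSpace ℂ H] [CompleteSpace H]

/-! The proof replaces unbounded operators on varying spaces by bounded ones on all of `ℓ²(ℤ^d)`.
With Q = (V + i)⁻¹ and C = (V - i)(V + i)⁻¹, both bounded diagonal operators depending continuously
on V in the circle, U = (C + ΔQ)(1 + ΔQ)⁻¹ is unitary, and the Cayley map carries the generalized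
spectrum exactly onto the spectrum of U (`image_cayleyPoint_extSpectrum`). Infinite values of V are
then no longer special. Since ‖u‖ ≤ (1 + 2d)‖(1 + ΔQ)u‖ uniformly in V (`norm_le_plusOp`), points
near the spectrum can be detected by approximate null vectors of the pencil w(1 + ΔQ) - (C + ΔQ),
and this pencil is local.

Localization (`exists_localized_approx_null_pencil`): cutting an approximate null vector to
translates of a large box costs only a boundary term, and averaging over the translates produces a
good one. The box depends on the accuracy only, not on V. Pointwise convergence of potentials
therefore gives lower semicontinuity of the spectrum (`eventually_exists_extSpectrum_near`), while
compactness of the space of potentials gives upper semicontinuity up to translations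
(`exists_translate_tendsto_extSpectrum_near`).

It remains to identify the limits of translates. If the frequencies tend to a rationally independent
α, the limiting phase has at most one site on the discontinuity, so a limit is again a shifted
potential for α. Its value at that site is the limit of the inserted values t_j, or f(0), or f(1-0),
according to the side of approach (`exists_eq_shiftedPotential_of_tendsto`). The two one-sided
potentials are themselves limits of translates of every shifted potential with frequency α, so their
common spectrum lies in all the others (`extSpectrum_oneSided_subset`). Every limit spectrum is thus
contained in that of H_t(α, 0), with t the limit of the t_j (`mem_extSpectrum_of_tendsto`).
Conversely H_t(β, 0) tends to H_t(α, 0) as β → α, because site 0 carries t for every β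
(`tendsto_shiftedPotential_zero`).

Points of C_α have gap coordinate 0 or -1, hence one-sided potentials, and all points of 𝒮_{β,t}
give translates of H_t(β, 0). This yields the constancy statements and reduces the three convergence
statements to the two semicontinuities. -/

theorem isStarNormal_algebraMap_sub {a : H →L[ℂ] H} (ha : IsStarNormal a) (w : ℂ) :
    IsStarNormal (algebraMap ℂ (H →L[ℂ] H) w - a) := by
  have hc : Commute (algebraMap ℂ (H →L[ℂ] H) w) (star a) := Algebra.commutes _ _
  constructor
  rw [star_sub, ← algebraMap_star_comm]
  exact Commute.sub_left ((Algebra.commutes _ _ : Commute (algebraMap ℂ (H →L[ℂ] H) (star w)) _))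
    (Commute.sub_right hc.symm ha.star_comm_self)

/-- A normal operator bounded below is injective, and the orthogonal complement of its range is its
kernel, so the range is dense and the operator is invertible: there is no residual spectrum. -/
theorem exists_approx_eigenvector {a : H →L[ℂ] H} (ha : IsStarNormal a) {w : ℂ}
    (hw : w ∈ spectrum ℂ a) {ε : ℝ} (hε : 0 < ε) :
    ∃ y : H, y ≠ 0 ∧ ‖(algebraMap ℂ (H →L[ℂ] H) w - a) y‖ ≤ ε * ‖y‖ := by
  by_contra! hcon
  apply hw
  have hn : IsStarNormal (algebraMap ℂ (H →L[ℂ] H) w - a) :=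
    isStarNormal_algebraMap_sub ha w
  set b := algebraMap ℂ (H →L[ℂ] H) w - a with hb
  have hbd : ∀ y, ‖y‖ ≤ ε⁻¹ * ‖b y‖ := by
    intro y
    rcases eq_or_ne y 0 with rfl | hy
    · simp
    · rw [inv_mul_eq_div, le_div_iff₀ hε, mul_comm]
      exact (hcon y hy).le
  rw [spectrum.mem_resolventSet_iff, ContinuousLinearMap.isUnit_iff_bijective,
    ContinuousLinearMap.bijective_iff_dense_range_and_antilipschitz]
  refine ⟨?_, ⟨ε⁻¹, by positivity⟩, ?_⟩
  · rw [Submodule.topologicalClosure_eq_top_iff, ContinuousLinearMap.IsStarNormal.orthogonal_range hn]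
    rw [LinearMap.ker_eq_bot']
    intro y hy
    have := hbd y
    have hy' : b y = 0 := hy
    rw [hy', norm_zero, mul_zero] at this
    simpa using this
  · exact ContinuousLinearMap.antilipschitz_of_bound _ hbd

/-- The inverse of w - a is normal, so its norm equals its spectral radius and is attained as |k| at
a spectral point k. Then w - k⁻¹ lies in the spectrum of a, at distance 1/‖(w - a)⁻¹‖ from w. -/
theorem exists_mem_spectrum_near {a : H →L[ℂ] H} (ha : IsStarNormal a) {w : ℂ} {δ : ℝ} {y : H}
    (hy : y ≠ 0) (h : ‖(algebraMap ℂ (H →L[ℂ] H) w - a) y‖ ≤ δ * ‖y‖) :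
    ∃ w' ∈ spectrum ℂ a, dist w w' ≤ δ := by
  have hy0 : 0 < ‖y‖ := norm_pos_iff.2 hy
  have hδ : 0 ≤ δ := by
    by_contra! hδ
    have := norm_nonneg ((algebraMap ℂ (H →L[ℂ] H) w - a) y)
    nlinarith
  by_cases hw : w ∈ spectrum ℂ a
  · exact ⟨w, hw, by simpa using hδ⟩
  obtain ⟨u, hu⟩ : IsUnit (algebraMap ℂ (H →L[ℂ] H) w - a) := by
    simpa [spectrum.mem_iff] using hw
  have : Nontrivial H := ⟨y, 0, hy⟩
  have hnu : IsStarNormal (u : H →L[ℂ] H) := by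
    rw [hu]
    exact isStarNormal_algebraMap_sub ha w
  have hn : IsStarNormal (↑u⁻¹ : H →L[ℂ] H) := by
    have h1 : Commute (star (u : H →L[ℂ] H)) (↑u⁻¹ : H →L[ℂ] H) :=
      Commute.units_inv_right hnu.star_comm_self
    constructor
    have h2 : star (↑u⁻¹ : H →L[ℂ] H) = ((star u)⁻¹ : (H →L[ℂ] H)ˣ) := by
      rw [← star_inv]; rfl
    rw [h2]
    exact Commute.units_inv_left h1
  obtain ⟨k, hk, hk'⟩ := spectrum.exists_nnnorm_eq_spectralRadius (↑u⁻¹ : H →L[ℂ] H)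
  rw [hn.spectralRadius_eq_nnnorm, ENNReal.coe_inj] at hk'
  have hk'' : ‖k‖ = ‖(↑u⁻¹ : H →L[ℂ] H)‖ := congrArg NNReal.toReal hk'
  have hinv : y = (↑u⁻¹ : H →L[ℂ] H) ((u : H →L[ℂ] H) y) := by
    rw [← mul_apply_eq_comp, Units.inv_mul]; rfl
  have hle : 1 ≤ ‖k‖ * δ := by
    have h1 : ‖y‖ ≤ ‖k‖ * (δ * ‖y‖) := by
      calc ‖y‖ = ‖(↑u⁻¹ : H →L[ℂ] H) ((u : H →L[ℂ] H) y)‖ := by rw [← hinv]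
        _ ≤ ‖(↑u⁻¹ : H →L[ℂ] H)‖ * ‖(u : H →L[ℂ] H) y‖ := ContinuousLinearMap.le_opNorm _ _
        _ ≤ ‖k‖ * (δ * ‖y‖) := by rw [hk'', hu]; gcongr
    by_contra! hlt
    nlinarith
  have hk0 : k ≠ 0 := by
    rintro rfl
    simp at hle
    linarith
  have hmem : k⁻¹ ∈ spectrum ℂ (u : H →L[ℂ] H) := by
    have := (spectrum.inv_mem_iff (r := Units.mk0 k hk0) (a := u⁻¹)).1 hk
    simpa using this
  rw [hu, ← spectrum.singleton_sub_eq] at hmem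
  obtain ⟨w', hw', hk2⟩ : ∃ w' ∈ spectrum ℂ a, w - w' = k⁻¹ := by
    simpa [Set.mem_sub] using hmem
  refine ⟨w', hw', ?_⟩
  rw [dist_eq_norm, hk2, norm_inv]
  rwa [inv_le_iff_one_le_mul₀' (norm_pos_iff.2 hk0)]

/-- The indicator of an isolated spectral point is continuous on the spectrum. The functional
calculus turns it into a nonzero operator whose range consists of eigenvectors. -/
theorem exists_eigenvector_of_isolated {a : H →L[ℂ] H} (ha : IsStarNormal a) {w : ℂ}
    (hw : w ∈ spectrum ℂ a) (hiso : w ∉ closure (spectrum ℂ a \ {w})) :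
    ∃ y : H, y ≠ 0 ∧ a y = w • y := by
  classical
  set g : ℂ → ℂ := fun z => if z = w then 1 else 0 with hg
  have hcont : ContinuousOn g (spectrum ℂ a) := by
    intro z hz
    by_cases hzw : z = w
    · subst hzw
      have h1 : (closure (spectrum ℂ a \ {z}))ᶜ ∈ 𝓝 z := isClosed_closure.isOpen_compl.mem_nhds hiso
      refine ContinuousWithinAt.congr_of_eventuallyEq (f := fun _ => (1 : ℂ))
        continuousWithinAt_const ?_ (by simp [hg])
      filter_upwards [mem_nhdsWithin_of_mem_nhds h1, self_mem_nhdsWithin] with x hx hx'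
      have : x = z := by
        by_contra hne
        exact hx (subset_closure ⟨hx', hne⟩)
      simp [hg, this]
    · refine ContinuousWithinAt.congr_of_eventuallyEq (f := fun _ => (0 : ℂ))
        continuousWithinAt_const ?_ (by simp [hg, hzw])
      filter_upwards [mem_nhdsWithin_of_mem_nhds (isOpen_compl_singleton.mem_nhds hzw)] with x hx
      exact if_neg hx
  have hmul : (a - algebraMap ℂ _ w) * cfc g a = 0 := by
    have h1 : cfc (fun z : ℂ => z - w) a = a - algebraMap ℂ _ w := by
      rw [cfc_sub _ _ a, cfc_id' ℂ a, cfc_const w a]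
    rw [← h1, ← cfc_mul _ _ a]
    have : (fun z : ℂ => (z - w) * g z) = fun _ => 0 := by
      funext z
      by_cases h : z = w <;> simp [hg, h]
    rw [this]
    exact cfc_const_zero ℂ a
  -- By spectral mapping the value 1 of the indicator at w belongs to the spectrum of `cfc g a`.
  have hne : cfc g a ≠ 0 := by
    intro h0
    have h1 : g w ∈ spectrum ℂ (cfc g a) := by
      rw [cfc_map_spectrum g a]
      exact ⟨w, hw, rfl⟩
    rw [h0] at h1
    have : Nontrivial (H →L[ℂ] H) := by
      by_contra hnt
      rw [not_nontrivial_iff_subsingleton] at hnt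
      simp [spectrum.of_subsingleton] at hw
    simp [hg] at h1
  obtain ⟨x, hx⟩ : ∃ x, cfc g a x ≠ 0 := by
    by_contra! hall
    exact hne (ContinuousLinearMap.ext hall)
  refine ⟨cfc g a x, hx, ?_⟩
  have := congrArg (fun T : H →L[ℂ] H => T x) hmul
  simpa [sub_eq_zero, Algebra.algebraMap_eq_smul_one] using this

end NormalOperators

/-! ### Shifts and diagonal operators on `ℓ²` -/

section LpTwo

variable {ι : Type*}

theorem lp_two_hasSum_norm_sq (u : lp (fun _ : ι => ℂ) 2) :
    HasSum (fun n => ‖u n‖ ^ 2) (‖u‖ ^ 2) := by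
  have h := lp.hasSum_norm (p := 2) (by norm_num) u
  simpa using h

theorem lp_two_norm_le {u v : lp (fun _ : ι => ℂ) 2} {C : ℝ} (hC : 0 ≤ C)
    (h : ∀ n, ‖u n‖ ≤ C * ‖v n‖) : ‖u‖ ≤ C * ‖v‖ := by
  refine le_of_sq_le_sq ?_ (by positivity)
  rw [mul_pow]
  refine hasSum_le (fun n => ?_) (lp_two_hasSum_norm_sq u)
    ((lp_two_hasSum_norm_sq v).mul_left (C ^ 2))
  rw [← mul_pow]
  exact pow_le_pow_left₀ (norm_nonneg _) (h n) 2

/-- Multiplication by a sequence bounded by one. -/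
noncomputable def lpDiag (c : ι → ℂ) (hc : ∀ n, ‖c n‖ ≤ 1) :
    lp (fun _ : ι => ℂ) 2 →L[ℂ] lp (fun _ : ι => ℂ) 2 :=
  LinearMap.mkContinuous
    { toFun := fun u => ⟨fun n => c n * u n, by
        have h2 : 0 < (2 : ENNReal).toReal := by norm_num
        refine memℓp_gen (((lp.memℓp u).summable h2).of_nonneg_of_le (fun n => by positivity)
          fun n => ?_)
        refine Real.rpow_le_rpow (norm_nonneg _) ?_ h2.le
        rw [norm_mul]
        exact mul_le_of_le_one_left (norm_nonneg _) (hc n)⟩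
      map_add' := fun u v => lp.ext (funext fun n => mul_add _ _ _)
      map_smul' := fun a u => lp.ext (funext fun n => mul_left_comm _ _ _) } 1
    fun u => lp_two_norm_le zero_le_one fun n => by
      change ‖c n * u n‖ ≤ _
      rw [norm_mul]
      exact mul_le_mul_of_nonneg_right (hc n) (norm_nonneg _)

@[simp]
theorem lpDiag_apply (c : ι → ℂ) (hc : ∀ n, ‖c n‖ ≤ 1) (u : lp (fun _ : ι => ℂ) 2) (n : ι) :
    lpDiag c hc u n = c n * u n := rfl

/-- Composition with a permutation of the index set. -/
noncomputable def lpShift (e : ι ≃ ι) : lp (fun _ : ι => ℂ) 2 →L[ℂ] lp (fun _ : ι => ℂ) 2 :=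
  LinearMap.mkContinuous
    { toFun := fun u => ⟨fun n => u (e n), memlp_comp_injective (lp.memℓp u) e.injective⟩
      map_add' := fun u v => rfl
      map_smul' := fun a u => rfl } 1
    fun u => by
      rw [one_mul]
      refine le_of_sq_le_sq (le_of_eq ?_) (norm_nonneg _)
      exact (lp_two_hasSum_norm_sq _).unique ((e.hasSum_iff).2 (lp_two_hasSum_norm_sq u))

@[simp]
theorem lpShift_apply (e : ι ≃ ι) (u : lp (fun _ : ι => ℂ) 2) (n : ι) :
    lpShift e u n = u (e n) := rfl

theorem norm_lpShift_apply (e : ι ≃ ι) (u : lp (fun _ : ι => ℂ) 2) : ‖lpShift e u‖ = ‖u‖ :=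
  (sq_eq_sq₀ (norm_nonneg _) (norm_nonneg _)).1
    ((lp_two_hasSum_norm_sq (lpShift e u)).unique ((e.hasSum_iff).2 (lp_two_hasSum_norm_sq u)))

theorem inner_lpShift (e : ι ≃ ι) (u v : lp (fun _ : ι => ℂ) 2) :
    inner ℂ (lpShift e u) v = inner ℂ u (lpShift e.symm v) := by
  rw [lp.inner_eq_tsum, lp.inner_eq_tsum,
    ← e.symm.tsum_eq fun n => inner ℂ (lpShift e u n) (v n)]
  simp

theorem lpDiag_mul_single [DecidableEq ι] (c : ι → ℂ) (hc : ∀ n, ‖c n‖ ≤ 1) (n : ι) (a : ℂ) :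
    lpDiag c hc (lp.single 2 n a) = lp.single 2 n (c n * a) := by
  refine lp.ext (funext fun k => ?_)
  rcases eq_or_ne k n with rfl | h
  · simp
  · simp [h]

end LpTwo

/-! ### The discrete Laplacian -/

/-- The discrete Laplacian as a bounded operator. -/
noncomputable def lapOp (d : ℕ) : EllTwo d →L[ℂ] EllTwo d :=
  ∑ i : Fin d, (lpShift (Equiv.addRight (Pi.single i 1)) + lpShift (Equiv.subRight (Pi.single i 1)))

theorem lapOp_apply {d : ℕ} (u : EllTwo d) (n : Fin d → ℤ) :
    lapOp d u n = latticeLaplacian u n := by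
  simp only [lapOp, sum_apply, add_apply, lp.coeFn_sum, lp.coeFn_add, latticeLaplacian]
  exact Finset.sum_apply n Finset.univ _

theorem norm_lapOp_apply_le {d : ℕ} (u : EllTwo d) : ‖lapOp d u‖ ≤ 2 * d * ‖u‖ := by
  rw [lapOp, sum_apply]
  refine (norm_sum_le _ _).trans ?_
  calc ∑ i : Fin d, ‖(lpShift (Equiv.addRight (Pi.single i 1))
          + lpShift (Equiv.subRight (Pi.single i 1)) : EllTwo d →L[ℂ] EllTwo d) u‖
        ≤ ∑ _i : Fin d, (‖u‖ + ‖u‖) := by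
        refine Finset.sum_le_sum fun i _ => (norm_add_le _ _).trans ?_
        exact (congrArg₂ (· + ·) (norm_lpShift_apply _ u) (norm_lpShift_apply _ u)).le
    _ = 2 * d * ‖u‖ := by simp; ring

theorem inner_lapOp {d : ℕ} (u v : EllTwo d) : inner ℂ (lapOp d u) v = inner ℂ u (lapOp d v) := by
  simp only [lapOp, sum_apply, add_apply, sum_inner,
    inner_sum, inner_add_left, inner_add_right]
  refine Finset.sum_congr rfl fun i _ => ?_
  rw [inner_lpShift, inner_lpShift, add_comm]
  rfl

/-! ### The Cayley parametrization of the extended line -/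

theorem ofReal_add_I_ne_zero (s : ℝ) : (s : ℂ) + Complex.I ≠ 0 := by
  intro h
  have := congrArg Complex.im h
  simp at this

@[simp] theorem cayleyPoint_infty : cayleyPoint OnePoint.infty = 1 := rfl

theorem cayleyPoint_coe (s : ℝ) :
    cayleyPoint (s : OnePoint ℝ) = ((s : ℂ) - Complex.I) / ((s : ℂ) + Complex.I) := rfl

theorem norm_cayleyPoint (v : OnePoint ℝ) : ‖cayleyPoint v‖ = 1 := by
  induction v using OnePoint.rec with
  | infty => simp
  | coe s =>
    rw [cayleyPoint_coe, norm_div, div_eq_one_iff_eq (norm_ne_zero_iff.2 (ofReal_add_I_ne_zero s))]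
    rw [← Complex.norm_conj]
    simp

/-- The value at `v` of the function `1 / (v + i)`. -/
noncomputable def resolventPoint (v : OnePoint ℝ) : ℂ := (1 - cayleyPoint v) / (2 * Complex.I)

@[simp] theorem resolventPoint_infty : resolventPoint OnePoint.infty = 0 := by
  simp [resolventPoint]

theorem resolventPoint_coe (s : ℝ) : resolventPoint (s : OnePoint ℝ) = ((s : ℂ) + Complex.I)⁻¹ := by
  have := ofReal_add_I_ne_zero s
  rw [resolventPoint, cayleyPoint_coe]
  field_simp
  ring

theorem norm_resolventPoint_le (v : OnePoint ℝ) : ‖resolventPoint v‖ ≤ 1 := by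
  rw [resolventPoint, norm_div]
  have := norm_sub_le (1 : ℂ) (cayleyPoint v)
  rw [norm_cayleyPoint] at this
  simp at this ⊢
  linarith

theorem cayleyPoint_eq_sub (v : OnePoint ℝ) :
    cayleyPoint v = 1 - 2 * Complex.I * resolventPoint v := by
  rw [resolventPoint]
  field_simp
  ring

/-- For real s the imaginary part of 1/(s + i) is -1/(s² + 1). This identity is the source of the a
priori bounds below, which do not depend on the potential. -/
theorem im_resolventPoint (v : OnePoint ℝ) : (resolventPoint v).im = -‖resolventPoint v‖ ^ 2 := by
  induction v using OnePoint.rec with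
  | infty => simp
  | coe s =>
    rw [resolventPoint_coe, Complex.inv_im, norm_inv, inv_pow, Complex.sq_norm]
    simp [neg_div]

theorem conj_resolventPoint_mul (v : OnePoint ℝ) :
    starRingEnd ℂ (resolventPoint v) * cayleyPoint v = resolventPoint v := by
  induction v using OnePoint.rec with
  | infty => simp
  | coe s =>
    have h1 := ofReal_add_I_ne_zero s
    have h2 : (s : ℂ) - Complex.I ≠ 0 := by
      intro h
      have := congrArg Complex.im h
      simp at this
    rw [resolventPoint_coe, cayleyPoint_coe]
    simp only [map_inv₀, map_add, Complex.conj_ofReal, Complex.conj_I, ← sub_eq_add_neg]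
    field_simp

theorem tendsto_cayleyPoint_coclosedCompact :
    Tendsto (fun s : ℝ => cayleyPoint s) (coclosedCompact ℝ) (𝓝 1) := by
  have h : (fun s : ℝ => cayleyPoint s) = fun s : ℝ => 1 - 2 * Complex.I * ((s : ℂ) + Complex.I)⁻¹ := by
    funext s
    rw [cayleyPoint_eq_sub, resolventPoint_coe]
  rw [h, coclosedCompact_eq_cocompact]
  have h1 : Tendsto (fun s : ℝ => ((s : ℂ) + Complex.I)⁻¹) (cocompact ℝ) (𝓝 0) := by
    refine tendsto_inv₀_cobounded.comp ?_
    rw [← tendsto_norm_atTop_iff_cobounded]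
    refine tendsto_atTop_mono (fun s => ?_) (tendsto_norm_cocompact_atTop (E := ℝ))
    have := Complex.abs_re_le_norm ((s : ℂ) + Complex.I)
    simpa using this
  simpa using (h1.const_mul (2 * Complex.I)).const_sub 1

theorem continuous_cayleyPoint : Continuous cayleyPoint := by
  rw [OnePoint.continuous_iff]
  refine ⟨tendsto_cayleyPoint_coclosedCompact, ?_⟩
  have h : (fun s : ℝ => cayleyPoint s) = fun s : ℝ => ((s : ℂ) - Complex.I) / ((s : ℂ) + Complex.I) :=
    rfl
  rw [h]
  exact Continuous.div (by fun_prop) (by fun_prop) ofReal_add_I_ne_zero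

theorem continuous_resolventPoint : Continuous resolventPoint :=
  (continuous_const.sub continuous_cayleyPoint).div_const _

theorem cayleyPoint_coe_ne_one (s : ℝ) : cayleyPoint (s : OnePoint ℝ) ≠ 1 := by
  intro h
  have h1 := resolventPoint_coe s
  rw [resolventPoint, h] at h1
  simp at h1
  exact ofReal_add_I_ne_zero s h1.symm

theorem cayleyPoint_injective : Function.Injective cayleyPoint := by
  intro a b h
  induction a using OnePoint.rec with
  | infty =>
    induction b using OnePoint.rec with
    | infty => rfl
    | coe t => exact absurd h.symm (cayleyPoint_coe_ne_one t)
  | coe s =>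
    induction b using OnePoint.rec with
    | infty => exact absurd h (cayleyPoint_coe_ne_one s)
    | coe t =>
      have h1 : resolventPoint (s : OnePoint ℝ) = resolventPoint (t : OnePoint ℝ) := by
        rw [resolventPoint, resolventPoint, h]
      rw [resolventPoint_coe, resolventPoint_coe, inv_inj] at h1
      simpa using h1

theorem isClosedEmbedding_cayleyPoint : IsClosedEmbedding cayleyPoint :=
  continuous_cayleyPoint.isClosedEmbedding cayleyPoint_injective

theorem exists_cayleyPoint_eq {w : ℂ} (hw : ‖w‖ = 1) : ∃ v, cayleyPoint v = w := by
  rcases eq_or_ne w 1 with rfl | h1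
  · exact ⟨OnePoint.infty, rfl⟩
  have h2 : 1 - w ≠ 0 := sub_ne_zero.2 h1.symm
  have hsq : w * starRingEnd ℂ w = 1 := by rw [Complex.mul_conj, Complex.normSq_eq_norm_sq, hw]; simp
  have hw0 : w ≠ 0 := by rintro rfl; simp at hw
  have h3 : starRingEnd ℂ w = w⁻¹ := eq_inv_of_mul_eq_one_right hsq
  -- On the circle the conjugate of w is w⁻¹, which makes the inverse Cayley transform i(1 + w)/(1 -
  -- w) real.
  have h4 : starRingEnd ℂ (Complex.I * (1 + w) / (1 - w)) = Complex.I * (1 + w) / (1 - w) := by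
    have h5 : w - 1 ≠ 0 := sub_ne_zero.2 h1
    have h6 : 1 - w⁻¹ ≠ 0 := by
      intro h
      apply h1
      have := sub_eq_zero.1 h
      rw [eq_comm, inv_eq_one] at this
      exact this
    simp only [map_div₀, map_mul, map_add, map_sub, map_one, Complex.conj_I, h3]
    rw [div_eq_div_iff h6 h2]
    field_simp
    ring
  obtain ⟨s, hs⟩ := Complex.conj_eq_iff_real.1 h4
  refine ⟨(s : OnePoint ℝ), ?_⟩
  rw [cayleyPoint_coe, ← hs, div_eq_iff (by rw [hs]; exact ofReal_add_I_ne_zero s)]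
  field_simp
  ring

/-! ### The Cayley transform of a Schrödinger operator

With `Q = (V + i)⁻¹`, which is a bounded diagonal operator even where `V` is infinite, the Cayley
transform of `H` is `(C + Δ Q) (1 + Δ Q)⁻¹`, where `C` is the Cayley transform of `V`. -/

section CayleyTransform

variable {d : ℕ} (V : (Fin d → ℤ) → OnePoint ℝ)

/-- Multiplication by `1 / (V + i)`. -/
noncomputable def resDiag : EllTwo d →L[ℂ] EllTwo d :=
  lpDiag (fun n => resolventPoint (V n)) fun _ => norm_resolventPoint_le _

/-- Multiplication by `(V - i) / (V + i)`. -/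
noncomputable def cayleyDiag : EllTwo d →L[ℂ] EllTwo d :=
  lpDiag (fun n => cayleyPoint (V n)) fun _ => (norm_cayleyPoint _).le

theorem resDiag_apply (u : EllTwo d) (n : Fin d → ℤ) :
    resDiag V u n = resolventPoint (V n) * u n := rfl

theorem cayleyDiag_apply (u : EllTwo d) (n : Fin d → ℤ) :
    cayleyDiag V u n = cayleyPoint (V n) * u n := rfl

/-- The operator `(H + i) (V + i)⁻¹`. -/
noncomputable def plusOp : EllTwo d →L[ℂ] EllTwo d := 1 + lapOp d * resDiag V

/-- The operator `(H - i) (V + i)⁻¹`. -/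
noncomputable def minusOp : EllTwo d →L[ℂ] EllTwo d := cayleyDiag V + lapOp d * resDiag V

theorem plusOp_apply (u : EllTwo d) : plusOp V u = u + lapOp d (resDiag V u) := rfl

theorem minusOp_apply (u : EllTwo d) : minusOp V u = cayleyDiag V u + lapOp d (resDiag V u) := rfl

theorem cayleyDiag_eq (u : EllTwo d) :
    cayleyDiag V u = u - (2 * Complex.I) • resDiag V u := by
  refine lp.ext (funext fun n => ?_)
  change cayleyPoint (V n) * u n = u n - 2 * Complex.I * (resolventPoint (V n) * u n)
  rw [cayleyPoint_eq_sub]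
  ring

/-- The Laplacian is symmetric and contributes a real number, so only the diagonal term remains;
there each site gives -Im q |u|² = |q u|². -/
theorem im_inner_resDiag_plusOp (u : EllTwo d) :
    (inner ℂ (resDiag V u) (plusOp V u)).im = ‖resDiag V u‖ ^ 2 := by
  have h1 : (inner ℂ (resDiag V u) (lapOp d (resDiag V u))).im = 0 := by
    have : starRingEnd ℂ (inner ℂ (resDiag V u) (lapOp d (resDiag V u)))
        = inner ℂ (resDiag V u) (lapOp d (resDiag V u)) := by
      rw [inner_conj_symm, inner_lapOp]
    exact Complex.conj_eq_iff_im.1 this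
  have h2 : HasSum (fun n => (inner ℂ (resDiag V u n) (u n)).im) (inner ℂ (resDiag V u) u).im :=
    Complex.hasSum_im (lp.hasSum_inner (resDiag V u) u)
  have h3 : (fun n => (inner ℂ (resDiag V u n) (u n)).im) = fun n => ‖resDiag V u n‖ ^ 2 := by
    funext n
    rw [resDiag_apply, ← smul_eq_mul, inner_smul_left, inner_self_eq_norm_sq_to_K, norm_smul,
      mul_pow]
    have := im_resolventPoint (V n)
    change (starRingEnd ℂ (resolventPoint (V n)) * ((‖u n‖ : ℝ) : ℂ) ^ 2).im = _
    rw [← Complex.ofReal_pow, Complex.im_mul_ofReal, Complex.conj_im, this]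
    ring
  rw [plusOp_apply, inner_add_right, Complex.add_im, h1, add_zero]
  rw [h3] at h2
  exact h2.unique (lp_two_hasSum_norm_sq _)

theorem norm_resDiag_apply_le_plusOp (u : EllTwo d) : ‖resDiag V u‖ ≤ ‖plusOp V u‖ := by
  have h1 := im_inner_resDiag_plusOp V u
  have h2 := (Complex.abs_im_le_norm _).trans (norm_inner_le_norm (𝕜 := ℂ) (resDiag V u) (plusOp V u))
  rw [h1, abs_of_nonneg (by positivity)] at h2
  rcases (norm_nonneg (resDiag V u)).eq_or_lt with h | h
  · rw [← h]; exact norm_nonneg _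
  · nlinarith

/-- Write u = (1 + ΔQ)u - ΔQu and use ‖Qu‖ ≤ ‖(1 + ΔQ)u‖, ‖Δ‖ ≤ 2d. The constant is the same for all
potentials, which makes every later estimate uniform. -/
theorem norm_le_plusOp (u : EllTwo d) : ‖u‖ ≤ (1 + 2 * d) * ‖plusOp V u‖ := by
  have h1 : u = plusOp V u - lapOp d (resDiag V u) := by rw [plusOp_apply]; abel
  have h2 := norm_resDiag_apply_le_plusOp V u
  have h3 := norm_lapOp_apply_le (resDiag V u)
  calc ‖u‖ = ‖plusOp V u - lapOp d (resDiag V u)‖ := by rw [← h1]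
    _ ≤ ‖plusOp V u‖ + ‖lapOp d (resDiag V u)‖ := norm_sub_le _ _
    _ ≤ ‖plusOp V u‖ + 2 * d * ‖plusOp V u‖ := by gcongr; exact h3.trans (by gcongr)
    _ = _ := by ring

/-- Expanding the square of (1 + ΔQ)u - 2iQu, the cross term -4‖Qu‖² cancels ‖2iQu‖². This is the
isometry property of the Cayley transform. -/
theorem norm_minusOp_apply (u : EllTwo d) : ‖minusOp V u‖ = ‖plusOp V u‖ := by
  have h1 : minusOp V u = plusOp V u - (2 * Complex.I) • resDiag V u := by
    rw [minusOp_apply, plusOp_apply, cayleyDiag_eq]; abel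
  have h2 := im_inner_resDiag_plusOp V u
  have h3 := norm_sub_sq (𝕜 := ℂ) (plusOp V u) ((2 * Complex.I) • resDiag V u)
  rw [← h1, inner_smul_right, norm_smul] at h3
  have h4 : RCLike.re (2 * Complex.I * inner ℂ (plusOp V u) (resDiag V u))
      = 2 * ‖resDiag V u‖ ^ 2 := by
    rw [← inner_conj_symm, mul_assoc]
    change (2 * (Complex.I * _) : ℂ).re = _
    rw [show (2 : ℂ) = ((2 : ℝ) : ℂ) by simp, Complex.re_ofReal_mul, Complex.I_mul_re,
      Complex.conj_im, h2]
    ring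
  rw [h4] at h3
  have h5 : ‖(2 * Complex.I : ℂ)‖ = 2 := by simp
  rw [h5] at h3
  refine (sq_eq_sq₀ (norm_nonneg _) (norm_nonneg _)).1 ?_
  rw [h3]
  ring

/-- Multiplication by `1 / (V - i)`. -/
noncomputable def conjResDiag : EllTwo d →L[ℂ] EllTwo d :=
  lpDiag (fun n => starRingEnd ℂ (resolventPoint (V n))) fun n => by
    rw [RCLike.norm_conj]; exact norm_resolventPoint_le _

theorem conjResDiag_apply (u : EllTwo d) (n : Fin d → ℤ) :
    conjResDiag V u n = starRingEnd ℂ (resolventPoint (V n)) * u n := rfl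

theorem adjoint_resDiag : ContinuousLinearMap.adjoint (resDiag V) = conjResDiag V := by
  symm
  rw [ContinuousLinearMap.eq_adjoint_iff]
  intro x y
  rw [lp.inner_eq_tsum, lp.inner_eq_tsum]
  refine tsum_congr fun n => ?_
  rw [conjResDiag_apply, resDiag_apply]
  simp
  ring

theorem adjoint_lapOp : ContinuousLinearMap.adjoint (lapOp d) = lapOp d := by
  symm
  rw [ContinuousLinearMap.eq_adjoint_iff]
  exact fun x y => inner_lapOp x y

theorem conjResDiag_cayleyDiag (u : EllTwo d) : conjResDiag V (cayleyDiag V u) = resDiag V u := by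
  refine lp.ext (funext fun n => ?_)
  rw [conjResDiag_apply, cayleyDiag_apply, resDiag_apply, ← mul_assoc, conj_resolventPoint_mul]

/-- Multiplication by `(V + i) / (V - i)`. -/
noncomputable def conjCayleyDiag : EllTwo d →L[ℂ] EllTwo d :=
  lpDiag (fun n => starRingEnd ℂ (cayleyPoint (V n))) fun n => by
    rw [RCLike.norm_conj]; exact (norm_cayleyPoint _).le

theorem cayleyDiag_conjCayleyDiag (u : EllTwo d) : cayleyDiag V (conjCayleyDiag V u) = u := by
  refine lp.ext (funext fun n => ?_)
  change cayleyPoint (V n) * (starRingEnd ℂ (cayleyPoint (V n)) * u n) = u n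
  rw [← mul_assoc, Complex.mul_conj, Complex.normSq_eq_norm_sq, norm_cayleyPoint]
  simp

theorem minusOp_conjCayleyDiag (v : EllTwo d) :
    minusOp V (conjCayleyDiag V v) = v + lapOp d (conjResDiag V v) := by
  rw [minusOp_apply, cayleyDiag_conjCayleyDiag, ← conjResDiag_cayleyDiag,
    cayleyDiag_conjCayleyDiag]

theorem adjoint_plusOp : ContinuousLinearMap.adjoint (plusOp V) = 1 + conjResDiag V * lapOp d := by
  rw [plusOp, map_add, ContinuousLinearMap.mul_def, ContinuousLinearMap.adjoint_comp,
    adjoint_resDiag, adjoint_lapOp, ContinuousLinearMap.one_def, ContinuousLinearMap.adjoint_id]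
  rfl

/-- The operator is bounded below, so it suffices that its adjoint 1 + Q*Δ is injective. If v + Q*Δv
= 0, then Δv is killed by 1 + ΔQ*, which is the product of `minusOp V` and a unitary diagonal
operator, hence injective. -/
theorem isUnit_plusOp : IsUnit (plusOp V) := by
  have hinj : ∀ v : EllTwo d, v + lapOp d (conjResDiag V v) = 0 → v = 0 := by
    intro v hv
    have h2 := norm_le_plusOp V (conjCayleyDiag V v)
    rw [← norm_minusOp_apply, minusOp_conjCayleyDiag, hv, norm_zero, mul_zero] at h2
    have h3 : conjCayleyDiag V v = 0 := by simpa using h2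
    rw [← cayleyDiag_conjCayleyDiag V v, h3, map_zero]
  rw [ContinuousLinearMap.isUnit_iff_bijective,
    ContinuousLinearMap.bijective_iff_dense_range_and_antilipschitz]
  refine ⟨?_, ⟨1 + 2 * d, by positivity⟩,
    ContinuousLinearMap.antilipschitz_of_bound _ fun u => norm_le_plusOp V u⟩
  rw [Submodule.topologicalClosure_eq_top_iff, ContinuousLinearMap.orthogonal_range,
    LinearMap.ker_eq_bot']
  intro v hv
  rw [adjoint_plusOp] at hv
  have h1 : v + conjResDiag V (lapOp d v) = 0 := hv
  have h2 : lapOp d v = 0 := by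
    apply hinj
    rw [← map_add, h1, map_zero]
  rwa [h2, map_zero, add_zero] at h1

theorem minusOp_surjective : Function.Surjective (minusOp V) := by
  intro y
  have hu : IsUnit (ContinuousLinearMap.adjoint (plusOp V)) := (isUnit_plusOp V).star
  obtain ⟨z, hz⟩ := (ContinuousLinearMap.isUnit_iff_bijective.1 hu).2 (conjResDiag V y)
  rw [adjoint_plusOp] at hz
  have hz' : z + conjResDiag V (lapOp d z) = conjResDiag V y := hz
  -- With z + Q*Δz = Q*y, the vector v = y - Δz satisfies Q*v = z, so v + ΔQ*v = y.
  refine ⟨conjCayleyDiag V (y - lapOp d z), ?_⟩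
  rw [minusOp_conjCayleyDiag, map_sub (conjResDiag V), ← hz', add_sub_cancel_right]
  abel

/-- The Cayley transform `(H - i) (H + i)⁻¹`, extended by the identity to the sites at which the
potential is infinite. -/
noncomputable def cayleyOp : EllTwo d →L[ℂ] EllTwo d := minusOp V * Ring.inverse (plusOp V)

theorem cayleyOp_plusOp (u : EllTwo d) : cayleyOp V (plusOp V u) = minusOp V u := by
  have h : cayleyOp V * plusOp V = minusOp V := by
    rw [cayleyOp, mul_assoc, Ring.inverse_mul_cancel _ (isUnit_plusOp V), mul_one]
  exact congrArg (fun T : EllTwo d →L[ℂ] EllTwo d => T u) h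

theorem norm_cayleyOp_apply (y : EllTwo d) : ‖cayleyOp V y‖ = ‖y‖ := by
  obtain ⟨u, rfl⟩ := (ContinuousLinearMap.isUnit_iff_bijective.1 (isUnit_plusOp V)).2 y
  rw [cayleyOp_plusOp, norm_minusOp_apply]

/-- The isometry is onto because its range contains that of `minusOp V`. -/
theorem cayleyOp_mem_unitary : cayleyOp V ∈ unitary (EllTwo d →L[ℂ] EllTwo d) := by
  have h1 : star (cayleyOp V) * cayleyOp V = 1 :=
    (ContinuousLinearMap.norm_map_iff_adjoint_comp_self _).1 (norm_cayleyOp_apply V)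
  have h2 : IsUnit (cayleyOp V) := by
    rw [ContinuousLinearMap.isUnit_iff_bijective]
    constructor
    · rw [injective_iff_map_eq_zero]
      intro y hy
      rw [← norm_eq_zero, ← norm_cayleyOp_apply V, hy, norm_zero]
    · intro y
      obtain ⟨u, rfl⟩ := minusOp_surjective V y
      exact ⟨_, cayleyOp_plusOp V u⟩
  refine Unitary.mem_iff.2 ⟨h1, ?_⟩
  obtain ⟨b, hb⟩ := h2
  rw [← hb] at h1 ⊢
  rw [Units.mul_eq_one_iff_eq_inv.1 h1]
  simp

theorem isStarNormal_cayleyOp : IsStarNormal (cayleyOp V) := by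
  have h := Unitary.mem_iff.1 (cayleyOp_mem_unitary V)
  exact ⟨h.1.trans h.2.symm⟩

/-- The operator `w (H + i) (V + i)⁻¹ - (H - i) (V + i)⁻¹`. -/
noncomputable def pencil (w : ℂ) : EllTwo d →L[ℂ] EllTwo d := w • plusOp V - minusOp V

theorem pencil_eq (w : ℂ) :
    pencil V w = (algebraMap ℂ (EllTwo d →L[ℂ] EllTwo d) w - cayleyOp V) * plusOp V := by
  refine ContinuousLinearMap.ext fun u => ?_
  change w • plusOp V u - minusOp V u = (algebraMap ℂ (EllTwo d →L[ℂ] EllTwo d) w) (plusOp V u) -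
    cayleyOp V (plusOp V u)
  rw [cayleyOp_plusOp, Algebra.algebraMap_eq_smul_one]
  rfl

theorem mem_spectrum_cayleyOp_iff (w : ℂ) : w ∈ spectrum ℂ (cayleyOp V) ↔ ¬IsUnit (pencil V w) := by
  rw [spectrum.mem_iff, pencil_eq]
  obtain ⟨b, hb⟩ := isUnit_plusOp V
  rw [← hb, Units.isUnit_mul_units]

theorem norm_eq_one_of_mem_spectrum {w : ℂ} (hw : w ∈ spectrum ℂ (cayleyOp V)) : ‖w‖ = 1 := by
  have := Unitary.spectrum_subset_circle (𝕜 := ℂ) ⟨cayleyOp V, cayleyOp_mem_unitary V⟩ hw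
  simpa using this

theorem exists_approx_null_pencil {w : ℂ} (hw : w ∈ spectrum ℂ (cayleyOp V)) {ε : ℝ} (hε : 0 < ε) :
    ∃ u : EllTwo d, u ≠ 0 ∧ ‖pencil V w u‖ ≤ ε * ‖u‖ := by
  -- The summand 1 only keeps the divisor positive.
  set C : ℝ := ‖plusOp V‖ + 1 with hC
  have hC0 : 0 < C := by positivity
  obtain ⟨y, hy, h⟩ := exists_approx_eigenvector (isStarNormal_cayleyOp V) hw (div_pos hε hC0)
  obtain ⟨u, rfl⟩ := (ContinuousLinearMap.isUnit_iff_bijective.1 (isUnit_plusOp V)).2 y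
  refine ⟨u, fun h0 => hy (by rw [h0, map_zero]), ?_⟩
  rw [pencil_eq]
  refine h.trans ?_
  have h1 : ‖plusOp V u‖ ≤ C * ‖u‖ := (ContinuousLinearMap.le_opNorm _ _).trans (by gcongr; simp [hC])
  calc ε / C * ‖plusOp V u‖ ≤ ε / C * (C * ‖u‖) := by gcongr
    _ = ε * ‖u‖ := by field_simp

/-- The vector (1 + ΔQ)u is an approximate eigenvector of the Cayley transform; the loss 1 + 2d
comes from `norm_le_plusOp`. -/
theorem exists_mem_spectrum_of_approx_null_pencil {w : ℂ} {ε : ℝ} (hε : 0 ≤ ε) {u : EllTwo d}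
    (hu : u ≠ 0) (h : ‖pencil V w u‖ ≤ ε * ‖u‖) :
    ∃ w' ∈ spectrum ℂ (cayleyOp V), dist w w' ≤ ε * (1 + 2 * d) := by
  have h1 := norm_le_plusOp V u
  refine exists_mem_spectrum_near (isStarNormal_cayleyOp V) (y := plusOp V u) ?_ ?_
  · intro h0
    rw [h0, norm_zero, mul_zero] at h1
    exact hu (by simpa using h1)
  · rw [pencil_eq] at h
    calc _ ≤ ε * ‖u‖ := h
      _ ≤ ε * ((1 + 2 * d) * ‖plusOp V u‖) := by gcongr
      _ = _ := by ring

end CayleyTransform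

/-! ### The spectrum of the Cayley transform -/

section SpectrumCayley

variable {d : ℕ} (V : (Fin d → ℤ) → OnePoint ℝ)

theorem resolventPoint_mul_finiteValue {v : OnePoint ℝ} (hv : v ≠ OnePoint.infty) :
    resolventPoint v * ((finiteValue v : ℂ) + Complex.I) = 1 := by
  induction v using OnePoint.rec with
  | infty => exact absurd rfl hv
  | coe s =>
    rw [resolventPoint_coe]
    exact inv_mul_cancel₀ (ofReal_add_I_ne_zero s)

/-- The operator `(H - E) (V + i)⁻¹`. -/
noncomputable def shiftedOp (E : ℝ) : EllTwo d →L[ℂ] EllTwo d :=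
  1 - ((E : ℂ) + Complex.I) • resDiag V + lapOp d * resDiag V

theorem shiftedOp_apply (E : ℝ) (u : EllTwo d) (n : Fin d → ℤ) :
    shiftedOp V E u n
      = u n - ((E : ℂ) + Complex.I) * resDiag V u n + latticeLaplacian (resDiag V u) n := by
  rw [← lapOp_apply]
  rfl

/-- With w = 1 - 2iρ and ρ = (E + i)⁻¹ the pencil is -2iρ(1 + ΔQ) + 2iQ, and ρ can be factored out.
-/
theorem pencil_cayleyPoint_eq (E : ℝ) :
    pencil V (cayleyPoint E) = (-(2 * Complex.I * resolventPoint E)) • shiftedOp V E := by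
  refine ContinuousLinearMap.ext fun u => ?_
  have h1 : resolventPoint E * ((E : ℂ) + Complex.I) = 1 :=
    resolventPoint_mul_finiteValue (OnePoint.coe_ne_infty E)
  change cayleyPoint E • plusOp V u - minusOp V u = (-(2 * Complex.I * resolventPoint E)) •
    (u - ((E : ℂ) + Complex.I) • resDiag V u + lapOp d (resDiag V u))
  rw [plusOp_apply, minusOp_apply, cayleyDiag_eq, cayleyPoint_eq_sub,
    smul_add (-(2 * Complex.I * resolventPoint E)), smul_sub (-(2 * Complex.I * resolventPoint E)),
    smul_smul,
    show -(2 * Complex.I * resolventPoint E) * ((E : ℂ) + Complex.I) = -(2 * Complex.I) by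
      linear_combination (-2 * Complex.I) * h1]
  module

theorem isUnit_pencil_cayleyPoint_iff (E : ℝ) :
    IsUnit (pencil V (cayleyPoint E)) ↔ IsUnit (shiftedOp V E) := by
  have h1 : resolventPoint E * ((E : ℂ) + Complex.I) = 1 :=
    resolventPoint_mul_finiteValue (OnePoint.coe_ne_infty E)
  have h2 : resolventPoint E ≠ 0 := left_ne_zero_of_mul_eq_one h1
  have h3 : IsUnit (-(2 * Complex.I * resolventPoint E)) := by
    rw [isUnit_iff_ne_zero]
    simp [h2]
  obtain ⟨a, ha⟩ := h3
  rw [pencil_cayleyPoint_eq, ← ha]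
  exact isUnit_smul_iff a (shiftedOp V E)

theorem resDiag_mem_finiteSubspace (u : EllTwo d) : resDiag V u ∈ finiteSubspace V := by
  intro n hn
  rw [resDiag_apply, hn, resolventPoint_infty, zero_mul]

theorem memlp_finiteValue_mul_resDiag (u : EllTwo d) :
    Memℓp (fun n => (finiteValue (V n) : ℂ) * resDiag V u n) 2 := by
  classical
  have h := memlp_cut (lp.memℓp (u - Complex.I • resDiag V u)) fun n => V n = OnePoint.infty
  refine (iff_of_eq (congrArg (fun g => Memℓp g 2) ?_)).mp h
  funext n
  by_cases hn : V n = OnePoint.infty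
  · rw [resDiag_apply, hn, resolventPoint_infty]
    simp
  · rw [if_neg hn]
    change u n - Complex.I * (resolventPoint (V n) * u n)
      = finiteValue (V n) * (resolventPoint (V n) * u n)
    linear_combination (-u n) * resolventPoint_mul_finiteValue hn

theorem shiftedOp_apply_of_finite (E : ℝ) (u : EllTwo d) {n : Fin d → ℤ}
    (hn : V n ≠ OnePoint.infty) :
    shiftedOp V E u n = latticeLaplacian (resDiag V u) n
      + ((finiteValue (V n) : ℂ) - E) * resDiag V u n := by
  rw [shiftedOp_apply, resDiag_apply]
  linear_combination (-u n) * resolventPoint_mul_finiteValue hn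

-- Elements of the domain of H are exactly of the form Qu. Off the infinite sites u = (V + i)ψ is
-- forced; on them Q vanishes, so u is free there and is taken to be y - Δψ, which prescribes the
-- value y of `shiftedOp V E u`.
open Classical in
theorem exists_resDiag_eq {ψ : EllTwo d} (hψ : ψ ∈ finiteSubspace V)
    (hdom : Memℓp (fun n => (finiteValue (V n) : ℂ) * ψ n) 2) (E : ℝ) (y : EllTwo d) :
    ∃ u, resDiag V u = ψ ∧ ∀ n, shiftedOp V E u n = if V n = OnePoint.infty then y n
      else latticeLaplacian ψ n + ((finiteValue (V n) : ℂ) - E) * ψ n := by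
  have h1 : Memℓp (fun n => if V n = OnePoint.infty then (y - lapOp d ψ) n else 0) 2 := by
    refine (iff_of_eq (congrArg (fun g => Memℓp g 2) ?_)).mp
      (memlp_cut (lp.memℓp (y - lapOp d ψ)) fun n => V n ≠ OnePoint.infty)
    funext n
    by_cases hn : V n = OnePoint.infty <;> simp [hn]
  have h2 := (h1.add hdom).add ((lp.memℓp ψ).const_smul Complex.I)
  have h3 : resDiag V ⟨_, h2⟩ = ψ := by
    refine lp.ext (funext fun n => ?_)
    rw [resDiag_apply]
    change resolventPoint (V n) * ((if V n = OnePoint.infty then (y - lapOp d ψ) n else 0)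
      + finiteValue (V n) * ψ n + Complex.I * ψ n) = ψ n
    by_cases hn : V n = OnePoint.infty
    · rw [hn, resolventPoint_infty, hψ n hn, zero_mul]
    · rw [if_neg hn]
      linear_combination (ψ n) * resolventPoint_mul_finiteValue hn
  refine ⟨⟨_, h2⟩, h3, fun n => ?_⟩
  split_ifs with hn
  · rw [shiftedOp_apply, h3, hψ n hn]
    change (if V n = OnePoint.infty then (y - lapOp d ψ) n else 0)
      + finiteValue (V n) * ψ n + Complex.I * ψ n - (E + Complex.I) * 0 + latticeLaplacian ψ n = y n
    rw [if_pos hn, hψ n hn, ← lapOp_apply]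
    change y n - lapOp d ψ n + _ + _ - _ + _ = y n
    ring
  · rw [shiftedOp_apply_of_finite V E _ hn, h3]

/-- If (H - E)(V + i)⁻¹u = 0, then Qu is in the domain and in the kernel of H - E, so Qu = 0, and
then u = 0. For surjectivity the resolvent solves the equation on the finite sites, and the freedom
of u settles the infinite ones. -/
theorem isUnit_shiftedOp_of_mem_resolventSet {E : ℝ}
    (h : (E : ℂ) ∈ unboundedResolventSet (schrodinger V)) : IsUnit (shiftedOp V E) := by
  classical
  obtain ⟨R, hR1, hR2⟩ := h
  rw [ContinuousLinearMap.isUnit_iff_bijective]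
  constructor
  · rw [injective_iff_map_eq_zero]
    intro u hu
    have h0 : resDiag V u = 0 := by
      let x : (schrodinger V).domain :=
        ⟨⟨resDiag V u, resDiag_mem_finiteSubspace V u⟩, memlp_finiteValue_mul_resDiag V u⟩
      have hx : schrodinger V x - (E : ℂ) • (x : finiteSubspace V) = 0 := by
        refine Subtype.ext (lp.ext (funext fun n => ?_))
        change schrodingerExpr V (resDiag V u) n - E * resDiag V u n = 0
        by_cases hn : V n = OnePoint.infty
        · rw [schrodingerExpr, if_pos hn, resDiag_mem_finiteSubspace V u n hn]
          simp
        · rw [schrodingerExpr, if_neg hn]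
          have := shiftedOp_apply_of_finite V E u hn
          rw [hu] at this
          have h1 : (0 : ℂ) = latticeLaplacian (resDiag V u) n
            + ((finiteValue (V n) : ℂ) - E) * resDiag V u n := this
          linear_combination -h1
      have := hR2 x
      rw [hx, map_zero] at this
      exact congrArg Subtype.val this.symm
    refine lp.ext (funext fun n => ?_)
    have h1 := shiftedOp_apply V E u n
    rw [hu, h0, ← lapOp_apply, map_zero] at h1
    have h2 : (0 : ℂ) = u n - (E + Complex.I) * 0 + 0 := h1
    change u n = 0
    linear_combination -h2
  · intro y
    have hy : Memℓp (fun n => if V n = OnePoint.infty then 0 else y n) 2 := memlp_cut (lp.memℓp y) _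
    let y' : finiteSubspace V := ⟨⟨_, hy⟩, fun n hn => if_pos hn⟩
    obtain ⟨hdom, hy'⟩ := hR1 y'
    obtain ⟨u, -, hu2⟩ := exists_resDiag_eq V (R y').2 hdom E y
    refine ⟨u, lp.ext (funext fun n => ?_)⟩
    rw [hu2]
    split_ifs with hn
    · rfl
    · have h1 := congrArg (fun z : finiteSubspace V => (z : EllTwo d) n) hy'
      have h2 : schrodingerExpr V (R y' : EllTwo d) n - E * (R y' : EllTwo d) n
        = if V n = OnePoint.infty then 0 else y n := h1
      rw [schrodingerExpr, if_neg hn, if_neg hn] at h2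
      linear_combination h2

/-- The resolvent is (V + i)⁻¹ composed with the inverse of (H - E)(V + i)⁻¹, restricted to
sequences vanishing at the infinite sites. -/
theorem mem_resolventSet_of_isUnit_shiftedOp {E : ℝ} (h : IsUnit (shiftedOp V E)) :
    (E : ℂ) ∈ unboundedResolventSet (schrodinger V) := by
  classical
  obtain ⟨S, hS⟩ := h
  have hS1 : ∀ y, shiftedOp V E ((↑S⁻¹ : EllTwo d →L[ℂ] EllTwo d) y) = y := by
    intro y
    rw [← hS]
    exact congrArg (fun T : EllTwo d →L[ℂ] EllTwo d => T y) S.mul_inv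
  have hS2 : ∀ u, (↑S⁻¹ : EllTwo d →L[ℂ] EllTwo d) (shiftedOp V E u) = u := by
    intro y
    rw [← hS]
    exact congrArg (fun T : EllTwo d →L[ℂ] EllTwo d => T y) S.inv_mul
  refine ⟨((resDiag V ∘L (↑S⁻¹ : EllTwo d →L[ℂ] EllTwo d)) ∘L (finiteSubspace V).subtypeL).codRestrict
    (finiteSubspace V) fun y => resDiag_mem_finiteSubspace V _, fun y => ?_, fun x => ?_⟩
  · refine ⟨memlp_finiteValue_mul_resDiag V _, ?_⟩
    refine Subtype.ext (lp.ext (funext fun n => ?_))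
    set u := (↑S⁻¹ : EllTwo d →L[ℂ] EllTwo d) y with hu
    change schrodingerExpr V (resDiag V u) n - E * resDiag V u n = (y : EllTwo d) n
    by_cases hn : V n = OnePoint.infty
    · rw [schrodingerExpr, if_pos hn, resDiag_mem_finiteSubspace V u n hn, y.2 n hn]
      simp
    · rw [schrodingerExpr, if_neg hn, ← hS1 (y : EllTwo d), ← hu, shiftedOp_apply_of_finite V E u hn]
      ring
  -- The target 0 on the infinite sites matches (H - E)x, which vanishes there.
  · obtain ⟨u, hu1, hu2⟩ := exists_resDiag_eq V (x : finiteSubspace V).2 x.2 E 0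
    have hx : shiftedOp V E u
        = ((schrodinger V x - (E : ℂ) • (x : finiteSubspace V) : finiteSubspace V) : EllTwo d) := by
      refine lp.ext (funext fun n => ?_)
      rw [hu2]
      change _ = schrodingerExpr V ((x : finiteSubspace V) : EllTwo d) n
        - E * ((x : finiteSubspace V) : EllTwo d) n
      rw [schrodingerExpr]
      split_ifs with hn
      · rw [(x : finiteSubspace V).2 n hn]
        simp
      · ring
    refine Subtype.ext ?_
    change resDiag V ((↑S⁻¹ : EllTwo d →L[ℂ] EllTwo d)
      ((schrodinger V x - (E : ℂ) • (x : finiteSubspace V) : finiteSubspace V) : EllTwo d)) = _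
    rw [← hx, hS2, hu1]

theorem cayleyPoint_coe_mem_spectrum_iff (E : ℝ) :
    cayleyPoint E ∈ spectrum ℂ (cayleyOp V) ↔ E ∈ realSpectrum V := by
  rw [mem_spectrum_cayleyOp_iff, isUnit_pencil_cayleyPoint_iff]
  exact not_congr ⟨mem_resolventSet_of_isUnit_shiftedOp V, isUnit_shiftedOp_of_mem_resolventSet V⟩

/-- For y = (1 + ΔQ)u the equation Uy = y reduces to Qu = 0, and Q is injective when V is finite
everywhere. -/
theorem exists_infinite_of_eigenvalue_one {y : EllTwo d} (hy : y ≠ 0) (h : cayleyOp V y = y) :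
    ∃ n, V n = OnePoint.infty := by
  obtain ⟨u, rfl⟩ := (ContinuousLinearMap.isUnit_iff_bijective.1 (isUnit_plusOp V)).2 y
  rw [cayleyOp_plusOp, minusOp_apply, plusOp_apply, add_left_inj, cayleyDiag_eq, sub_eq_self,
    smul_eq_zero_iff_right (by simp)] at h
  by_contra! hV
  refine hy ?_
  have hu : u = 0 := by
    refine lp.ext (funext fun n => ?_)
    have h1 : resolventPoint (V n) * u n = 0 := by
      rw [← resDiag_apply, h]; rfl
    have h2 := resolventPoint_mul_finiteValue (hV n)
    exact (mul_eq_zero.1 h1).resolve_left (left_ne_zero_of_mul_eq_one h2)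
  rw [hu, map_zero]

/-- At w = 1 the pencil equals 2iQ, which kills the unit vector at an infinite site. -/
theorem one_mem_spectrum_of_infinite {n : Fin d → ℤ} (hn : V n = OnePoint.infty) :
    (1 : ℂ) ∈ spectrum ℂ (cayleyOp V) := by
  classical
  rw [mem_spectrum_cayleyOp_iff, ContinuousLinearMap.isUnit_iff_bijective]
  rintro ⟨h, -⟩
  have h1 : pencil V 1 (lp.single 2 n 1) = 0 := by
    change (1 : ℂ) • plusOp V _ - minusOp V _ = 0
    rw [one_smul, plusOp_apply, minusOp_apply, cayleyDiag_eq]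
    have : resDiag V (lp.single 2 n 1) = 0 := by
      rw [resDiag, lpDiag_mul_single, hn, resolventPoint_infty, zero_mul, lp.single_zero]
    rw [this]
    simp
  have h2 := h (h1.trans (map_zero _).symm)
  have h3 := congrArg (fun z : EllTwo d => z n) h2
  simp at h3

/-- Away from 1, which corresponds to ∞, this is the comparison of resolvents. With an infinite
site, 1 is always spectral. Without one, 1 is not an eigenvalue, so it cannot be isolated in the
spectrum and belongs to it only as a limit of other spectral points; this is the closure in the
definition. -/
theorem image_cayleyPoint_extSpectrum :
    cayleyPoint '' extSpectrum V = spectrum ℂ (cayleyOp V) := by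
  have hcoe : cayleyPoint '' ((fun E : ℝ => (E : OnePoint ℝ)) '' realSpectrum V)
      = spectrum ℂ (cayleyOp V) \ {1} := by
    ext w
    constructor
    · rintro ⟨_, ⟨E, hE, rfl⟩, rfl⟩
      exact ⟨(cayleyPoint_coe_mem_spectrum_iff V E).2 hE, cayleyPoint_coe_ne_one E⟩
    · rintro ⟨hw, hw1⟩
      obtain ⟨v, rfl⟩ := exists_cayleyPoint_eq (norm_eq_one_of_mem_spectrum V hw)
      induction v using OnePoint.rec with
      | infty => exact absurd rfl hw1
      | coe E => exact ⟨E, ⟨E, (cayleyPoint_coe_mem_spectrum_iff V E).1 hw, rfl⟩, rfl⟩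
  rw [extSpectrum]
  split_ifs with hV
  · rw [← isClosedEmbedding_cayleyPoint.closure_image_eq, hcoe]
    refine Subset.antisymm ?_ fun w hw => ?_
    · exact closure_minimal sdiff_subset (spectrum.isClosed _)
    · rcases eq_or_ne w 1 with rfl | hw1
      · by_contra hcl
        obtain ⟨y, hy, h⟩ := exists_eigenvector_of_isolated (isStarNormal_cayleyOp V) hw hcl
        rw [one_smul] at h
        obtain ⟨n, hn⟩ := exists_infinite_of_eigenvalue_one V hy h
        exact hV n hn
      · exact subset_closure ⟨hw, hw1⟩
  · push Not at hV
    obtain ⟨n, hn⟩ := hV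
    rw [image_union, hcoe, image_singleton, cayleyPoint_infty, sdiff_union_self, union_eq_left,
      singleton_subset_iff]
    exact one_mem_spectrum_of_infinite V hn

theorem mem_extSpectrum_iff (E : OnePoint ℝ) :
    E ∈ extSpectrum V ↔ cayleyPoint E ∈ spectrum ℂ (cayleyOp V) := by
  rw [← image_cayleyPoint_extSpectrum, cayleyPoint_injective.mem_set_image]

theorem isClosed_extSpectrum : IsClosed (extSpectrum V) := by
  have : extSpectrum V = cayleyPoint ⁻¹' spectrum ℂ (cayleyOp V) := by
    ext E; exact mem_extSpectrum_iff V E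
  rw [this]
  exact (spectrum.isClosed _).preimage continuous_cayleyPoint

theorem extSpectrum_nonempty : (extSpectrum V).Nonempty := by
  have : Nontrivial (EllTwo d) := by
    classical
    refine ⟨lp.single 2 0 1, 0, fun h => ?_⟩
    have h3 := congrArg (fun z : EllTwo d => z 0) h
    simp at h3
  rw [← image_nonempty (f := cayleyPoint), image_cayleyPoint_extSpectrum]
  exact spectrum.nonempty _

end SpectrumCayley

/-! ### Localization of approximate eigenvectors -/

section Localization

variable {d : ℕ} (V : (Fin d → ℤ) → OnePoint ℝ)

theorem pencil_apply_eq (w : ℂ) (u : EllTwo d) :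
    pencil V w u = w • u - cayleyDiag V u + (w - 1) • lapOp d (resDiag V u) := by
  change w • plusOp V u - minusOp V u = _
  rw [plusOp_apply, minusOp_apply]
  module

/-- The translation of a potential. -/
def translatePotential (m : Fin d → ℤ) (V : (Fin d → ℤ) → OnePoint ℝ) : (Fin d → ℤ) → OnePoint ℝ :=
  fun n => V (n + m)

theorem lpShift_lapOp (m : Fin d → ℤ) (u : EllTwo d) :
    lpShift (Equiv.addRight m) (lapOp d u) = lapOp d (lpShift (Equiv.addRight m) u) := by
  refine lp.ext (funext fun n => ?_)
  rw [lpShift_apply, lapOp_apply, lapOp_apply]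
  simp only [latticeLaplacian, lpShift_apply, Equiv.coe_addRight]
  refine Finset.sum_congr rfl fun i _ => ?_
  rw [add_right_comm, sub_add_eq_add_sub]

theorem pencil_translate_lpShift (m : Fin d → ℤ) (w : ℂ) (u : EllTwo d) :
    pencil (translatePotential m V) w (lpShift (Equiv.addRight m) u)
      = lpShift (Equiv.addRight m) (pencil V w u) := by
  have h1 : resDiag (translatePotential m V) (lpShift (Equiv.addRight m) u)
      = lpShift (Equiv.addRight m) (resDiag V u) := rfl
  have h2 : cayleyDiag (translatePotential m V) (lpShift (Equiv.addRight m) u)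
      = lpShift (Equiv.addRight m) (cayleyDiag V u) := rfl
  rw [pencil_apply_eq, pencil_apply_eq, h1, h2, map_add, map_sub, map_smul, map_smul, lpShift_lapOp]

theorem mem_spectrum_cayleyOp_iff_approx (w : ℂ) :
    w ∈ spectrum ℂ (cayleyOp V) ↔
      ∀ ε : ℝ, 0 < ε → ∃ u : EllTwo d, u ≠ 0 ∧ ‖pencil V w u‖ ≤ ε * ‖u‖ := by
  refine ⟨fun hw ε hε => exists_approx_null_pencil V hw hε, fun h => ?_⟩
  rw [← (spectrum.isClosed (𝕜 := ℂ) (cayleyOp V)).closure_eq, Metric.mem_closure_iff]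
  intro ε hε
  have hC : (0 : ℝ) < 1 + 2 * d := by positivity
  obtain ⟨u, hu, hu'⟩ := h (ε / 2 / (1 + 2 * d)) (by positivity)
  obtain ⟨w', hw', hd⟩ := exists_mem_spectrum_of_approx_null_pencil V (by positivity) hu hu'
  refine ⟨w', hw', ?_⟩
  rw [div_mul_cancel₀ _ hC.ne'] at hd
  linarith

theorem extSpectrum_subset_translate (m : Fin d → ℤ) :
    extSpectrum V ⊆ extSpectrum (translatePotential m V) := by
  intro E hE
  rw [mem_extSpectrum_iff, mem_spectrum_cayleyOp_iff_approx] at hE ⊢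
  intro ε hε
  obtain ⟨u, hu, hu'⟩ := hE ε hε
  refine ⟨lpShift (Equiv.addRight m) u, fun h0 => hu ?_, ?_⟩
  · rw [← norm_eq_zero, ← norm_lpShift_apply (Equiv.addRight m) u, h0, norm_zero]
  · rw [pencil_translate_lpShift, norm_lpShift_apply, norm_lpShift_apply]
    exact hu'

theorem extSpectrum_translate (m : Fin d → ℤ) : extSpectrum (translatePotential m V) = extSpectrum V := by
  refine Subset.antisymm ?_ (extSpectrum_subset_translate V m)
  have h := extSpectrum_subset_translate (translatePotential m V) (-m)
  have h2 : translatePotential (-m) (translatePotential m V) = V := by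
    funext n
    simp [translatePotential]
  rwa [h2] at h

open Classical in
/-- The restriction of a sequence to a finite set of sites. -/
noncomputable def cutOp (S : Finset (Fin d → ℤ)) : EllTwo d →L[ℂ] EllTwo d :=
  lpDiag (fun n => if n ∈ S then 1 else 0) fun n => by split_ifs <;> simp

theorem cutOp_apply_of_mem {S : Finset (Fin d → ℤ)} {n : Fin d → ℤ} (hn : n ∈ S) (u : EllTwo d) :
    cutOp S u n = u n := by
  rw [cutOp, lpDiag_apply, if_pos hn, one_mul]

theorem cutOp_apply_of_notMem {S : Finset (Fin d → ℤ)} {n : Fin d → ℤ} (hn : n ∉ S)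
    (u : EllTwo d) : cutOp S u n = 0 := by
  rw [cutOp, lpDiag_apply, if_neg hn, zero_mul]

theorem norm_sq_cutOp (S : Finset (Fin d → ℤ)) (u : EllTwo d) :
    ‖cutOp S u‖ ^ 2 = ∑ n ∈ S, ‖u n‖ ^ 2 := by
  refine (lp_two_hasSum_norm_sq _).unique ?_
  have h : ∑ n ∈ S, ‖u n‖ ^ 2 = ∑ n ∈ S, ‖cutOp S u n‖ ^ 2 :=
    Finset.sum_congr rfl fun n hn => by rw [cutOp_apply_of_mem hn]
  rw [h]
  refine hasSum_sum_of_ne_finset_zero fun n hn => ?_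
  rw [cutOp_apply_of_notMem hn]
  simp

/-- Over all translations each site of the lattice is visited once by each element of S. -/
theorem hasSum_norm_sq_cutOp_lpShift (S : Finset (Fin d → ℤ)) (u : EllTwo d) :
    HasSum (fun m => ‖cutOp S (lpShift (Equiv.addRight m) u)‖ ^ 2) (S.card * ‖u‖ ^ 2) := by
  simp only [norm_sq_cutOp, lpShift_apply, Equiv.coe_addRight]
  rw [← nsmul_eq_mul, ← Finset.sum_const]
  refine hasSum_sum fun n _ => ?_
  exact ((Equiv.addLeft n).hasSum_iff (f := fun k => ‖u k‖ ^ 2)).2 (lp_two_hasSum_norm_sq u)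

theorem norm_cutOp_resDiag_le (S : Finset (Fin d → ℤ)) (u : EllTwo d) :
    ‖cutOp S (resDiag V u)‖ ≤ ‖cutOp S u‖ := by
  rw [← one_mul ‖cutOp S u‖]
  refine lp_two_norm_le zero_le_one fun n => ?_
  rw [one_mul]
  by_cases hn : n ∈ S
  · rw [cutOp_apply_of_mem hn, cutOp_apply_of_mem hn, resDiag_apply, norm_mul]
    exact mul_le_of_le_one_left (norm_nonneg _) (norm_resolventPoint_le _)
  · rw [cutOp_apply_of_notMem hn, cutOp_apply_of_notMem hn]

theorem norm_cutOp_le (S : Finset (Fin d → ℤ)) (u : EllTwo d) : ‖cutOp S u‖ ≤ ‖u‖ := by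
  rw [← one_mul ‖u‖]
  refine lp_two_norm_le zero_le_one fun n => ?_
  rw [one_mul]
  by_cases hn : n ∈ S
  · rw [cutOp_apply_of_mem hn]
  · rw [cutOp_apply_of_notMem hn]
    simp

/-- In the commutator of Δ with the indicator of S only hops across the boundary of S survive, and
these start from values of v on B. So v may be replaced by its restriction to B, and each of the two
terms costs 2d. -/
theorem norm_commutator_lapOp_le {S B : Finset (Fin d → ℤ)}
    (h1 : ∀ n i, n + Pi.single i 1 ∉ B → (n + Pi.single i 1 ∈ S ↔ n ∈ S))
    (h2 : ∀ n i, n - Pi.single i 1 ∉ B → (n - Pi.single i 1 ∈ S ↔ n ∈ S)) (v : EllTwo d) :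
    ‖lapOp d (cutOp S v) - cutOp S (lapOp d v)‖ ≤ 4 * d * ‖cutOp B v‖ := by
  have key : lapOp d (cutOp S v) - cutOp S (lapOp d v)
      = lapOp d (cutOp S (cutOp B v)) - cutOp S (lapOp d (cutOp B v)) := by
    have hterm : ∀ n k : Fin d → ℤ, (k ∉ B → (k ∈ S ↔ n ∈ S)) →
        ∀ χ : ℂ, χ = (if n ∈ S then 1 else 0) →
        cutOp S v k - χ * v k = cutOp S (cutOp B v) k - χ * cutOp B v k := by
      intro n k hk χ hχ
      by_cases hB : k ∈ B
      · rw [cutOp_apply_of_mem hB]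
        congr 1
        by_cases hS : k ∈ S
        · rw [cutOp_apply_of_mem hS, cutOp_apply_of_mem hS, cutOp_apply_of_mem hB]
        · rw [cutOp_apply_of_notMem hS, cutOp_apply_of_notMem hS]
      · have hk' := hk hB
        rw [cutOp_apply_of_notMem hB, mul_zero, sub_zero, hχ]
        by_cases hS : k ∈ S
        · rw [cutOp_apply_of_mem hS, cutOp_apply_of_mem hS, cutOp_apply_of_notMem hB,
            if_pos (hk'.1 hS), one_mul, sub_self]
        · rw [cutOp_apply_of_notMem hS, cutOp_apply_of_notMem hS, if_neg fun h => hS (hk'.2 h),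
            zero_mul, sub_zero]
    refine lp.ext (funext fun n => ?_)
    have hcut : ∀ x : EllTwo d, cutOp S x n = (if n ∈ S then 1 else 0) * x n := by
      intro x
      by_cases hn : n ∈ S
      · rw [cutOp_apply_of_mem hn, if_pos hn, one_mul]
      · rw [cutOp_apply_of_notMem hn, if_neg hn, zero_mul]
    change lapOp d (cutOp S v) n - cutOp S (lapOp d v) n
      = lapOp d (cutOp S (cutOp B v)) n - cutOp S (lapOp d (cutOp B v)) n
    rw [hcut, hcut, lapOp_apply, lapOp_apply, lapOp_apply, lapOp_apply, latticeLaplacian,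
      latticeLaplacian, latticeLaplacian, latticeLaplacian, Finset.mul_sum, Finset.mul_sum,
      ← Finset.sum_sub_distrib, ← Finset.sum_sub_distrib]
    refine Finset.sum_congr rfl fun i _ => ?_
    linear_combination hterm n _ (h1 n i) _ rfl + hterm n _ (h2 n i) _ rfl
  rw [key]
  have e1 := norm_lapOp_apply_le (cutOp S (cutOp B v))
  have e2 := norm_cutOp_le S (lapOp d (cutOp B v))
  have e3 := norm_lapOp_apply_le (cutOp B v)
  have e4 := norm_cutOp_le S (cutOp B v)
  have e5 : 2 * d * ‖cutOp S (cutOp B v)‖ ≤ 2 * d * ‖cutOp B v‖ := by gcongr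
  have e6 := norm_sub_le (lapOp d (cutOp S (cutOp B v))) (cutOp S (lapOp d (cutOp B v)))
  linarith

/-- Diagonal operators commute with the cutoff, which leaves (w - 1)[Δ, 1_S]Q; the constant is 8d =
2 · 4d. -/
theorem norm_pencil_cutOp_le {S B : Finset (Fin d → ℤ)}
    (h1 : ∀ n i, n + Pi.single i 1 ∉ B → (n + Pi.single i 1 ∈ S ↔ n ∈ S))
    (h2 : ∀ n i, n - Pi.single i 1 ∉ B → (n - Pi.single i 1 ∈ S ↔ n ∈ S))
    {w : ℂ} (hw : ‖w‖ = 1) (u : EllTwo d) :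
    ‖pencil V w (cutOp S u)‖ ≤ ‖cutOp S (pencil V w u)‖ + 8 * d * ‖cutOp B u‖ := by
  have hdiag : ∀ c : (Fin d → ℤ) → ℂ, ∀ hc, lpDiag c hc (cutOp S u) = cutOp S (lpDiag c hc u) := by
    intro c hc
    refine lp.ext (funext fun n => ?_)
    by_cases hn : n ∈ S
    · rw [cutOp_apply_of_mem hn, lpDiag_apply, lpDiag_apply, cutOp_apply_of_mem hn]
    · rw [cutOp_apply_of_notMem hn, lpDiag_apply, cutOp_apply_of_notMem hn, mul_zero]
  have hr : resDiag V (cutOp S u) = cutOp S (resDiag V u) := hdiag _ _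
  have hc : cayleyDiag V (cutOp S u) = cutOp S (cayleyDiag V u) := hdiag _ _
  have key : pencil V w (cutOp S u) = cutOp S (pencil V w u)
      + (w - 1) • (lapOp d (cutOp S (resDiag V u)) - cutOp S (lapOp d (resDiag V u))) := by
    rw [pencil_apply_eq, pencil_apply_eq, hr, hc, map_add, map_sub, map_smul, map_smul]
    module
  have hw1 : ‖w - 1‖ ≤ 2 := by
    have := norm_sub_le w 1
    rw [hw, norm_one] at this
    linarith
  rw [key]
  refine (norm_add_le _ _).trans (add_le_add_right ?_ _)
  rw [norm_smul]
  calc _ ≤ 2 * (4 * d * ‖cutOp B u‖) := by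
        gcongr
        refine (norm_commutator_lapOp_le h1 h2 _).trans ?_
        gcongr
        exact norm_cutOp_resDiag_le V B u
    _ = _ := by ring

/-- The cube of side `2 L + 1` centred at the origin. -/
noncomputable def latticeBox (d L : ℕ) : Finset (Fin d → ℤ) :=
  Finset.Icc (fun _ => -(L : ℤ)) fun _ => (L : ℤ)

theorem mem_latticeBox {L : ℕ} {n : Fin d → ℤ} : n ∈ latticeBox d L ↔ ∀ j, |n j| ≤ L := by
  simp [latticeBox, Pi.le_def, abs_le, forall_and]

theorem card_latticeBox (L : ℕ) : (latticeBox d L).card = (2 * L + 1) ^ d := by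
  rw [latticeBox, Pi.card_Icc]
  simp only [Int.card_Icc, Finset.prod_const, Finset.card_univ, Fintype.card_fin]
  congr 1
  omega

theorem latticeBox_of_neighbour {L : ℕ} {n k : Fin d → ℤ} (h : ∀ j, |n j - k j| ≤ 1)
    (hn : n ∈ latticeBox d L) : k ∈ latticeBox d (L + 1) := by
  rw [mem_latticeBox] at hn ⊢
  intro j
  have h1 := abs_le.1 (hn j)
  have h2 := abs_le.1 (h j)
  rw [abs_le]
  push_cast
  constructor <;> linarith [h1.1, h1.2, h2.1, h2.2]

theorem mem_latticeBox_iff_of_neighbour {K : ℕ} {n k : Fin d → ℤ} (h : ∀ j, |n j - k j| ≤ 1)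
    (hk : k ∉ latticeBox d (K + 2) \ latticeBox d K) :
    k ∈ latticeBox d (K + 1) ↔ n ∈ latticeBox d (K + 1) := by
  have h' : ∀ j, |k j - n j| ≤ 1 := fun j => by rw [abs_sub_comm]; exact h j
  constructor
  · intro hk1
    by_contra hn
    refine hk (Finset.mem_sdiff.2 ⟨?_, fun hk0 => hn (latticeBox_of_neighbour h' hk0)⟩)
    rw [mem_latticeBox] at hk1 ⊢
    intro j
    have := hk1 j
    push_cast at this ⊢
    linarith
  · intro hn
    by_contra hk1
    refine hk (Finset.mem_sdiff.2 ⟨latticeBox_of_neighbour h hn, fun hk0 => hk1 ?_⟩)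
    rw [mem_latticeBox] at hk0 ⊢
    intro j
    have := hk0 j
    push_cast at this ⊢
    linarith

/-- This is the amenability of `ℤ^d`: ((2K + 5)^d - (2K + 1)^d) / (2K + 3)^d tends to 0. -/
theorem exists_latticeBox_boundary_le (d : ℕ) {η : ℝ} (hη : 0 < η) :
    ∃ K : ℕ, ((latticeBox d (K + 2) \ latticeBox d K).card : ℝ)
      ≤ η * (latticeBox d (K + 1)).card := by
  have hsub : ∀ K : ℕ, latticeBox d K ⊆ latticeBox d (K + 2) := by
    intro K n hn
    rw [mem_latticeBox] at hn ⊢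
    intro j
    have := hn j
    push_cast
    linarith
  have hcard : ∀ K : ℕ, ((latticeBox d (K + 2) \ latticeBox d K).card : ℝ)
      = (2 * K + 5 : ℝ) ^ d - (2 * K + 1 : ℝ) ^ d := by
    intro K
    rw [Finset.cast_card_sdiff (hsub K), card_latticeBox, card_latticeBox]
    push_cast
    ring
  have hlim : ∀ c : ℝ, Tendsto (fun K : ℕ => ((2 * K + c) / (2 * K + 3) : ℝ) ^ d) atTop (𝓝 1) := by
    intro c
    have h0 : Tendsto (fun K : ℕ => (1 : ℝ) + (c - 3) / (2 * K + 3)) atTop (𝓝 (1 + 0)) := by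
      refine tendsto_const_nhds.add (Tendsto.const_div_atTop ?_ _)
      exact tendsto_atTop_add_const_right _ _
        (tendsto_natCast_atTop_atTop.const_mul_atTop two_pos)
    have h1 : (fun K : ℕ => (1 : ℝ) + (c - 3) / (2 * K + 3))
        = fun K : ℕ => ((2 * K + c) / (2 * K + 3) : ℝ) := by
      funext K
      have : (2 * K + 3 : ℝ) ≠ 0 := by positivity
      field_simp
      ring
    rw [h1, add_zero] at h0
    simpa using h0.pow d
  have h := (hlim 5).sub (hlim 1)
  rw [sub_self] at h
  obtain ⟨K, hK⟩ := (h.eventually (gt_mem_nhds hη)).exists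
  refine ⟨K, ?_⟩
  rw [hcard, card_latticeBox]
  rw [div_pow, div_pow, ← sub_div, div_lt_iff₀ (by positivity)] at hK
  push_cast
  calc _ ≤ η * (2 * K + 3) ^ d := hK.le
    _ = _ := by ring

theorem neighbour_add (n : Fin d → ℤ) (i j : Fin d) :
    |n j - (n + Pi.single i 1 : Fin d → ℤ) j| ≤ 1 := by
  rcases eq_or_ne j i with rfl | h
  · simp
  · simp [h]

theorem neighbour_sub (n : Fin d → ℤ) (i j : Fin d) :
    |n j - (n - Pi.single i 1 : Fin d → ℤ) j| ≤ 1 := by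
  rcases eq_or_ne j i with rfl | h
  · simp
  · simp [h]

theorem cutOp_cutOp (S : Finset (Fin d → ℤ)) (x : EllTwo d) : cutOp S (cutOp S x) = cutOp S x := by
  refine lp.ext (funext fun n => ?_)
  by_cases hn : n ∈ S
  · rw [cutOp_apply_of_mem hn]
  · rw [cutOp_apply_of_notMem hn, cutOp_apply_of_notMem hn]

/-- The term with p is at most half of the left side of `h`, and the boundary term is strictly less
than half of it, since c/(c + 1) < 1. -/
theorem localization_arithmetic {ε s b p q c : ℝ} (hε : 0 < ε) (hs : 0 < s) (hq : 0 < q)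
    (hb : 0 ≤ b) (hc : 0 ≤ c) (hbs : b ≤ ε ^ 2 / (4 * (c + 1)) * s) (hp : p ≤ ε / 2 * q)
    (hp0 : 0 ≤ p) (h : ε ^ 2 * (s * q ^ 2) ≤ 2 * (s * p ^ 2) + 2 * c * (b * q ^ 2)) : False := by
  rw [div_mul_eq_mul_div, le_div_iff₀ (by positivity)] at hbs
  have hp2 : p ^ 2 ≤ (ε / 2 * q) ^ 2 := pow_le_pow_left₀ hp0 hp 2
  have h5 : 4 * c * b * q ^ 2 ≤ (ε ^ 2 * s - 4 * b) * q ^ 2 :=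
    mul_le_mul_of_nonneg_right (by linarith) (by positivity)
  have h7 : s * p ^ 2 ≤ s * (ε / 2 * q) ^ 2 := mul_le_mul_of_nonneg_left hp2 hs.le
  have h0 : b * q ^ 2 = 0 := le_antisymm (by linarith) (by positivity)
  have h8 : 0 < ε ^ 2 * s * q ^ 2 := by positivity
  have h9 : 4 * c * (b * q ^ 2) = 0 := by rw [h0, mul_zero]
  linarith

theorem norm_sq_cutOp_le_of_not_approx {ε : ℝ} (hε : 0 < ε) {w : ℂ} (hw : ‖w‖ = 1) (K : ℕ)
    (hcon : ∀ u : EllTwo d, u ≠ 0 → cutOp (latticeBox d (K + 1)) u = u →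
      ε * ‖u‖ < ‖pencil V w u‖) (u : EllTwo d) :
    ε ^ 2 * ‖cutOp (latticeBox d (K + 1)) u‖ ^ 2
      ≤ 2 * ‖cutOp (latticeBox d (K + 1)) (pencil V w u)‖ ^ 2
        + 2 * (64 * d ^ 2) * ‖cutOp (latticeBox d (K + 2) \ latticeBox d K) u‖ ^ 2 := by
  have h1 : ε * ‖cutOp (latticeBox d (K + 1)) u‖
      ≤ ‖pencil V w (cutOp (latticeBox d (K + 1)) u)‖ := by
    by_cases h0 : cutOp (latticeBox d (K + 1)) u = 0
    · rw [h0]; simp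
    · exact (hcon _ h0 (cutOp_cutOp _ u)).le
  have h2 := norm_pencil_cutOp_le V (S := latticeBox d (K + 1))
    (B := latticeBox d (K + 2) \ latticeBox d K)
    (fun n i h => mem_latticeBox_iff_of_neighbour (neighbour_add n i) h)
    (fun n i h => mem_latticeBox_iff_of_neighbour (neighbour_sub n i) h) hw u
  have h3 := pow_le_pow_left₀ (by positivity) (h1.trans h2) 2
  rw [mul_pow] at h3
  refine h3.trans (add_sq_le.trans (le_of_eq ?_))
  ring

/-- Approximate eigenvectors can be chosen, after a translation, in a finite set of sites that does
not depend on the potential. -/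
theorem exists_localized_approx_null_pencil (d : ℕ) {ε : ℝ} (hε : 0 < ε) :
    ∃ S : Finset (Fin d → ℤ), ∀ (V : (Fin d → ℤ) → OnePoint ℝ), ∀ w ∈ spectrum ℂ (cayleyOp V),
      ∃ (m : Fin d → ℤ) (u : EllTwo d), u ≠ 0 ∧ cutOp S u = u ∧
        ‖pencil (translatePotential m V) w u‖ ≤ ε * ‖u‖ := by
  -- The constant 64d² is the square of the 8d lost in cutting; the factor 2 in front of it later
  -- comes from (a + b)² ≤ 2a² + 2b².
  obtain ⟨K, hK⟩ := exists_latticeBox_boundary_le d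
    (η := ε ^ 2 / (4 * (64 * d ^ 2 + 1))) (by positivity)
  refine ⟨latticeBox d (K + 1), fun V w hw => ?_⟩
  by_contra! hcon
  have hw1 := norm_eq_one_of_mem_spectrum V hw
  obtain ⟨u, hu, hup⟩ := exists_approx_null_pencil V hw (half_pos hε)
  have hle : ∀ m, ε ^ 2 * ‖cutOp (latticeBox d (K + 1)) (lpShift (Equiv.addRight m) u)‖ ^ 2
      ≤ 2 * ‖cutOp (latticeBox d (K + 1)) (lpShift (Equiv.addRight m) (pencil V w u))‖ ^ 2
        + 2 * (64 * d ^ 2) * ‖cutOp (latticeBox d (K + 2) \ latticeBox d K)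
          (lpShift (Equiv.addRight m) u)‖ ^ 2 := by
    intro m
    rw [← pencil_translate_lpShift]
    exact norm_sq_cutOp_le_of_not_approx _ hε hw1 K (hcon m) _
  have hS : (0 : ℝ) < (latticeBox d (K + 1)).card := by
    rw [card_latticeBox]
    positivity
  clear hcon
  generalize latticeBox d (K + 1) = S at *
  generalize latticeBox d (K + 2) \ latticeBox d K = B at *
  -- If every translate of the box failed, summing the local inequalities over all translates would
  -- weigh interior terms by |S| and the boundary term by |B|, contradicting |B| ≪ |S|.
  have h1 : HasSum (fun m => ε ^ 2 * ‖cutOp S (lpShift (Equiv.addRight m) u)‖ ^ 2)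
      (ε ^ 2 * (S.card * ‖u‖ ^ 2)) := (hasSum_norm_sq_cutOp_lpShift S u).mul_left _
  have h2 : HasSum (fun m => 2 * ‖cutOp S (lpShift (Equiv.addRight m) (pencil V w u))‖ ^ 2)
      (2 * (S.card * ‖pencil V w u‖ ^ 2)) := (hasSum_norm_sq_cutOp_lpShift S _).mul_left _
  have h3 : HasSum (fun m => 2 * (64 * (d : ℝ) ^ 2) * ‖cutOp B (lpShift (Equiv.addRight m) u)‖ ^ 2)
      (2 * (64 * (d : ℝ) ^ 2) * (B.card * ‖u‖ ^ 2)) := (hasSum_norm_sq_cutOp_lpShift B u).mul_left _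
  exact localization_arithmetic hε hS (norm_pos_iff.2 hu) (Nat.cast_nonneg _) (by positivity) hK
    hup (norm_nonneg _) (hasSum_le hle h1 (h2.add h3))

end Localization

/-! ### Semicontinuity of the spectrum -/

section Semicontinuity

variable {d : ℕ}

open Classical in
/-- The finitely supported sequence with given values on a finite set of sites. -/
noncomputable def finiteSeq (S : Finset (Fin d → ℤ)) (x : (Fin d → ℤ) → ℂ) : EllTwo d :=
  ∑ n ∈ S, lp.single 2 n (x n)

open Classical in
theorem finiteSeq_eq_cutOp (S : Finset (Fin d → ℤ)) (u : EllTwo d) : finiteSeq S u = cutOp S u := by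
  refine lp.ext ?_
  rw [finiteSeq, lp.coeFn_sum]
  funext k
  refine (Finset.sum_apply k S _).trans ?_
  by_cases hk : k ∈ S
  · rw [cutOp_apply_of_mem hk, Finset.sum_eq_single k]
    · exact lp.single_apply_self (E := fun _ : Fin d → ℤ => ℂ) 2 k (u k)
    · intro n _ hn
      exact lp.single_apply_ne (E := fun _ : Fin d → ℤ => ℂ) 2 n (u n) hn.symm
    · exact fun h => absurd hk h
  · rw [cutOp_apply_of_notMem hk]
    refine Finset.sum_eq_zero fun n hn => lp.single_apply_ne (E := fun _ : Fin d → ℤ => ℂ) 2 n (u n) ?_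
    rintro rfl
    exact hk hn

open Classical in
theorem continuous_lpSingle (n : Fin d → ℤ) :
    Continuous fun a : ℂ => (lp.single 2 n a : EllTwo d) :=
  (lp.isometry_single (E := fun _ : Fin d → ℤ => ℂ) (p := 2) n).continuous

theorem continuous_finiteSeq (S : Finset (Fin d → ℤ)) : Continuous (finiteSeq S) := by
  classical
  exact continuous_finsetSum _ fun n _ => (continuous_lpSingle n).comp (continuous_apply n)

open Classical in
theorem pencil_finiteSeq (V : (Fin d → ℤ) → OnePoint ℝ) (w : ℂ) (S : Finset (Fin d → ℤ))
    (x : (Fin d → ℤ) → ℂ) :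
    pencil V w (finiteSeq S x) = ∑ n ∈ S, (lp.single 2 n ((w - cayleyPoint (V n)) * x n)
      + (w - 1) • lapOp d (lp.single 2 n (resolventPoint (V n) * x n))) := by
  rw [finiteSeq, map_sum]
  refine Finset.sum_congr rfl fun n _ => ?_
  rw [pencil_apply_eq, cayleyDiag, resDiag, lpDiag_mul_single, lpDiag_mul_single, sub_mul,
    lp.single_sub, ← smul_eq_mul w, lp.single_smul]

/-- Only the finitely many values of the potential on S enter, through continuous functions on the
circle. This is why pointwise convergence of potentials suffices. -/
theorem continuous_pencil_finiteSeq (S : Finset (Fin d → ℤ)) :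
    Continuous fun p : ((Fin d → ℤ) → OnePoint ℝ) × ℂ × ((Fin d → ℤ) → ℂ) =>
      pencil p.1 p.2.1 (finiteSeq S p.2.2) := by
  classical
  simp only [pencil_finiteSeq]
  refine continuous_finsetSum _ fun n _ => ?_
  have hV : Continuous fun p : ((Fin d → ℤ) → OnePoint ℝ) × ℂ × ((Fin d → ℤ) → ℂ) => p.1 n :=
    (continuous_apply n).comp continuous_fst
  have hx : Continuous fun p : ((Fin d → ℤ) → OnePoint ℝ) × ℂ × ((Fin d → ℤ) → ℂ) => p.2.2 n :=
    (continuous_apply n).comp (continuous_snd.comp continuous_snd)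
  have hw : Continuous fun p : ((Fin d → ℤ) → OnePoint ℝ) × ℂ × ((Fin d → ℤ) → ℂ) => p.2.1 :=
    continuous_fst.comp continuous_snd
  refine ((continuous_lpSingle n).comp ((hw.sub (continuous_cayleyPoint.comp hV)).mul hx)).add
    ((hw.sub continuous_const).smul ((lapOp d).continuous.comp
      ((continuous_lpSingle n).comp ((continuous_resolventPoint.comp hV).mul hx))))

theorem continuous_translatePotential (m : Fin d → ℤ) :
    Continuous (translatePotential m : ((Fin d → ℤ) → OnePoint ℝ) → (Fin d → ℤ) → OnePoint ℝ) :=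
  continuous_pi fun n => continuous_apply (n + m)

/-- Lower semicontinuity: points of the spectrum persist under small changes of the potential in
the product topology. -/
theorem eventually_exists_extSpectrum_near {V : (Fin d → ℤ) → OnePoint ℝ} {E : OnePoint ℝ}
    (hE : E ∈ extSpectrum V) {δ : ℝ} (hδ : 0 < δ) :
    ∀ᶠ W in 𝓝 V, ∃ E' ∈ extSpectrum W, dist (cayleyPoint E) (cayleyPoint E') < δ := by
  have hC : (0 : ℝ) < 1 + 2 * d := by positivity
  rw [mem_extSpectrum_iff] at hE
  set ε : ℝ := δ / 2 / (1 + 2 * d) with hε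
  have hε0 : 0 < ε := by positivity
  -- Half of the tolerance is kept, so that the strict inequality survives a small change of the
  -- potential.
  obtain ⟨S, hS⟩ := exists_localized_approx_null_pencil d (half_pos hε0)
  obtain ⟨m, u, hu, huS, hup⟩ := hS V _ hE
  have hun : 0 < ‖u‖ := norm_pos_iff.2 hu
  rw [← finiteSeq_eq_cutOp] at huS
  have hlt : ‖pencil (translatePotential m V) (cayleyPoint E) (finiteSeq S u)‖ < ε * ‖u‖ := by
    rw [huS]
    refine hup.trans_lt ?_
    gcongr
    linarith
  have hcont : Continuous fun W : (Fin d → ℤ) → OnePoint ℝ =>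
      ‖pencil (translatePotential m W) (cayleyPoint E) (finiteSeq S u)‖ :=
    ((continuous_pencil_finiteSeq S).comp ((continuous_translatePotential m).prodMk
      (continuous_const (y := (cayleyPoint E, (u : (Fin d → ℤ) → ℂ)))))).norm
  filter_upwards [hcont.continuousAt.eventually (gt_mem_nhds hlt)] with W hW
  rw [huS] at hW
  obtain ⟨w', hw', hd⟩ := exists_mem_spectrum_of_approx_null_pencil _ hε0.le hu hW.le
  rw [← image_cayleyPoint_extSpectrum, extSpectrum_translate] at hw'
  obtain ⟨E', hE', rfl⟩ := hw'
  refine ⟨E', hE', hd.trans_lt ?_⟩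
  rw [hε, div_mul_cancel₀ _ hC.ne']
  linarith

/-- Upper semicontinuity: limits of points of the spectrum are seen, up to a small error, by limits
of suitable translations of the potentials. -/
theorem exists_translate_tendsto_extSpectrum_near {ι : Type*} (𝒰 : Ultrafilter ι)
    {V : ι → (Fin d → ℤ) → OnePoint ℝ} {e : ι → OnePoint ℝ} {E : OnePoint ℝ}
    (he : ∀ i, e i ∈ extSpectrum (V i)) (hlim : Tendsto e 𝒰 (𝓝 E)) {δ : ℝ} (hδ : 0 < δ) :
    ∃ (m : ι → Fin d → ℤ) (W : (Fin d → ℤ) → OnePoint ℝ),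
      Tendsto (fun i => translatePotential (m i) (V i)) 𝒰 (𝓝 W) ∧
      ∃ E' ∈ extSpectrum W, dist (cayleyPoint E) (cayleyPoint E') ≤ δ := by
  have hC : (0 : ℝ) < 1 + 2 * d := by positivity
  set ε : ℝ := δ / (1 + 2 * d) with hε
  have hε0 : 0 < ε := by positivity
  obtain ⟨S, hS⟩ := exists_localized_approx_null_pencil d hε0
  have hnorm : ∀ i, ∃ (m : Fin d → ℤ) (u : EllTwo d), ‖u‖ = 1 ∧ finiteSeq S u = u ∧
      ‖pencil (translatePotential m (V i)) (cayleyPoint (e i)) (finiteSeq S u)‖ ≤ ε := by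
    intro i
    obtain ⟨m, u, hu, huS, hup⟩ := hS (V i) _ ((mem_extSpectrum_iff _ _).1 (he i))
    have hun : 0 < ‖u‖ := norm_pos_iff.2 hu
    have hS' : finiteSeq S (((‖u‖ : ℂ)⁻¹ • u : EllTwo d)) = (‖u‖ : ℂ)⁻¹ • u := by
      rw [finiteSeq_eq_cutOp, map_smul, huS]
    refine ⟨m, (‖u‖ : ℂ)⁻¹ • u, ?_, hS', ?_⟩
    · rw [norm_smul, norm_inv, Complex.norm_real, norm_norm, inv_mul_cancel₀ hun.ne']
    · rw [hS', map_smul, norm_smul, norm_inv, Complex.norm_real, norm_norm, inv_mul_le_iff₀ hun,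
        mul_comm]
      exact hup
  choose m u hu1 huS hup using hnorm
  -- The space of all potentials is compact, being a product of circles, so the translates converge
  -- along the ultrafilter.
  obtain ⟨W, -, hW⟩ := isCompact_univ.ultrafilter_le_nhds'
    (𝒰.map fun i => translatePotential (m i) (V i)) univ_mem
  have hcpt : IsCompact (Set.univ.pi fun _ : Fin d → ℤ => Metric.closedBall (0 : ℂ) 1) :=
    isCompact_univ_pi fun _ => isCompact_closedBall _ _
  obtain ⟨x, -, hx⟩ := hcpt.ultrafilter_le_nhds' (𝒰.map fun i => (u i : (Fin d → ℤ) → ℂ)) (by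
    refine Ultrafilter.mem_map.2 (Filter.univ_mem' fun i n _ => ?_)
    rw [mem_closedBall_zero_iff, ← hu1 i]
    exact lp.norm_apply_le_norm (by norm_num) (u i) n)
  have hW' : Tendsto (fun i => translatePotential (m i) (V i)) 𝒰 (𝓝 W) := hW
  have hx' : Tendsto (fun i => (u i : (Fin d → ℤ) → ℂ)) 𝒰 (𝓝 x) := hx
  refine ⟨m, W, hW', ?_⟩
  -- No mass escapes in the coordinatewise limit, since all the vectors are supported in the same
  -- finite set.
  have h1 : ‖finiteSeq S x‖ = 1 := by
    refine tendsto_nhds_unique (((continuous_finiteSeq S).tendsto x).comp hx').norm ?_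
    refine tendsto_const_nhds.congr fun i => ?_
    rw [Function.comp_apply, huS, hu1]
  have h2 : ‖pencil W (cayleyPoint E) (finiteSeq S x)‖ ≤ ε * ‖finiteSeq S x‖ := by
    rw [h1, mul_one]
    have hlim' := ((continuous_pencil_finiteSeq S).tendsto (W, cayleyPoint E, x)).comp
      (hW'.prodMk_nhds (((continuous_cayleyPoint.tendsto E).comp hlim).prodMk_nhds hx'))
    exact le_of_tendsto hlim'.norm (Eventually.of_forall hup)
  obtain ⟨w', hw', hd⟩ := exists_mem_spectrum_of_approx_null_pencil W hε0.le
    (norm_ne_zero_iff.1 (by rw [h1]; exact one_ne_zero)) h2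
  rw [← image_cayleyPoint_extSpectrum] at hw'
  obtain ⟨E', hE', rfl⟩ := hw'
  refine ⟨E', hE', hd.trans_eq ?_⟩
  rw [hε, div_mul_cancel₀ _ hC.ne']

end Semicontinuity

/-! ### Limits of potentials -/

section Potentials

/-- At either end: a neighbourhood of ∞ in the circle contains both a right and a left half-line. -/
theorem continuous_toCircleLine : Continuous toCircleLine := by
  have hinf : ∀ U ∈ 𝓝 (OnePoint.infty : OnePoint ℝ), ∃ a b : ℝ, (∀ s : ℝ, a < s → (s : OnePoint ℝ) ∈ U) ∧
      ∀ s : ℝ, s < b → (s : OnePoint ℝ) ∈ U := by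
    intro U hU
    rw [OnePoint.nhds_infty_eq, coclosedCompact_eq_cocompact, mem_sup, mem_map,
      cocompact_eq_atBot_atTop, mem_sup] at hU
    obtain ⟨⟨hb, ha⟩, -⟩ := hU
    obtain ⟨a, ha⟩ := mem_atTop_sets.1 ha
    obtain ⟨b, hb⟩ := mem_atBot_sets.1 hb
    exact ⟨a, b, fun s hs => ha s hs.le, fun s hs => hb s hs.le⟩
  have hreal : ∀ s : ℝ, toCircleLine (s : EReal) = (s : OnePoint ℝ) := fun s => by
    simp [toCircleLine]
  rw [continuous_iff_continuousAt]
  intro x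
  induction x with
  | bot =>
    have h0 : toCircleLine ⊥ = OnePoint.infty := by simp [toCircleLine]
    rw [ContinuousAt, h0]
    intro U hU
    obtain ⟨a, b, -, hb⟩ := hinf U hU
    rw [mem_map]
    refine mem_of_superset (Iio_mem_nhds (EReal.bot_lt_coe b)) fun y hy => ?_
    induction y with
    | bot => exact mem_preimage.2 (by rw [h0]; exact mem_of_mem_nhds hU)
    | coe s => exact mem_preimage.2 (by rw [hreal]; exact hb s (EReal.coe_lt_coe_iff.1 hy))
    | top => exact absurd hy (by simp)
  | coe s =>
    rw [ContinuousAt, hreal, EReal.nhds_coe, tendsto_map'_iff]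
    refine (OnePoint.continuous_coe.tendsto s).congr fun r => ?_
    exact (hreal r).symm
  | top =>
    have h0 : toCircleLine ⊤ = OnePoint.infty := by simp [toCircleLine]
    rw [ContinuousAt, h0]
    intro U hU
    obtain ⟨a, b, ha, -⟩ := hinf U hU
    rw [mem_map]
    refine mem_of_superset (Ioi_mem_nhds (EReal.coe_lt_top a)) fun y hy => ?_
    induction y with
    | bot => exact absurd hy (by simp)
    | coe s => exact mem_preimage.2 (by rw [hreal]; exact ha s (EReal.coe_lt_coe_iff.1 hy))
    | top => exact mem_preimage.2 (by rw [h0]; exact mem_of_mem_nhds hU)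

open Classical in
/-- The value at `s` of `f` with its values at the integers replaced by `t`. -/
noncomputable def modifiedValue (f : ℝ → EReal) (t : OnePoint ℝ) (s : ℝ) : OnePoint ℝ :=
  if Int.fract s = 0 then t else toCircleLine (f s)

theorem modifiedValue_of_eq {f : ℝ → EReal} {t : OnePoint ℝ} {s : ℝ} (h : Int.fract s = 0) :
    modifiedValue f t s = t := if_pos h

theorem modifiedValue_of_ne {f : ℝ → EReal} {t : OnePoint ℝ} {s : ℝ} (h : Int.fract s ≠ 0) :
    modifiedValue f t s = toCircleLine (f s) := if_neg h

theorem fract_ne_zero_of_mem_Ioo {k : ℤ} {s : ℝ} (h : s ∈ Ioo (k : ℝ) (k + 1)) :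
    Int.fract s ≠ 0 := by
  have : ⌊s⌋ = k := Int.floor_eq_iff.2 ⟨h.1.le, h.2⟩
  rw [Int.fract, this]
  exact (sub_pos.2 h.1).ne'

variable {f : ℝ → EReal}

theorem HasSimpleDiscontinuity.sub_int (hf : HasSimpleDiscontinuity f) (k : ℤ) (s : ℝ) :
    f (s - k) = f s := by
  simpa using hf.periodic.sub_int_mul_eq k (x := s)

theorem modifiedValue_add_int (hf : HasSimpleDiscontinuity f) (t : OnePoint ℝ) (s : ℝ) (k : ℤ) :
    modifiedValue f t (s + k) = modifiedValue f t s := by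
  have := hf.sub_int k (s + k)
  rw [add_sub_cancel_right] at this
  simp only [modifiedValue, Int.fract_add_intCast, this]

theorem HasSimpleDiscontinuity.continuousAt (hf : HasSimpleDiscontinuity f) {s : ℝ}
    (hs : Int.fract s ≠ 0) : ContinuousAt f s := by
  have h0 : 0 < Int.fract s := (Int.fract_nonneg s).lt_of_ne' hs
  have h1 : ContinuousAt f (s - ⌊s⌋) :=
    hf.continuousOn.continuousAt (Ico_mem_nhds h0 (Int.fract_lt_one s))
  have h2 : ContinuousAt (fun r : ℝ => f (r - ⌊s⌋)) s :=
    ContinuousAt.comp (f := fun r : ℝ => r - ⌊s⌋) h1 (by fun_prop)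
  simpa only [hf.sub_int] using h2

theorem HasSimpleDiscontinuity.tendsto_right_int (hf : HasSimpleDiscontinuity f) (k : ℤ) :
    Tendsto f (𝓝[>] (k : ℝ)) (𝓝 (f 0)) := by
  have h1 : Tendsto f (𝓝[>] 0) (𝓝 (f 0)) := by
    have := hf.continuousOn 0 ⟨le_rfl, one_pos⟩
    refine this.mono_left ?_
    rw [← nhdsWithin_Ioo_eq_nhdsGT (one_pos : (0 : ℝ) < 1)]
    exact nhdsWithin_mono _ Ioo_subset_Ico_self
  have h2 : Tendsto (fun s : ℝ => s - k) (𝓝[>] (k : ℝ)) (𝓝[>] 0) := by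
    refine tendsto_nhdsWithin_iff.2 ⟨?_, ?_⟩
    · have : Tendsto (fun s : ℝ => s - k) (𝓝 (k : ℝ)) (𝓝 (k - k)) :=
        tendsto_id.sub_const _
      rw [sub_self] at this
      exact this.mono_left nhdsWithin_le_nhds
    · filter_upwards [self_mem_nhdsWithin] with s hs
      exact mem_Ioi.2 (sub_pos.2 (mem_Ioi.1 hs))
  exact (h1.comp h2).congr fun s => hf.sub_int k s

theorem HasSimpleDiscontinuity.tendsto_left_int (hf : HasSimpleDiscontinuity f) (k : ℤ) :
    Tendsto f (𝓝[<] (k : ℝ)) (𝓝 (Function.leftLim f 1)) := by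
  have h2 : Tendsto (fun s : ℝ => s - ((k - 1 : ℤ) : ℝ)) (𝓝[<] (k : ℝ)) (𝓝[<] 1) := by
    refine tendsto_nhdsWithin_iff.2 ⟨?_, ?_⟩
    · have : Tendsto (fun s : ℝ => s - ((k - 1 : ℤ) : ℝ)) (𝓝 (k : ℝ)) (𝓝 (k - ((k - 1 : ℤ) : ℝ))) :=
        tendsto_id.sub_const _
      rw [show (k : ℝ) - ((k - 1 : ℤ) : ℝ) = 1 by push_cast; ring] at this
      exact this.mono_left nhdsWithin_le_nhds
    · filter_upwards [self_mem_nhdsWithin] with s hs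
      have : s < k := hs
      push_cast
      exact mem_Iio.2 (by linarith)
  exact (hf.tendsto_left.comp h2).congr fun s => hf.sub_int _ s

variable {ι : Type*} {l : Filter ι} {t : ι → OnePoint ℝ} {s : ι → ℝ}

theorem tendsto_modifiedValue (hf : HasSimpleDiscontinuity f) {s₀ : ℝ} (hs : Tendsto s l (𝓝 s₀))
    (h : Int.fract s₀ ≠ 0) (t₀ : OnePoint ℝ) :
    Tendsto (fun i => modifiedValue f (t i) (s i)) l (𝓝 (modifiedValue f t₀ s₀)) := by
  rw [modifiedValue_of_ne h]
  refine Tendsto.congr' (f₁ := fun i => toCircleLine (f (s i))) ?_ ?_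
  · have h0 : 0 < Int.fract s₀ := (Int.fract_nonneg _).lt_of_ne' h
    have h1 : s₀ ∈ Ioo (⌊s₀⌋ : ℝ) (⌊s₀⌋ + 1) := ⟨by rw [Int.fract] at h0; linarith, Int.lt_floor_add_one _⟩
    filter_upwards [hs.eventually (isOpen_Ioo.mem_nhds h1)] with i hi
    exact (modifiedValue_of_ne (fract_ne_zero_of_mem_Ioo hi)).symm
  · exact (continuous_toCircleLine.tendsto _).comp ((hf.continuousAt h).tendsto.comp hs)

theorem tendsto_modifiedValue_of_gt (hf : HasSimpleDiscontinuity f) {k : ℤ}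
    (hs : Tendsto s l (𝓝 (k : ℝ))) (h : ∀ᶠ i in l, (k : ℝ) < s i) :
    Tendsto (fun i => modifiedValue f (t i) (s i)) l (𝓝 (toCircleLine (f 0))) := by
  refine Tendsto.congr' (f₁ := fun i => toCircleLine (f (s i))) ?_ ?_
  · filter_upwards [h, hs.eventually (gt_mem_nhds (lt_add_one (k : ℝ)))] with i hi hi'
    exact (modifiedValue_of_ne (fract_ne_zero_of_mem_Ioo ⟨hi, hi'⟩)).symm
  · exact (continuous_toCircleLine.tendsto _).comp
      ((hf.tendsto_right_int k).comp (tendsto_nhdsWithin_iff.2 ⟨hs, h⟩))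

theorem tendsto_modifiedValue_of_lt (hf : HasSimpleDiscontinuity f) {k : ℤ}
    (hs : Tendsto s l (𝓝 (k : ℝ))) (h : ∀ᶠ i in l, s i < (k : ℝ)) :
    Tendsto (fun i => modifiedValue f (t i) (s i)) l
      (𝓝 (toCircleLine (Function.leftLim f 1))) := by
  refine Tendsto.congr' (f₁ := fun i => toCircleLine (f (s i))) ?_ ?_
  · filter_upwards [h, hs.eventually (lt_mem_nhds (sub_one_lt (k : ℝ)))] with i hi hi'
    refine (modifiedValue_of_ne (fract_ne_zero_of_mem_Ioo (k := k - 1) ⟨?_, ?_⟩)).symm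
    · push_cast; exact hi'
    · push_cast; linarith
  · exact (continuous_toCircleLine.tendsto _).comp
      ((hf.tendsto_left_int k).comp (tendsto_nhdsWithin_iff.2 ⟨hs, h⟩))

variable {d : ℕ}

/-! ### Translations and limits of shifted potentials -/

theorem shiftedPotential_apply (f : ℝ → EReal) (t : OnePoint ℝ) (α : Fin d → ℝ) (x : ℝ)
    (n : Fin d → ℤ) : shiftedPotential f t α x n = modifiedValue f t (x + freqDot n α) := rfl

theorem freqDot_add (m n : Fin d → ℤ) (α : Fin d → ℝ) :
    freqDot (m + n) α = freqDot m α + freqDot n α := by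
  simp [freqDot, add_mul, Finset.sum_add_distrib]

theorem freqDot_neg (m : Fin d → ℤ) (α : Fin d → ℝ) : freqDot (-m) α = -freqDot m α := by
  simp [freqDot]

theorem freqDot_zero (α : Fin d → ℝ) : freqDot 0 α = 0 := by
  simp [freqDot]

theorem continuous_freqDot (n : Fin d → ℤ) : Continuous (freqDot n : (Fin d → ℝ) → ℝ) := by
  unfold freqDot
  fun_prop

theorem translatePotential_shiftedPotential (f : ℝ → EReal) (t : OnePoint ℝ) (α : Fin d → ℝ) (x : ℝ)
    (m : Fin d → ℤ) : translatePotential m (shiftedPotential f t α x)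
      = shiftedPotential f t α (x + freqDot m α) := by
  funext n
  rw [translatePotential, shiftedPotential_apply, shiftedPotential_apply, freqDot_add]
  congr 1
  ring

theorem shiftedPotential_add_int (hf : HasSimpleDiscontinuity f) (t : OnePoint ℝ) (α : Fin d → ℝ)
    (x : ℝ) (k : ℤ) : shiftedPotential f t α (x + k) = shiftedPotential f t α x := by
  funext n
  rw [shiftedPotential_apply, shiftedPotential_apply, add_right_comm, modifiedValue_add_int hf]

theorem shiftedPotential_fract (hf : HasSimpleDiscontinuity f) (t : OnePoint ℝ) (α : Fin d → ℝ)
    (x : ℝ) : shiftedPotential f t α (Int.fract x) = shiftedPotential f t α x := by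
  have := shiftedPotential_add_int hf t α (Int.fract x) ⌊x⌋
  rw [Int.fract_add_floor] at this
  exact this.symm

theorem extSpectrum_shiftedPotential_freqDot (hf : HasSimpleDiscontinuity f) (t : OnePoint ℝ)
    (α : Fin d → ℝ) (m : Fin d → ℤ) :
    extSpectrum (shiftedPotential f t α (Int.fract (freqDot m α)))
      = extSpectrum (shiftedPotential f t α 0) := by
  rw [shiftedPotential_fract hf, ← extSpectrum_translate (shiftedPotential f t α 0) m,
    translatePotential_shiftedPotential, zero_add]

theorem RationallyIndependent.fract_ne_zero {α : Fin d → ℝ} (hα : RationallyIndependent α) {x : ℝ}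
    {n₀ : Fin d → ℤ} (h0 : Int.fract (x + freqDot n₀ α) = 0) {n : Fin d → ℤ} (hn : n ≠ n₀) :
    Int.fract (x + freqDot n α) ≠ 0 := by
  intro h
  obtain ⟨k, hk⟩ := Int.fract_eq_zero_iff.1 h
  obtain ⟨k', hk'⟩ := Int.fract_eq_zero_iff.1 h0
  refine hα (n - n₀) (sub_ne_zero.2 hn) (k - k') ?_
  rw [sub_eq_add_neg, freqDot_add, freqDot_neg]
  push_cast
  linarith

/-- A limit of shifted potentials, as the frequencies tend to a rationally independent vector, is a
shifted potential. -/
theorem exists_eq_shiftedPotential_of_tendsto (hf : HasSimpleDiscontinuity f) {α : Fin d → ℝ}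
    (hα : RationallyIndependent α) (𝒰 : Ultrafilter ι) {β : ι → Fin d → ℝ}
    (hβ : Tendsto β 𝒰 (𝓝 α)) {t₀ : OnePoint ℝ} (ht : Tendsto t 𝒰 (𝓝 t₀)) (x : ι → ℝ)
    {W : (Fin d → ℤ) → OnePoint ℝ}
    (hW : Tendsto (fun i => shiftedPotential f (t i) (β i) (x i)) 𝒰 (𝓝 W)) :
    ∃ (x₀ : ℝ) (r : OnePoint ℝ), (r = t₀ ∨ r = toCircleLine (f 0) ∨
      r = toCircleLine (Function.leftLim f 1)) ∧ W = shiftedPotential f r α x₀ := by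
  obtain ⟨x₀, -, hx⟩ := (isCompact_Icc (a := (0 : ℝ)) (b := 1)).ultrafilter_le_nhds'
    (𝒰.map fun i => Int.fract (x i)) (Ultrafilter.mem_map.2 (univ_mem' fun i =>
      ⟨Int.fract_nonneg _, (Int.fract_lt_one _).le⟩))
  have hx' : Tendsto (fun i => Int.fract (x i)) 𝒰 (𝓝 x₀) := hx
  have hs : ∀ n : Fin d → ℤ, Tendsto (fun i => Int.fract (x i) + freqDot n (β i)) 𝒰
      (𝓝 (x₀ + freqDot n α)) := fun n => hx'.add (((continuous_freqDot n).tendsto α).comp hβ)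
  have hWn : ∀ n, Tendsto (fun i => modifiedValue f (t i) (Int.fract (x i) + freqDot n (β i))) 𝒰
      (𝓝 (W n)) := by
    intro n
    refine (tendsto_pi_nhds.1 hW n).congr fun i => ?_
    rw [← shiftedPotential_fract hf, shiftedPotential_apply]
  -- By rational independence of α at most one site of the limit phase is an integer; at all others
  -- the potential converges to the value of `f` there.
  by_cases hex : ∃ n₀, Int.fract (x₀ + freqDot n₀ α) = 0
  · obtain ⟨n₀, h0⟩ := hex
    obtain ⟨k, hk⟩ := Int.fract_eq_zero_iff.1 h0
    have hs0 := hs n₀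
    rw [← hk] at hs0
    have hrest : ∀ r n, n ≠ n₀ → W n = shiftedPotential f r α x₀ n := fun r n hn =>
      tendsto_nhds_unique (hWn n) (tendsto_modifiedValue hf (hs n) (hα.fract_ne_zero h0 hn) r)
    have hval : ∀ r, shiftedPotential f r α x₀ n₀ = r := fun r => modifiedValue_of_eq h0
    have hcase : ∃ r, (r = t₀ ∨ r = toCircleLine (f 0) ∨
        r = toCircleLine (Function.leftLim f 1)) ∧ W n₀ = r := by
      -- An ultrafilter decides whether the critical site is approached from the right, from the
      -- left, or hit exactly. The three cases give f(0), f(1-0) and the limit of the inserted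
      -- values.
      have htri : (∀ᶠ i in (𝒰 : Filter ι), (k : ℝ) < Int.fract (x i) + freqDot n₀ (β i)) ∨
          (∀ᶠ i in (𝒰 : Filter ι), Int.fract (x i) + freqDot n₀ (β i) < k) ∨
          ∀ᶠ i in (𝒰 : Filter ι), Int.fract (x i) + freqDot n₀ (β i) = k := by
        rw [← Ultrafilter.eventually_or, ← Ultrafilter.eventually_or]
        refine Eventually.of_forall fun i => ?_
        rcases lt_trichotomy (Int.fract (x i) + freqDot n₀ (β i)) k with h | h | h
        exacts [Or.inr (Or.inl h), Or.inr (Or.inr h), Or.inl h]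
      rcases htri with h | h | h
      · exact ⟨_, Or.inr (Or.inl rfl),
          tendsto_nhds_unique (hWn n₀) (tendsto_modifiedValue_of_gt hf hs0 h)⟩
      · exact ⟨_, Or.inr (Or.inr rfl),
          tendsto_nhds_unique (hWn n₀) (tendsto_modifiedValue_of_lt hf hs0 h)⟩
      · refine ⟨_, Or.inl rfl, tendsto_nhds_unique (hWn n₀) (ht.congr' ?_)⟩
        filter_upwards [h] with i hi
        rw [hi, modifiedValue_of_eq (Int.fract_intCast k)]
    obtain ⟨r, hr, hWr⟩ := hcase
    refine ⟨x₀, r, hr, funext fun n => ?_⟩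
    rcases eq_or_ne n n₀ with rfl | hn
    · rw [hval, hWr]
    · exact hrest r n hn
  · push Not at hex
    exact ⟨x₀, t₀, Or.inl rfl, funext fun n =>
      tendsto_nhds_unique (hWn n) (tendsto_modifiedValue hf (hs n) (hex n) t₀)⟩

/-- Site 0 carries the value t for every frequency, and for n ≠ 0 the number n · α is not an
integer, so `f` is continuous there. -/
theorem tendsto_shiftedPotential_zero (hf : HasSimpleDiscontinuity f) {α : Fin d → ℝ}
    (hα : RationallyIndependent α) (t : OnePoint ℝ) :
    Tendsto (fun β => shiftedPotential f t β 0) (𝓝 α) (𝓝 (shiftedPotential f t α 0)) := by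
  have h0 : Int.fract ((0 : ℝ) + freqDot (0 : Fin d → ℤ) α) = 0 := by simp [freqDot_zero]
  refine tendsto_pi_nhds.2 fun n => ?_
  rcases eq_or_ne n 0 with rfl | hn
  · have : ∀ β : Fin d → ℝ, shiftedPotential f t β 0 0 = t := fun β =>
      modifiedValue_of_eq (by simp [freqDot_zero])
    simp only [this]
    exact tendsto_const_nhds
  · refine tendsto_modifiedValue (t := fun _ => t) hf ?_ (hα.fract_ne_zero h0 hn) t
    exact tendsto_const_nhds.add ((continuous_freqDot n).tendsto α)

/-! ### Minimality of the one-sided spectra -/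

theorem mem_extSpectrum_of_forall_near {V : (Fin d → ℤ) → OnePoint ℝ} {E : OnePoint ℝ}
    (h : ∀ δ : ℝ, 0 < δ → ∃ E' ∈ extSpectrum V, dist (cayleyPoint E) (cayleyPoint E') < δ) :
    E ∈ extSpectrum V := by
  rw [mem_extSpectrum_iff, ← (spectrum.isClosed (𝕜 := ℂ) (cayleyOp V)).closure_eq,
    Metric.mem_closure_iff]
  intro δ hδ
  obtain ⟨E', hE', hd⟩ := h δ hδ
  exact ⟨cayleyPoint E', (mem_extSpectrum_iff V E').1 hE', hd⟩

/-- Translates have the same spectrum, and the spectrum of their limit is approximated by it through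
lower semicontinuity. -/
theorem extSpectrum_subset_of_tendsto_translate {V W : (Fin d → ℤ) → OnePoint ℝ} [NeBot l]
    {m : ι → Fin d → ℤ} (h : Tendsto (fun i => translatePotential (m i) V) l (𝓝 W)) :
    extSpectrum W ⊆ extSpectrum V := by
  intro E hE
  refine mem_extSpectrum_of_forall_near fun δ hδ => ?_
  obtain ⟨i, hi⟩ := (h.eventually (eventually_exists_extSpectrum_near hE hδ)).exists
  rwa [extSpectrum_translate] at hi

/-- One coordinate is enough: it is irrational, since a rational value p/q would make q times the
basis vector violate independence, and so it generates together with 1 a dense subgroup. -/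
theorem exists_freqDot_add_int_mem_Ioo (hd : 1 ≤ d) {α : Fin d → ℝ} (hα : RationallyIndependent α)
    {a b : ℝ} (hab : a < b) : ∃ (m : Fin d → ℤ) (k : ℤ), freqDot m α + k ∈ Ioo a b := by
  classical
  let i₀ : Fin d := ⟨0, hd⟩
  have hsingle : ∀ j : ℤ, freqDot (Pi.single i₀ j) α = j * α i₀ := by
    intro j
    rw [freqDot, Finset.sum_eq_single i₀]
    · simp
    · intro i _ hi
      simp [hi]
    · simp
  have hirr : Irrational (α i₀ / 1) := by
    rw [div_one]
    rintro ⟨q, hq⟩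
    refine hα (Pi.single i₀ (q.den : ℤ)) (by simp) q.num ?_
    rw [hsingle, ← hq]
    have := Rat.den_mul_eq_num q
    exact_mod_cast this
  have hdense := dense_addSubgroupClosure_pair_iff.2 hirr
  obtain ⟨y, hy, hy'⟩ := hdense.exists_between hab
  obtain ⟨j, k, hjk⟩ := AddSubgroup.mem_closure_pair.1 hy
  refine ⟨Pi.single i₀ j, k, ?_⟩
  rw [hsingle]
  have : (j : ℝ) * α i₀ + k = y := by simpa using hjk
  rwa [this]

theorem extSpectrum_subset_of_tendsto_base (hf : HasSimpleDiscontinuity f) {α : Fin d → ℝ}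
    {r t : OnePoint ℝ} {x y : ℝ} {m : ℕ → Fin d → ℤ} {k : ℕ → ℤ}
    (hlim : Tendsto (fun j => y + (freqDot (m j) α + k j)) atTop (𝓝 x))
    (hside : ∀ n, Int.fract (x + freqDot n α) = 0 → Tendsto
      (fun j => modifiedValue f t (y + (freqDot (m j) α + k j) + freqDot n α)) atTop (𝓝 r)) :
    extSpectrum (shiftedPotential f r α x) ⊆ extSpectrum (shiftedPotential f t α y) := by
  have htrans : (fun j => translatePotential (m j) (shiftedPotential f t α y))
      = fun j => shiftedPotential f t α (y + (freqDot (m j) α + k j)) := by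
    funext j
    rw [translatePotential_shiftedPotential, ← shiftedPotential_add_int hf _ _ _ (k j), add_assoc]
  refine extSpectrum_subset_of_tendsto_translate (l := atTop) (m := m) ?_
  rw [htrans]
  refine tendsto_pi_nhds.2 fun n => ?_
  simp only [shiftedPotential_apply]
  by_cases h : Int.fract (x + freqDot n α) = 0
  · rw [modifiedValue_of_eq h]
    exact hside n h
  · exact tendsto_modifiedValue (t := fun _ => t) hf (hlim.add_const (freqDot n α)) h _

/-- The spectra of one-sided limits are contained in the spectrum of every shifted potential. -/
theorem extSpectrum_oneSided_subset (hd : 1 ≤ d) (hf : HasSimpleDiscontinuity f) {α : Fin d → ℝ}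
    (hα : RationallyIndependent α) {r : OnePoint ℝ}
    (hr : r = toCircleLine (f 0) ∨ r = toCircleLine (Function.leftLim f 1)) (x : ℝ)
    (t : OnePoint ℝ) (y : ℝ) :
    extSpectrum (shiftedPotential f r α x) ⊆ extSpectrum (shiftedPotential f t α y) := by
  have hδ : Tendsto (fun j : ℕ => 1 / ((j : ℝ) + 1)) atTop (𝓝 0) :=
    tendsto_one_div_add_atTop_nhds_zero_nat
  have hpos : ∀ j : ℕ, 0 < 1 / ((j : ℝ) + 1) := fun j => by positivity
  rcases hr with rfl | rfl
  -- The shifted phases converge to x strictly from the right, so an integer site of the limit is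
  -- approached from the right and receives f(0). The other case is the mirror image.
  · choose m k hmk using fun j : ℕ =>
      exists_freqDot_add_int_mem_Ioo hd hα (lt_add_of_pos_right (x - y) (hpos j))
    have hlim : Tendsto (fun j => y + (freqDot (m j) α + k j)) atTop (𝓝 x) := by
      have h0 := hδ.const_add x
      rw [add_zero] at h0
      refine tendsto_of_tendsto_of_tendsto_of_le_of_le tendsto_const_nhds h0 (fun j => ?_)
        (fun j => ?_)
      · have := (hmk j).1; linarith
      · have := (hmk j).2; linarith
    refine extSpectrum_subset_of_tendsto_base hf hlim fun n h => ?_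
    have hlimn := hlim.add_const (freqDot n α)
    obtain ⟨q, hq⟩ := Int.fract_eq_zero_iff.1 h
    rw [← hq] at hlimn
    refine tendsto_modifiedValue_of_gt (t := fun _ => t) hf hlimn (Eventually.of_forall fun j => ?_)
    rw [hq]
    have := (hmk j).1
    linarith
  · choose m k hmk using fun j : ℕ =>
      exists_freqDot_add_int_mem_Ioo hd hα (sub_lt_self (x - y) (hpos j))
    have hlim : Tendsto (fun j => y + (freqDot (m j) α + k j)) atTop (𝓝 x) := by
      have h0 := hδ.const_sub x
      rw [sub_zero] at h0
      refine tendsto_of_tendsto_of_tendsto_of_le_of_le h0 tendsto_const_nhds (fun j => ?_)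
        (fun j => ?_)
      · have := (hmk j).1; linarith
      · have := (hmk j).2; linarith
    refine extSpectrum_subset_of_tendsto_base hf hlim fun n h => ?_
    have hlimn := hlim.add_const (freqDot n α)
    obtain ⟨q, hq⟩ := Int.fract_eq_zero_iff.1 h
    rw [← hq] at hlimn
    refine tendsto_modifiedValue_of_lt (t := fun _ => t) hf hlimn (Eventually.of_forall fun j => ?_)
    rw [hq]
    have := (hmk j).2
    linarith

end Potentials

/-! ### The hull parametrization -/

section HullParametrization

theorem hasSum_int_geometric_weight : HasSum (fun k : ℤ => (3 : ℝ)⁻¹ * ((2 : ℝ) ^ k.natAbs)⁻¹) 1 := by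
  set g : ℤ → ℝ := fun k => (3 : ℝ)⁻¹ * ((2 : ℝ) ^ k.natAbs)⁻¹ with hg
  have h0 : HasSum (fun n : ℕ => g n) (3⁻¹ * 2) := by
    have h : (fun n : ℕ => g n) = fun n : ℕ => (3 : ℝ)⁻¹ * (1 / 2) ^ n := by
      funext n
      rw [hg]
      simp only [Int.natAbs_natCast, one_div, inv_pow]
    rw [h]
    exact hasSum_geometric_two.mul_left _
  -- The negative integers start at -1, which halves the constant 1/3; the two halves sum to 2/3 +
  -- 1/3.
  have h1 : HasSum (fun n : ℕ => g (-((n : ℤ) + 1))) (6⁻¹ * 2) := by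
    have h : (fun n : ℕ => g (-((n : ℤ) + 1))) = fun n : ℕ => (6 : ℝ)⁻¹ * (1 / 2) ^ n := by
      funext n
      rw [hg]
      simp only [Int.natAbs_neg, one_div, inv_pow]
      rw [show ((n : ℤ) + 1).natAbs = n + 1 by omega, pow_succ', mul_inv, ← mul_assoc]
      norm_num
    rw [h]
    exact hasSum_geometric_two.mul_left _
  have h := HasSum.of_nat_of_neg_add_one (f := g) h0 h1
  norm_num at h
  exact h

theorem siteWeight_pos {d : ℕ} (n : Fin d → ℤ) : 0 < siteWeight n := by
  unfold siteWeight
  positivity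

theorem siteWeight_cons {d : ℕ} (k : ℤ) (n : Fin d → ℤ) :
    siteWeight (Fin.cons k n : Fin (d + 1) → ℤ) = 3⁻¹ * (2 ^ k.natAbs)⁻¹ * siteWeight n := by
  simp only [siteWeight, Fin.sum_univ_succ, Fin.cons_zero, Fin.cons_succ, pow_succ, pow_add, mul_inv]
  ring

theorem hasSum_siteWeight (d : ℕ) : HasSum (siteWeight : (Fin d → ℤ) → ℝ) 1 := by
  induction d with
  | zero =>
    have : (siteWeight : (Fin 0 → ℤ) → ℝ) = fun _ => 1 := by
      funext n
      simp [siteWeight]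
    rw [this]
    convert hasSum_fintype (fun _ : Fin 0 → ℤ => (1 : ℝ))
    simp
  | succ d ih =>
    have hg := hasSum_int_geometric_weight
    have hprod := HasSum.mul hg ih (Summable.mul_of_nonneg hg.summable ih.summable
      (fun k => by positivity) fun n => (siteWeight_pos n).le)
    rw [one_mul] at hprod
    rw [← Equiv.hasSum_iff (Fin.consEquiv fun _ : Fin (d + 1) => ℤ)]
    have : (siteWeight ∘ (Fin.consEquiv fun _ : Fin (d + 1) => ℤ))
        = fun p : ℤ × (Fin d → ℤ) => 3⁻¹ * (2 ^ p.1.natAbs)⁻¹ * siteWeight p.2 := by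
      funext p
      exact siteWeight_cons p.1 p.2
    rw [this]
    exact hprod

/-! ### Monotonicity and one-sided limits of the step function h -/

variable {d : ℕ} (β : Fin d → ℝ)

open Classical in
theorem summable_ite_siteWeight (p : (Fin d → ℤ) → Prop) :
    Summable fun n : Fin d → ℤ => if p n then siteWeight n else 0 := by
  refine (hasSum_siteWeight d).summable.of_nonneg_of_le (fun n => ?_) fun n => ?_
  · split_ifs
    exacts [(siteWeight_pos n).le, le_rfl]
  · split_ifs
    exacts [le_rfl, (siteWeight_pos n).le]

open Classical in
theorem tsum_ite_siteWeight_mono {p q : (Fin d → ℤ) → Prop} (h : ∀ n, p n → q n) :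
    ∑' n : Fin d → ℤ, (if p n then siteWeight n else 0)
      ≤ ∑' n : Fin d → ℤ, if q n then siteWeight n else 0 := by
  refine (summable_ite_siteWeight p).tsum_le_tsum (fun n => ?_) (summable_ite_siteWeight q)
  by_cases hp : p n
  · rw [if_pos hp, if_pos (h n hp)]
  · rw [if_neg hp]
    split_ifs
    exacts [(siteWeight_pos n).le, le_rfl]

open Classical in
theorem tsum_ite_siteWeight_lt {p q : (Fin d → ℤ) → Prop} (h : ∀ n, p n → q n) {n₀ : Fin d → ℤ}
    (hp : ¬p n₀) (hq : q n₀) :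
    ∑' n : Fin d → ℤ, (if p n then siteWeight n else 0)
      < ∑' n : Fin d → ℤ, if q n then siteWeight n else 0 := by
  refine (summable_ite_siteWeight p).tsum_lt_tsum (i := n₀) (fun n => ?_) ?_
    (summable_ite_siteWeight q)
  · by_cases hp : p n
    · rw [if_pos hp, if_pos (h n hp)]
    · rw [if_neg hp]
      split_ifs
      exacts [(siteWeight_pos n).le, le_rfl]
  · rw [if_neg hp, if_pos hq]
    exact siteWeight_pos n₀

open Classical in
theorem tsum_ite_siteWeight_nonneg (p : (Fin d → ℤ) → Prop) :
    0 ≤ ∑' n : Fin d → ℤ, if p n then siteWeight n else 0 :=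
  tsum_nonneg fun n => by split_ifs; exacts [(siteWeight_pos n).le, le_rfl]

open Classical in
theorem tsum_ite_siteWeight_le_one (p : (Fin d → ℤ) → Prop) :
    ∑' n : Fin d → ℤ, (if p n then siteWeight n else 0) ≤ 1 := by
  have := tsum_ite_siteWeight_mono (p := p) (q := fun _ => True) fun _ _ => trivial
  simpa [(hasSum_siteWeight d).tsum_eq] using this

open Classical in
theorem tendsto_tsum_ite_siteWeight {l : Filter ℝ} {p : ℝ → (Fin d → ℤ) → Prop}
    {q : (Fin d → ℤ) → Prop} (h : ∀ n, ∀ᶠ y in l, p y n ↔ q n) :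
    Tendsto (fun y => ∑' n : Fin d → ℤ, if p y n then siteWeight n else 0) l
      (𝓝 (∑' n : Fin d → ℤ, if q n then siteWeight n else 0)) := by
  refine tendsto_tsum_of_dominated_convergence (hasSum_siteWeight d).summable (fun n => ?_)
    (Eventually.of_forall fun y n => ?_)
  · refine tendsto_const_nhds.congr' ?_
    filter_upwards [h n] with y hy
    by_cases hq : q n
    · rw [if_pos hq, if_pos (hy.2 hq)]
    · rw [if_neg hq, if_neg fun hp => hq (hy.1 hp)]
  · split_ifs
    · rw [Real.norm_of_nonneg (siteWeight_pos n).le]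
    · simpa using (siteWeight_pos n).le

theorem hullStep_add_le {y z : ℝ} (h : y ≤ z) : hullStep β y + (z - y) ≤ hullStep β z := by
  have := tsum_ite_siteWeight_mono (p := fun n : Fin d → ℤ => Int.fract (freqDot n β) ≤ y)
    (q := fun n => Int.fract (freqDot n β) ≤ z) fun n hn => hn.trans h
  unfold hullStep
  linarith

theorem hullStep_strictMono : StrictMono (hullStep β) := fun y z h => by
  have := hullStep_add_le β h.le
  linarith

theorem hullStep_nonneg {y : ℝ} (hy : 0 ≤ y) : 0 ≤ hullStep β y := by
  have := tsum_ite_siteWeight_nonneg fun n : Fin d → ℤ => Int.fract (freqDot n β) ≤ y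
  unfold hullStep
  linarith

theorem hullStep_le_add_one (y : ℝ) : hullStep β y ≤ y + 1 := by
  have := tsum_ite_siteWeight_le_one fun n : Fin d → ℤ => Int.fract (freqDot n β) ≤ y
  unfold hullStep
  linarith

theorem hullStep_one : hullStep β 1 = 2 := by
  have h : ∀ n : Fin d → ℤ, Int.fract (freqDot n β) ≤ 1 := fun n => (Int.fract_lt_one _).le
  simp only [hullStep, h, if_true, (hasSum_siteWeight d).tsum_eq]
  norm_num

theorem hullStepLeft_zero : hullStepLeft β 0 = -1 := if_pos rfl

theorem hullStepLeft_le (y : ℝ) (hy : 0 ≤ y) : hullStepLeft β y ≤ hullStep β y := by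
  rcases hy.eq_or_lt with rfl | h0
  · rw [hullStepLeft_zero]
    linarith [hullStep_nonneg β le_rfl]
  · have := tsum_ite_siteWeight_mono (p := fun n : Fin d → ℤ => Int.fract (freqDot n β) < y)
      (q := fun n => Int.fract (freqDot n β) ≤ y) fun n hn => hn.le
    rw [hullStepLeft, if_neg h0.ne', hullStep]
    linarith

/-- The gap at {n·β} is nondegenerate: at y = 0 it runs from -1 to a nonnegative number, and
elsewhere the site n alone adds a positive jump. -/
theorem hullStepLeft_lt (n : Fin d → ℤ) :
    hullStepLeft β (Int.fract (freqDot n β)) < hullStep β (Int.fract (freqDot n β)) := by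
  rcases (Int.fract_nonneg (freqDot n β)).eq_or_lt with h | h0
  · rw [← h, hullStepLeft_zero]
    linarith [hullStep_nonneg β le_rfl]
  · have := tsum_ite_siteWeight_lt
      (p := fun m : Fin d → ℤ => Int.fract (freqDot m β) < Int.fract (freqDot n β))
      (q := fun m => Int.fract (freqDot m β) ≤ Int.fract (freqDot n β)) (fun m hm => hm.le)
      (n₀ := n) (lt_irrefl _) le_rfl
    rw [hullStepLeft, if_neg h0.ne', hullStep]
    linarith

/-- The summand y makes the gaps at different points disjoint, even when no jump lies between them.
-/
theorem hullStep_lt_left {y z : ℝ} (hy : 0 ≤ y) (h : y < z) : hullStep β y < hullStepLeft β z := by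
  have := tsum_ite_siteWeight_mono (p := fun n : Fin d → ℤ => Int.fract (freqDot n β) ≤ y)
    (q := fun n => Int.fract (freqDot n β) < z) fun n hn => hn.trans_lt h
  rw [hullStepLeft, if_neg (hy.trans_lt h).ne', hullStep]
  linarith

theorem neg_one_le_hullStepLeft {y : ℝ} (hy : 0 ≤ y) : -1 ≤ hullStepLeft β y := by
  rcases hy.eq_or_lt with rfl | h0
  · rw [hullStepLeft_zero]
  · have := tsum_ite_siteWeight_nonneg fun n : Fin d → ℤ => Int.fract (freqDot n β) < y
    rw [hullStepLeft, if_neg h0.ne']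
    linarith

theorem tendsto_hullStep_right (y : ℝ) : Tendsto (hullStep β) (𝓝[>] y) (𝓝 (hullStep β y)) := by
  refine Tendsto.add (tendsto_id.mono_left nhdsWithin_le_nhds)
    (tendsto_tsum_ite_siteWeight fun n => ?_)
  by_cases h : Int.fract (freqDot n β) ≤ y
  · filter_upwards [self_mem_nhdsWithin] with z hz
    exact iff_of_true (h.trans (le_of_lt hz)) h
  · filter_upwards [mem_nhdsWithin_of_mem_nhds (Iio_mem_nhds (not_le.1 h))] with z hz
    exact iff_of_false (not_le.2 hz) h

theorem tendsto_hullStep_left {y : ℝ} (hy : 0 < y) :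
    Tendsto (hullStep β) (𝓝[<] y) (𝓝 (hullStepLeft β y)) := by
  rw [hullStepLeft, if_neg hy.ne']
  refine Tendsto.add (tendsto_id.mono_left nhdsWithin_le_nhds)
    (tendsto_tsum_ite_siteWeight fun n => ?_)
  by_cases h : Int.fract (freqDot n β) < y
  · filter_upwards [mem_nhdsWithin_of_mem_nhds (Ioi_mem_nhds h)] with z hz
    exact iff_of_true (le_of_lt hz) h
  · filter_upwards [self_mem_nhdsWithin] with z hz
    exact iff_of_false (not_le.2 (lt_of_lt_of_le hz (not_lt.1 h))) h

/-! ### Base points and gap coordinates on the parameter circle -/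

theorem circleRep_mem (θ : ParamCircle) : circleRep θ ∈ Ico (-1 : ℝ) 2 := by
  have h := (AddCircle.equivIco (3 : ℝ) (-1) θ).2
  exact ⟨h.1, h.2.trans_eq (by norm_num)⟩

theorem coe_circleRep (θ : ParamCircle) : ((circleRep θ : ℝ) : ParamCircle) = θ :=
  (AddCircle.equivIco (3 : ℝ) (-1)).symm_apply_apply θ

theorem circleRep_coe {c : ℝ} (hc : c ∈ Ico (-1 : ℝ) 2) : circleRep (c : ParamCircle) = c := by
  rw [circleRep, AddCircle.equivIco_coe_eq]
  rwa [show (-1 : ℝ) + 3 = 2 by norm_num]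

/-- Right continuity of h makes the infimum attained; the value h(1) = 2 exceeds every
representative, so the set is nonempty. -/
theorem basePoint_isLeast (θ : ParamCircle) :
    IsLeast {y | y ∈ Icc (0 : ℝ) 1 ∧ circleRep θ ≤ hullStep β y} (basePoint β θ) := by
  set A := {y | y ∈ Icc (0 : ℝ) 1 ∧ circleRep θ ≤ hullStep β y} with hA
  have hne : A.Nonempty := ⟨1, ⟨zero_le_one, le_rfl⟩, by
    rw [hullStep_one]; exact (circleRep_mem θ).2.le⟩
  have hbdd : BddBelow A := ⟨0, fun y hy => hy.1.1⟩
  have hglb : IsGLB A (basePoint β θ) := isGLB_csInf hne hbdd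
  refine ⟨?_, hglb.1⟩
  have h0 : 0 ≤ basePoint β θ := hglb.2 fun y hy => hy.1.1
  have h1 : basePoint β θ ≤ 1 := hglb.1 ⟨⟨zero_le_one, le_rfl⟩, by
    rw [hullStep_one]; exact (circleRep_mem θ).2.le⟩
  refine ⟨⟨h0, h1⟩, ge_of_tendsto (tendsto_hullStep_right β (basePoint β θ)) ?_⟩
  filter_upwards [self_mem_nhdsWithin] with z hz
  obtain ⟨y, hy, hyz⟩ := (isGLB_lt_iff hglb).1 (mem_Ioi.1 hz)
  exact hy.2.trans ((hullStep_strictMono β).monotone hyz.le)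

theorem basePoint_eq {θ : ParamCircle} {x : ℝ} (hx : x ∈ Icc (0 : ℝ) 1)
    (h1 : hullStepLeft β x ≤ circleRep θ) (h2 : circleRep θ ≤ hullStep β x) :
    basePoint β θ = x := by
  refine (basePoint_isLeast β θ).unique ⟨⟨hx, h2⟩, fun y hy => ?_⟩
  by_contra! hlt
  exact absurd (h1.trans hy.2) (not_le.2 (hullStep_lt_left β hy.1.1 hlt))

theorem circleRep_mem_gap (θ : ParamCircle) :
    circleRep θ ∈ Icc (hullStepLeft β (basePoint β θ)) (hullStep β (basePoint β θ)) := by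
  have h := basePoint_isLeast β θ
  refine ⟨?_, h.1.2⟩
  rcases h.1.1.1.eq_or_lt with h0 | h0
  · rw [← h0, hullStepLeft_zero]
    exact (circleRep_mem θ).1
  · refine le_of_tendsto (tendsto_hullStep_left β h0) ?_
    filter_upwards [Ioo_mem_nhdsLT h0] with z hz
    by_contra! hlt
    exact absurd (h.2 ⟨⟨hz.1.le, hz.2.le.trans h.1.1.2⟩, hlt.le⟩) (not_le.2 hz.2)

theorem gapCoordinate_mem (θ : ParamCircle) : gapCoordinate β θ ∈ Icc (-1 : ℝ) 0 := by
  have h := circleRep_mem_gap β θ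
  have hle : hullStepLeft β (basePoint β θ) ≤ hullStep β (basePoint β θ) := h.1.trans h.2
  refine ⟨?_, div_nonpos_of_nonpos_of_nonneg (by linarith [h.2]) (by linarith)⟩
  rcases hle.eq_or_lt with h0 | h0
  -- A degenerate gap has denominator 0, and the default value 0 of the quotient lies in the
  -- required interval.
  · rw [gapCoordinate, h0, sub_self, div_zero]
    norm_num
  · rw [gapCoordinate, le_div_iff₀ (sub_pos.2 h0)]
    linarith [h.1]

/-- The interior of a gap is open in the circle and misses the range of h, hence also its closure.
Only the two endpoints of a gap can remain. -/
theorem gapCoordinate_of_mem_paramCantor {θ : ParamCircle} (hθ : θ ∈ paramCantor β) :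
    gapCoordinate β θ = 0 ∨ gapCoordinate β θ = -1 := by
  have h := circleRep_mem_gap β θ
  have hb := (basePoint_isLeast β θ).1.1
  rcases h.2.eq_or_lt with h2 | h2
  · left
    rw [gapCoordinate, h2, sub_self, zero_div]
  rcases h.1.eq_or_lt with h1 | h1
  · right
    have : hullStep β (basePoint β θ) - hullStepLeft β (basePoint β θ) ≠ 0 := by
      rw [h1]; exact (sub_pos.2 h2).ne'
    rw [gapCoordinate, ← h1, div_eq_iff this]
    ring
  exfalso
  have hopen : IsOpen ((fun c : ℝ => (c : ParamCircle)) ''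
      Ioo (hullStepLeft β (basePoint β θ)) (hullStep β (basePoint β θ))) :=
    QuotientAddGroup.isOpenMap_coe _ isOpen_Ioo
  obtain ⟨_, ⟨r, hr, rfl⟩, ⟨y, hy, hyr⟩⟩ := mem_closure_iff.1 hθ _ hopen
    ⟨circleRep θ, ⟨h1, h2⟩, coe_circleRep θ⟩
  have hlt : -1 < r := (neg_one_le_hullStepLeft β hb.1).trans_lt hr.1
  have hr2 : r < 2 := by
    refine hr.2.trans_le ?_
    have := hullStep_le_add_one β (basePoint β θ)
    linarith [hb.2]
  have hy0 := hullStep_nonneg β hy.1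
  have hy2 : hullStep β y ≤ 2 := by
    have := hullStep_le_add_one β y
    linarith [hy.2]
  have hyr' : hullStep β y = r := by
    -- The fundamental domain is (-1, 2], closed on the right, because h takes the value 2 at y = 1.
    refine (AddCircle.coe_eq_coe_iff_of_mem_Ioc (p := (3 : ℝ)) (a := -1) ⟨?_, ?_⟩ ⟨hlt, ?_⟩).1 hyr
    all_goals linarith
  rcases lt_or_ge y (basePoint β θ) with hlt | hge
  · exact absurd (hullStep_lt_left β hy.1 hlt) (not_lt.2 (hyr' ▸ hr.1.le))
  · exact absurd ((hullStep_strictMono β).monotone hge) (not_le.2 (hyr' ▸ hr.2))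

variable (f : ℝ → EReal) (φ : ℝ → OnePoint ℝ)

theorem exists_hullPotential_eq (θ : ParamCircle) :
    ∃ u ∈ Icc (-1 : ℝ) 0, ∃ x, hullPotential f φ β θ = shiftedPotential f (φ u) β x :=
  ⟨_, gapCoordinate_mem β θ, _, rfl⟩

theorem exists_hullPotential_eq_of_mem_paramCantor {θ : ParamCircle} (hθ : θ ∈ paramCantor β) :
    ∃ u, (u = 0 ∨ u = -1) ∧ ∃ x, hullPotential f φ β θ = shiftedPotential f (φ u) β x :=
  ⟨_, gapCoordinate_of_mem_paramCantor β hθ, _, rfl⟩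

theorem hullPotential_gapPoint (n : Fin d → ℤ) {u : ℝ} (hu : u ∈ Icc (-1 : ℝ) 0) :
    hullPotential f φ β (gapPoint β n u)
      = shiftedPotential f (φ u) β (Int.fract (freqDot n β)) := by
  set y := Int.fract (freqDot n β) with hy
  have hy0 : 0 ≤ y := Int.fract_nonneg _
  have hy1 : y < 1 := Int.fract_lt_one _
  have hgap : hullStepLeft β y < hullStep β y := hullStepLeft_lt β n
  have hpos := sub_pos.2 hgap
  have h1 : hullStepLeft β y ≤ hullStep β y + u * (hullStep β y - hullStepLeft β y) := by
    nlinarith [hu.1]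
  have h2 : hullStep β y + u * (hullStep β y - hullStepLeft β y) ≤ hullStep β y := by
    nlinarith [hu.2]
  have hrep : circleRep (gapPoint β n u)
      = hullStep β y + u * (hullStep β y - hullStepLeft β y) := by
    refine circleRep_coe ⟨(neg_one_le_hullStepLeft β hy0).trans h1, h2.trans_lt ?_⟩
    have := hullStep_le_add_one β y
    linarith
  have hbase : basePoint β (gapPoint β n u) = y :=
    basePoint_eq β ⟨hy0, hy1.le⟩ (by rw [hrep]; exact h1) (by rw [hrep]; exact h2)
  have hcoord : gapCoordinate β (gapPoint β n u) = u := by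
    rw [gapCoordinate, hbase, hrep, add_sub_cancel_left, mul_div_cancel_right₀ _ hpos.ne']
  rw [hullPotential, hbase, hcoord]

theorem hullPotential_hullStep {x : ℝ} (hx : x ∈ Ico (0 : ℝ) 1) :
    hullPotential f φ β ((hullStep β x : ℝ) : ParamCircle) = shiftedPotential f (φ 0) β x := by
  have hrep : circleRep ((hullStep β x : ℝ) : ParamCircle) = hullStep β x := by
    refine circleRep_coe ⟨by linarith [hullStep_nonneg β hx.1], ?_⟩
    have := hullStep_le_add_one β x
    linarith [hx.2]
  have hbase : basePoint β ((hullStep β x : ℝ) : ParamCircle) = x :=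
    basePoint_eq β ⟨hx.1, hx.2.le⟩ (by rw [hrep]; exact hullStepLeft_le β x hx.1) hrep.le
  rw [hullPotential, gapCoordinate, hbase, hrep, sub_self, zero_div]

theorem hullStep_mem_paramCantor {x : ℝ} (hx : x ∈ Icc (0 : ℝ) 1) :
    ((hullStep β x : ℝ) : ParamCircle) ∈ paramCantor β :=
  subset_closure ⟨x, hx, rfl⟩

end HullParametrization

/-! ### Constancy of the spectrum -/

section Constancy

variable {d : ℕ} {f : ℝ → EReal} {φ : ℝ → OnePoint ℝ} {α : Fin d → ℝ}

/-- Either some site is an integer, and then the potential is a translate of the one at phase 0; or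
t is never inserted, and the potential is a one-sided one, of minimal spectrum. -/
theorem extSpectrum_shiftedPotential_subset_zero (hd : 1 ≤ d) (hf : HasSimpleDiscontinuity f)
    (hα : RationallyIndependent α) (t : OnePoint ℝ) (x : ℝ) :
    extSpectrum (shiftedPotential f t α x) ⊆ extSpectrum (shiftedPotential f t α 0) := by
  by_cases h : ∃ n, Int.fract (x + freqDot n α) = 0
  · obtain ⟨n, hn⟩ := h
    obtain ⟨k, hk⟩ := Int.fract_eq_zero_iff.1 hn
    have hx : x = 0 + freqDot (-n) α + k := by
      rw [freqDot_neg]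
      linarith
    rw [hx, shiftedPotential_add_int hf, ← translatePotential_shiftedPotential,
      extSpectrum_translate]
  · push Not at h
    have hx : shiftedPotential f t α x = shiftedPotential f (toCircleLine (f 0)) α x := by
      funext n
      rw [shiftedPotential_apply, shiftedPotential_apply, modifiedValue_of_ne (h n),
        modifiedValue_of_ne (h n)]
    rw [hx]
    exact extSpectrum_oneSided_subset hd hf hα (Or.inl rfl) _ _ _

theorem IsArcParametrization.apply_oneSided (hφ : IsArcParametrization f φ) {u : ℝ}
    (hu : u = 0 ∨ u = -1) :
    φ u = toCircleLine (f 0) ∨ φ u = toCircleLine (Function.leftLim f 1) := by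
  rcases hu with rfl | rfl
  exacts [Or.inl hφ.right, Or.inr hφ.left]

theorem extSpectrum_oneSided_eq (hd : 1 ≤ d) (hf : HasSimpleDiscontinuity f)
    (hφ : IsArcParametrization f φ) (hα : RationallyIndependent α) {u v : ℝ}
    (hu : u = 0 ∨ u = -1) (hv : v = 0 ∨ v = -1) (x y : ℝ) :
    extSpectrum (shiftedPotential f (φ u) α x) = extSpectrum (shiftedPotential f (φ v) α y) :=
  Subset.antisymm (extSpectrum_oneSided_subset hd hf hα (hφ.apply_oneSided hu) _ _ _)
    (extSpectrum_oneSided_subset hd hf hα (hφ.apply_oneSided hv) _ _ _)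

theorem extSpectrum_hullPotential_of_mem_paramCantor (hd : 1 ≤ d) (hf : HasSimpleDiscontinuity f)
    (hφ : IsArcParametrization f φ) (hα : RationallyIndependent α) {θ : ParamCircle}
    (hθ : θ ∈ paramCantor α) :
    extSpectrum (hullPotential f φ α θ) = extSpectrum (shiftedPotential f (φ 0) α 0) := by
  obtain ⟨u, hu, x, hx⟩ := exists_hullPotential_eq_of_mem_paramCantor α f φ hθ
  rw [hx]
  exact extSpectrum_oneSided_eq hd hf hφ hα hu (Or.inl rfl) _ _

theorem unionSpectrum_eq_of_forall {β : Fin d → ℝ} {Θ : Set ParamCircle} {S₀ : Set (OnePoint ℝ)}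
    (hne : Θ.Nonempty) (h : ∀ θ ∈ Θ, extSpectrum (hullPotential f φ β θ) = S₀) :
    unionSpectrum f φ β Θ = S₀ := by
  rw [unionSpectrum, iUnion₂_congr h, biUnion_const hne]

theorem paramCantor_nonempty (β : Fin d → ℝ) : (paramCantor β).Nonempty :=
  ⟨_, hullStep_mem_paramCantor β ⟨le_rfl, zero_le_one⟩⟩

theorem unionSpectrum_paramCantor (hd : 1 ≤ d) (hf : HasSimpleDiscontinuity f)
    (hφ : IsArcParametrization f φ) (hα : RationallyIndependent α) :
    unionSpectrum f φ α (paramCantor α) = extSpectrum (shiftedPotential f (φ 0) α 0) :=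
  unionSpectrum_eq_of_forall (paramCantor_nonempty α) fun _ hθ =>
    extSpectrum_hullPotential_of_mem_paramCantor hd hf hφ hα hθ

theorem extSpectrum_hullPotential_of_mem_paramLevel (hf : HasSimpleDiscontinuity f)
    {β : Fin d → ℝ} {t : OnePoint ℝ} {θ : ParamCircle} (hθ : θ ∈ paramLevel φ β t) :
    extSpectrum (hullPotential f φ β θ) = extSpectrum (shiftedPotential f t β 0) := by
  obtain ⟨u, hu, rfl, n, rfl⟩ := hθ
  rw [hullPotential_gapPoint β f φ n hu, extSpectrum_shiftedPotential_freqDot hf]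

/-- All gaps give translates of one potential, for rational and irrational β alike. -/
theorem unionSpectrum_paramLevel (hf : HasSimpleDiscontinuity f) {t : OnePoint ℝ}
    (ht : t ∈ φ '' Icc (-1) 0) (β : Fin d → ℝ) :
    unionSpectrum f φ β (paramLevel φ β t) = extSpectrum (shiftedPotential f t β 0) := by
  obtain ⟨u, hu, hut⟩ := ht
  exact unionSpectrum_eq_of_forall ⟨_, u, hu, hut, 0, rfl⟩ fun _ hθ =>
    extSpectrum_hullPotential_of_mem_paramLevel hf hθ

theorem hullPotential_gapPoint_zero (β : Fin d → ℝ) {u : ℝ} (hu : u ∈ Icc (-1 : ℝ) 0) :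
    hullPotential f φ β (gapPoint β 0 u) = shiftedPotential f (φ u) β 0 := by
  rw [hullPotential_gapPoint β f φ 0 hu, freqDot_zero, Int.fract_zero]

theorem extSpectrum_subset_unionSpectrum_univ (β : Fin d → ℝ) {u : ℝ} (hu : u ∈ Icc (-1 : ℝ) 0) :
    extSpectrum (shiftedPotential f (φ u) β 0) ⊆ unionSpectrum f φ β univ := by
  rw [← hullPotential_gapPoint_zero β hu]
  exact subset_biUnion_of_mem (u := fun θ => extSpectrum (hullPotential f φ β θ)) (mem_univ _)

theorem extSpectrum_subset_unionSpectrum_paramCantor (β : Fin d → ℝ) :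
    extSpectrum (shiftedPotential f (φ 0) β 0) ⊆ unionSpectrum f φ β (paramCantor β) := by
  rw [← hullPotential_hullStep β f φ ⟨le_rfl, zero_lt_one⟩]
  exact subset_biUnion_of_mem (u := fun θ => extSpectrum (hullPotential f φ β θ))
    (hullStep_mem_paramCantor β ⟨le_rfl, zero_le_one⟩)

end Constancy

/-! ### Convergence of the spectra -/

section Convergence

variable {d : ℕ} {f : ℝ → EReal} {φ : ℝ → OnePoint ℝ} {α : Fin d → ℝ}

/-- Limits of translates either keep the inserted value t₀ or become one-sided; in both cases their
spectrum lies in that of H_{t₀}(α, 0). -/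
theorem mem_extSpectrum_of_tendsto (hd : 1 ≤ d) (hf : HasSimpleDiscontinuity f)
    (hα : RationallyIndependent α) {ι : Type*} (𝒰 : Ultrafilter ι) {β : ι → Fin d → ℝ}
    (hβ : Tendsto β 𝒰 (𝓝 α)) {t : ι → OnePoint ℝ} {t₀ : OnePoint ℝ} (ht : Tendsto t 𝒰 (𝓝 t₀))
    (x : ι → ℝ) {e : ι → OnePoint ℝ} {E : OnePoint ℝ}
    (he : ∀ i, e i ∈ extSpectrum (shiftedPotential f (t i) (β i) (x i)))
    (hlim : Tendsto e 𝒰 (𝓝 E)) : E ∈ extSpectrum (shiftedPotential f t₀ α 0) := by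
  refine mem_extSpectrum_of_forall_near fun δ hδ => ?_
  obtain ⟨m, W, hW, E', hE', hdist⟩ :=
    exists_translate_tendsto_extSpectrum_near 𝒰 he hlim (half_pos hδ)
  simp only [translatePotential_shiftedPotential] at hW
  obtain ⟨x₀, r, hr, rfl⟩ := exists_eq_shiftedPotential_of_tendsto hf hα 𝒰 hβ ht _ hW
  refine ⟨E', ?_, hdist.trans_lt (half_lt_self hδ)⟩
  rcases hr with rfl | hr
  · exact extSpectrum_shiftedPotential_subset_zero hd hf hα _ _ hE'
  · exact extSpectrum_oneSided_subset hd hf hα hr _ _ _ hE'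

theorem mem_extSpectrum_of_tendsto_paramCantor (hd : 1 ≤ d) (hf : HasSimpleDiscontinuity f)
    (hφ : IsArcParametrization f φ) (hα : RationallyIndependent α) {ι : Type*} (𝒰 : Ultrafilter ι)
    {β : ι → Fin d → ℝ} (hβ : Tendsto β 𝒰 (𝓝 α)) {e : ι → OnePoint ℝ} {E : OnePoint ℝ}
    (he : ∀ i, e i ∈ unionSpectrum f φ (β i) (paramCantor (β i)))
    (hlim : Tendsto e 𝒰 (𝓝 E)) : E ∈ unionSpectrum f φ α (paramCantor α) := by
  have hex : ∀ i, ∃ u, (u = 0 ∨ u = -1) ∧ ∃ x,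
      e i ∈ extSpectrum (shiftedPotential f (φ u) (β i) x) := by
    intro i
    obtain ⟨θ, hθ, heθ⟩ := mem_iUnion₂.1 (he i)
    obtain ⟨u, hu, x, hx⟩ := exists_hullPotential_eq_of_mem_paramCantor (β i) f φ hθ
    exact ⟨u, hu, x, hx ▸ heθ⟩
  choose u hu x hx using hex
  -- Only two gap coordinates occur, so the ultrafilter selects one of them and the inserted value
  -- is eventually constant.
  have hlimu : ∃ u₀, (u₀ = 0 ∨ u₀ = -1) ∧ ∀ᶠ i in (𝒰 : Filter ι), u i = u₀ := by
    rcases Ultrafilter.eventually_or.1 (Eventually.of_forall hu) with h | h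
    exacts [⟨0, Or.inl rfl, h⟩, ⟨-1, Or.inr rfl, h⟩]
  obtain ⟨u₀, hu₀, huu⟩ := hlimu
  have ht : Tendsto (fun i => φ (u i)) 𝒰 (𝓝 (φ u₀)) := by
    refine tendsto_const_nhds.congr' ?_
    filter_upwards [huu] with i hi
    rw [hi]
  rw [unionSpectrum_paramCantor hd hf hφ hα,
    extSpectrum_oneSided_eq hd hf hφ hα (Or.inl rfl) hu₀ 0 0]
  exact mem_extSpectrum_of_tendsto hd hf hα 𝒰 hβ ht x hx hlim

theorem mem_unionSpectrum_univ_of_tendsto (hd : 1 ≤ d) (hf : HasSimpleDiscontinuity f)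
    (hφ : IsArcParametrization f φ) (hα : RationallyIndependent α) {ι : Type*} (𝒰 : Ultrafilter ι)
    {β : ι → Fin d → ℝ} (hβ : Tendsto β 𝒰 (𝓝 α)) {e : ι → OnePoint ℝ} {E : OnePoint ℝ}
    (he : ∀ i, e i ∈ unionSpectrum f φ (β i) univ) (hlim : Tendsto e 𝒰 (𝓝 E)) :
    E ∈ unionSpectrum f φ α univ := by
  have hex : ∀ i, ∃ u ∈ Icc (-1 : ℝ) 0, ∃ x,
      e i ∈ extSpectrum (shiftedPotential f (φ u) (β i) x) := by
    intro i
    obtain ⟨θ, -, heθ⟩ := mem_iUnion₂.1 (he i)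
    obtain ⟨u, hu, x, hx⟩ := exists_hullPotential_eq (β i) f φ θ
    exact ⟨u, hu, x, hx ▸ heθ⟩
  choose u hu x hx using hex
  obtain ⟨u₀, hu₀, hlimu⟩ := (isCompact_Icc (a := (-1 : ℝ)) (b := 0)).ultrafilter_le_nhds'
    (𝒰.map u) (Ultrafilter.mem_map.2 (univ_mem' hu))
  have ht : Tendsto (fun i => φ (u i)) 𝒰 (𝓝 (φ u₀)) :=
    (hφ.continuousOn u₀ hu₀).tendsto.comp
      (tendsto_nhdsWithin_iff.2 ⟨hlimu, Eventually.of_forall hu⟩)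
  exact extSpectrum_subset_unionSpectrum_univ α hu₀
    (mem_extSpectrum_of_tendsto hd hf hα 𝒰 hβ ht x hx hlim)

/-- A nearest point of each closed spectrum turns the estimates for all δ into a single convergent
family. -/
theorem exists_tendsto_mem_extSpectrum {ι : Type*} {l : Filter ι}
    {V : ι → (Fin d → ℤ) → OnePoint ℝ} {V₀ : (Fin d → ℤ) → OnePoint ℝ} (hV : Tendsto V l (𝓝 V₀))
    {E : OnePoint ℝ} (hE : E ∈ extSpectrum V₀) :
    ∃ e : ι → OnePoint ℝ, (∀ i, e i ∈ extSpectrum (V i)) ∧ Tendsto e l (𝓝 E) := by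
  have hmin : ∀ i, ∃ e ∈ extSpectrum (V i), ∀ e' ∈ extSpectrum (V i),
      dist (cayleyPoint E) (cayleyPoint e) ≤ dist (cayleyPoint E) (cayleyPoint e') := by
    intro i
    obtain ⟨e, he, hmin⟩ := (isClosed_extSpectrum (V i)).isCompact.exists_isMinOn
      (extSpectrum_nonempty (V i))
      (f := fun e => dist (cayleyPoint E) (cayleyPoint e))
      (continuous_const.dist continuous_cayleyPoint).continuousOn
    exact ⟨e, he, fun e' he' => hmin he'⟩
  choose e he hmin using hmin
  refine ⟨e, he, ?_⟩
  rw [isClosedEmbedding_cayleyPoint.isInducing.tendsto_nhds_iff, Metric.tendsto_nhds]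
  intro δ hδ
  filter_upwards [hV.eventually (eventually_exists_extSpectrum_near hE hδ)] with i hi
  obtain ⟨E', hE', hdist⟩ := hi
  rw [dist_comm]
  exact (hmin i E' hE').trans_lt hdist

/-- Failure occurs frequently, hence on a set of some ultrafilter finer than `l`; along it the
offending points converge by compactness of the circle. -/
theorem exists_ultrafilter_of_not_eventually_near {X : Type*} {l : Filter X}
    {A B : X → Set (OnePoint ℝ)} (hne : ∀ x, (A x).Nonempty) {δ : ℝ}
    (hcon : ¬∀ᶠ x in l, ∀ E ∈ A x, ∃ E' ∈ B x, dist (cayleyPoint E) (cayleyPoint E') < δ) :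
    ∃ (𝒰 : Ultrafilter X) (e : X → OnePoint ℝ) (E : OnePoint ℝ), (𝒰 : Filter X) ≤ l ∧
      (∀ x, e x ∈ A x) ∧ Tendsto e 𝒰 (𝓝 E) ∧
      ∀ᶠ x in (𝒰 : Filter X), ∀ E' ∈ B x, δ ≤ dist (cayleyPoint (e x)) (cayleyPoint E') := by
  have hsel : ∀ x, ∃ E ∈ A x,
      (¬∀ E ∈ A x, ∃ E' ∈ B x, dist (cayleyPoint E) (cayleyPoint E') < δ) →
        ∀ E' ∈ B x, δ ≤ dist (cayleyPoint E) (cayleyPoint E') := by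
    intro x
    by_cases h : ∀ E ∈ A x, ∃ E' ∈ B x, dist (cayleyPoint E) (cayleyPoint E') < δ
    · obtain ⟨E, hE⟩ := hne x
      exact ⟨E, hE, fun h' => absurd h h'⟩
    · have h' := h
      push Not at h'
      obtain ⟨E, hE, hE'⟩ := h'
      exact ⟨E, hE, fun _ => hE'⟩
  choose e he hbad using hsel
  replace hcon := frequently_iff_neBot.1 (not_eventually.1 hcon)
  obtain ⟨𝒰, h𝒰⟩ := @Ultrafilter.exists_le _ _ hcon
  obtain ⟨E, -, hE⟩ := isCompact_univ.ultrafilter_le_nhds' (𝒰.map e) univ_mem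
  refine ⟨𝒰, e, E, h𝒰.trans inf_le_left, he, hE, ?_⟩
  filter_upwards [h𝒰 (mem_inf_of_right (mem_principal_self _))] with x hx
  exact hbad x hx

/-- A criterion for continuity of a set-valued map in the Hausdorff distance. -/
theorem tendsto_circleHausdorffEDist {X : Type*} [TopologicalSpace X] {A : X → Set (OnePoint ℝ)}
    {x₀ : X} (hne : ∀ x, (A x).Nonempty)
    (hlow : ∀ E ∈ A x₀, ∀ δ : ℝ, 0 < δ →
      ∀ᶠ x in 𝓝 x₀, ∃ E' ∈ A x, dist (cayleyPoint E) (cayleyPoint E') < δ)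
    (hup : ∀ (𝒰 : Ultrafilter X), (𝒰 : Filter X) ≤ 𝓝 x₀ → ∀ (e : X → OnePoint ℝ) (E : OnePoint ℝ),
      (∀ x, e x ∈ A x) → Tendsto e 𝒰 (𝓝 E) → E ∈ A x₀) :
    Tendsto (fun x => circleHausdorffEDist (A x) (A x₀)) (𝓝 x₀) (𝓝 0) := by
  rw [ENNReal.tendsto_nhds_zero]
  intro ε hε
  obtain ⟨δ, hδ0, hδ⟩ : ∃ δ : ℝ, 0 < δ ∧ ENNReal.ofReal δ ≤ ε := by
    rcases eq_or_ne ε ⊤ with rfl | htop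
    · exact ⟨1, one_pos, le_top⟩
    · exact ⟨ε.toReal, ENNReal.toReal_pos hε.ne' htop, ENNReal.ofReal_toReal_le⟩
  have hupper : ∀ᶠ x in 𝓝 x₀, ∀ E ∈ A x, ∃ E' ∈ A x₀,
      dist (cayleyPoint E) (cayleyPoint E') < δ := by
    by_contra hcon
    obtain ⟨𝒰, e, E, h𝒰, he, hE, hbad⟩ :=
      exists_ultrafilter_of_not_eventually_near (B := fun _ => A x₀) hne hcon
    have hclose := Metric.tendsto_nhds.1 ((continuous_cayleyPoint.tendsto E).comp hE) δ hδ0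
    obtain ⟨x, hx, hx'⟩ := (hclose.and hbad).exists
    exact absurd hx (not_lt.2 (hx' E (hup 𝒰 h𝒰 e E he hE)))
  have hlower : ∀ᶠ x in 𝓝 x₀, ∀ E ∈ A x₀, ∃ E' ∈ A x,
      dist (cayleyPoint E) (cayleyPoint E') < δ := by
    by_contra hcon
    obtain ⟨𝒰, e, E, h𝒰, he, hE, hbad⟩ :=
      exists_ultrafilter_of_not_eventually_near (A := fun _ => A x₀) (fun _ => hne x₀) hcon
    have hclose := Metric.tendsto_nhds.1 ((continuous_cayleyPoint.tendsto E).comp hE) (δ / 3)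
      (by positivity)
    -- The limit E need not belong to A x₀, which is not assumed closed; a nearby point e y of A x₀
    -- replaces it. Three errors below δ/3 then contradict the separation δ.
    obtain ⟨y, hy⟩ := hclose.exists
    have hnear := h𝒰 (hlow (e y) (he y) (δ / 3) (by positivity))
    obtain ⟨x, ⟨hx, hx'⟩, E', hE', hd⟩ := ((hclose.and hbad).and hnear).exists
    have h1 := hx' E' hE'
    have h3 := dist_triangle (cayleyPoint (e x)) (cayleyPoint E) (cayleyPoint E')
    have h4 := dist_triangle (cayleyPoint E) (cayleyPoint (e y)) (cayleyPoint E')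
    rw [dist_comm (cayleyPoint E) (cayleyPoint (e y))] at h4
    simp only [Function.comp_apply] at hx hy
    linarith
  filter_upwards [hupper, hlower] with x h1 h2
  refine (Metric.hausdorffEDist_le_of_mem_edist ?_ ?_).trans hδ
  · rintro _ ⟨E, hE, rfl⟩
    obtain ⟨E', hE', hd⟩ := h1 E hE
    exact ⟨_, mem_image_of_mem _ hE', by rw [edist_dist]; exact ENNReal.ofReal_le_ofReal hd.le⟩
  · rintro _ ⟨E, hE, rfl⟩
    obtain ⟨E', hE', hd⟩ := h2 E hE
    exact ⟨_, mem_image_of_mem _ hE', by rw [edist_dist]; exact ENNReal.ofReal_le_ofReal hd.le⟩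

end Convergence

/-! ### Proof of the theorem -/

theorem theorem4p8 (d : ℕ) (hd : 1 ≤ d) (f : ℝ → EReal) (hf : HasSimpleDiscontinuity f)
    (φ : ℝ → OnePoint ℝ) (hφ : IsArcParametrization f φ)
    (α : Fin d → ℝ) (hα : RationallyIndependent α) :
    -- the spectrum is constant on `C_α`, and on each set `𝒮_{β,t}`, `β` arbitrary
    ((∀ θ ∈ paramCantor α, extSpectrum (hullPotential f φ α θ)
        = unionSpectrum f φ α (paramCantor α)) ∧
      (∀ (β : Fin d → ℝ), ∀ t ∈ φ '' Icc (-1) 0, ∀ θ ∈ paramLevel φ β t,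
        extSpectrum (hullPotential f φ β θ) = unionSpectrum f φ β (paramLevel φ β t))) ∧
    -- rational approximations
    (∀ a : ℕ → Fin d → ℝ, (∀ j i, ∃ q : ℚ, a j i = q) → Tendsto a atTop (𝓝 α) →
      (∀ E : OnePoint ℝ, E ∈ unionSpectrum f φ α (paramCantor α) ↔
        ∃ (e : ℕ → OnePoint ℝ) (θ : ℕ → ParamCircle),
          (∀ j, θ j ∈ paramCantor (a j) ∧ e j ∈ extSpectrum (hullPotential f φ (a j) (θ j))) ∧
          Tendsto e atTop (𝓝 E)) ∧
      (∀ t ∈ φ '' Icc (-1) 0, ∀ E : OnePoint ℝ,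
        E ∈ unionSpectrum f φ α (paramLevel φ α t) ↔
        ∃ (e : ℕ → OnePoint ℝ) (s : ℕ → OnePoint ℝ),
          (∀ j, s j ∈ φ '' Icc (-1) 0 ∧
            e j ∈ unionSpectrum f φ (a j) (paramLevel φ (a j) (s j))) ∧
          Tendsto s atTop (𝓝 t) ∧ Tendsto e atTop (𝓝 E))) ∧
    -- continuity of the union spectra at `α`, in the Hausdorff distance
    (Tendsto (fun β => circleHausdorffEDist (unionSpectrum f φ β (paramCantor β))
        (unionSpectrum f φ α (paramCantor α))) (𝓝 α) (𝓝 0) ∧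
      Tendsto (fun β => circleHausdorffEDist (unionSpectrum f φ β univ)
        (unionSpectrum f φ α univ)) (𝓝 α) (𝓝 0)) := by
  have h𝒰 : (Ultrafilter.of (atTop : Filter ℕ) : Filter ℕ) ≤ atTop := Ultrafilter.of_le _
  refine ⟨⟨fun θ hθ => ?_, fun β t ht θ hθ => ?_⟩, fun a _ ha => ⟨fun E => ⟨fun hE => ?_, ?_⟩,
    fun t ht E => ⟨fun hE => ?_, ?_⟩⟩, ?_, ?_⟩
  · rw [extSpectrum_hullPotential_of_mem_paramCantor hd hf hφ hα hθ,
      unionSpectrum_paramCantor hd hf hφ hα]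
  · rw [extSpectrum_hullPotential_of_mem_paramLevel hf hθ, unionSpectrum_paramLevel hf ht]
  · rw [unionSpectrum_paramCantor hd hf hφ hα] at hE
    obtain ⟨e, he, hlim⟩ := exists_tendsto_mem_extSpectrum
      ((tendsto_shiftedPotential_zero hf hα (φ 0)).comp ha) hE
    -- The point h(0) belongs to every set C_β and carries the potential at phase 0 with the value
    -- f(0) inserted.
    refine ⟨e, fun j => ((hullStep (a j) 0 : ℝ) : ParamCircle), fun j =>
      ⟨hullStep_mem_paramCantor _ ⟨le_rfl, zero_le_one⟩, ?_⟩, hlim⟩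
    rw [hullPotential_hullStep (a j) f φ ⟨le_rfl, zero_lt_one⟩]
    exact he j
  · rintro ⟨e, θ, h, hlim⟩
    exact mem_extSpectrum_of_tendsto_paramCantor hd hf hφ hα (Ultrafilter.of atTop)
      (ha.mono_left h𝒰) (fun j => mem_iUnion₂.2 ⟨θ j, (h j).1, (h j).2⟩) (hlim.mono_left h𝒰)
  · rw [unionSpectrum_paramLevel hf ht] at hE
    obtain ⟨e, he, hlim⟩ := exists_tendsto_mem_extSpectrum
      ((tendsto_shiftedPotential_zero hf hα t).comp ha) hE
    -- A constant sequence of inserted values suffices for this direction.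
    refine ⟨e, fun _ => t, fun j => ⟨ht, ?_⟩, tendsto_const_nhds, hlim⟩
    rw [unionSpectrum_paramLevel hf ht]
    exact he j
  · rintro ⟨e, s, h, hs, hlim⟩
    rw [unionSpectrum_paramLevel hf ht]
    refine mem_extSpectrum_of_tendsto hd hf hα (Ultrafilter.of atTop) (ha.mono_left h𝒰)
      (hs.mono_left h𝒰) (fun _ => 0) (fun j => ?_) (hlim.mono_left h𝒰)
    rw [← unionSpectrum_paramLevel hf (h j).1]
    exact (h j).2
  · refine tendsto_circleHausdorffEDist (A := fun β => unionSpectrum f φ β (paramCantor β))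
      (fun β => (extSpectrum_nonempty _).mono (extSpectrum_subset_unionSpectrum_paramCantor β))
      (fun E hE δ hδ => ?_) (fun 𝒰 h e E he hlim =>
        mem_extSpectrum_of_tendsto_paramCantor hd hf hφ hα 𝒰 h he hlim)
    rw [unionSpectrum_paramCantor hd hf hφ hα] at hE
    filter_upwards [(tendsto_shiftedPotential_zero hf hα (φ 0)).eventually
      (eventually_exists_extSpectrum_near hE hδ)] with β hβ
    obtain ⟨E', hE', hdist⟩ := hβ
    exact ⟨E', extSpectrum_subset_unionSpectrum_paramCantor β hE', hdist⟩
  · refine tendsto_circleHausdorffEDist (A := fun β => unionSpectrum f φ β univ)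
      (fun β => (extSpectrum_nonempty _).mono
        (extSpectrum_subset_unionSpectrum_univ β (u := 0) (by norm_num)))
      (fun E hE δ hδ => ?_) (fun 𝒰 h e E he hlim =>
        mem_unionSpectrum_univ_of_tendsto hd hf hφ hα 𝒰 h he hlim)
    obtain ⟨θ, -, hθ⟩ := mem_iUnion₂.1 hE
    obtain ⟨u, hu, x, hx⟩ := exists_hullPotential_eq α f φ θ
    rw [hx] at hθ
    -- The energy is moved to phase 0 with the same inserted value, where the potential depends
    -- continuously on the frequency at α.
    have hE0 := extSpectrum_shiftedPotential_subset_zero hd hf hα _ _ hθ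
    filter_upwards [(tendsto_shiftedPotential_zero hf hα (φ u)).eventually
      (eventually_exists_extSpectrum_near hE0 hδ)] with β hβ
    obtain ⟨E', hE', hdist⟩ := hβ
    exact ⟨E', extSpectrum_subset_unionSpectrum_univ β hu hE', hdist⟩
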